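/- Let $T>0$, $d,m,r\in\mathbb N$, let $(\Omega,\mathscr F,\mathbb P)$ be a probability space and $\boldsymbol B$ an $m$-dimensional Brownian motion on it. Let $\mathscr F(t)$ be the $\sigma$-algebra generated by $\{\boldsymbol B(s):0\le s\le t\}$ and the $\mathbb P$-null sets in $\mathscr F$, let $\mathscr F_\circ\subset\mathscr F$ be a sub-$\sigma$-algebra independent of $\mathscr F(T)$, and put $\mathscr F_\circ(t)=\sigma(\mathscr F(t)\cup\mathscr F_\circ)$. Let $\mathscr X$ be the space of all progressively measurable (with respect to $\{\mathscr F_\circ(t)\}$) processes on $[0,T]$ with almost surely continuous paths of the form $$\boldsymbol Y(t)=\boldsymbol Y_\circ+\int_0^t \mathtt a(s)\,ds+\int_0^t\mathtt b(s)\,d\boldsymbol B(s)\quad\text{a.s., for every }t\in[0,T],$$ where $\boldsymbol Y_\circ\in L^2(\Omega;\mathbb R^d)$ is $\mathscr F_\circ$-measurable, and $\mathtt a$, $\mathtt b$ are $\{\mathscr F_\circ(t)\}$-progressively measurable processes in $L^2(\Omega\times(0,T);\mathbb R^d)$ and $L^2(\Omega\times(0,T);\mathbb R^{d\times m})$; the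 stochastic integral is the $L^2$ Itô integral. The triple $(\boldsymbol Y_\circ,\mathtt a,\mathtt b)$ is unique up to null sets, and $$\|\boldsymbol Y\|_{\mathscr X}=\Big(\mathbb E\|\boldsymbol Y_\circ\|^2+\mathbb E\int_0^T\|\mathtt a(s)\|^2+\|\mathtt b(s)\|_{\mathrm F}^2\,ds\Big)^{1/2}.$$ Let $\mathscr U=L^2(0,T;\mathbb R^r)$, let $u_{\mathsf a}\le u_{\mathsf b}$ in $\mathbb R^r$ (componentwise), and $\mathscr U_{\mathsf{ad}}=\{u\in\mathscr U: u(t)\in[u_{\mathsf a},u_{\mathsf b}]\text{ for a.a. }t\in[0,T]\}$. Let $a:\mathbb R^d\times\mathbb R^r\times[0,T]\to\mathbb R^d$ and $b:\mathbb R^d\times\mathbb R^r\times[0,T]\to\mathbb R^{d\times m}$ be measurable, and let $L>0$ be such that, for almost all $t\in[0,T]$ and all $x,\tilde x\in\mathbb R^d$, $v,\tilde v\in[u_{\mathsf a},u_{\mathsf b}]$, $$\|a(x,v,t)-a(\tilde x,\tilde v,t)\|+\|b(x,v,t)-b(\tilde x,\tilde v,t)\|_{\mathrm F}\le L\,(\|x-\tilde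 x\|+\|v-\tilde v\|),$$ and, for all $u\in\mathscr U_{\mathsf{ad}}$, $$\int_0^T\|a(0,u(t),t)\|^2+\|b(0,u(t),t)\|_{\mathrm F}^2\,dt\le L^2.$$ Let $\boldsymbol X_\circ\in L^2(\Omega;\mathbb R^d)$ be $\mathscr F_\circ$-measurable. Then for every $u\in\mathscr U_{\mathsf{ad}}$ the equation $$\boldsymbol X(t)=\boldsymbol X_\circ+\int_0^t a(\boldsymbol X(s),u(s),s)\,ds+\int_0^t b(\boldsymbol X(s),u(s),s)\,d\boldsymbol B(s)\quad\text{in }L^2(\Omega;\mathbb R^d),\ t\in[0,T],$$ has a solution $\mathcal S(u)\in\mathscr X$, unique up to indistinguishability, and $\mathcal S(u)\in C([0,T];L^2(\Omega;\mathbb R^d))$. Moreover, there are constants $C_1,C_1'\ge0$ depending only on $L$ and $T$, and constants $C_2,C_2'\ge0$ depending only on $L$, $T$ and $\boldsymbol X_\circ$, such that for all $u,\tilde u\in\mathscr U_{\mathsf{ad}}$ $$\|\mathcal S(u)-\mathcal S(\tilde u)\|_{C([0,T];L^2(\Omega;\mathbb R^d))}\le C_1\|u-\tilde u\|_{\mathscr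 U},\qquad \|\mathcal S(u)\|_{C([0,T];L^2(\Omega;\mathbb R^d))}\le C_2,$$ $$\|\mathcal S(u)-\mathcal S(\tilde u)\|_{\mathscr X}\le C_1'\|u-\tilde u\|_{\mathscr U},\qquad \|\mathcal S(u)\|_{\mathscr X}\le C_2'.$$ Here $\|\boldsymbol Y\|_{C([0,T];L^2(\Omega;\mathbb R^d))}=\sup_{t\in[0,T]}\big(\mathbb E\|\boldsymbol Y(t)\|^2\big)^{1/2}$. -/

import Mathlib

open MeasureTheory ProbabilityTheory Filter Topology Set
open scoped ENNReal NNReal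

namespace SDEControl

/-- `ℝⁿ` with the Euclidean norm. -/
abbrev Vec (n : ℕ) : Type := EuclideanSpace ℝ (Fin n)

/-- `d × m` real matrices; the Euclidean norm of the entries is the Frobenius norm. -/
abbrev Mat (d m : ℕ) : Type := EuclideanSpace ℝ (Fin d × Fin m)

/-- Matrix-vector product. -/
noncomputable def matVec {d m : ℕ} (M : Mat d m) (v : Vec m) : Vec d :=
  WithLp.toLp 2 fun i => ∑ j, M (i, j) * v j

section Noise

variable {Ω : Type*} [mΩ : MeasurableSpace Ω]

/-- `B = (B₁, …, B_m)` is an `m`-dimensional Brownian motion: its components are independent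
real Brownian motions (starting at `0`, with almost surely continuous paths). -/
structure IsBrownianMotion {m : ℕ} (B : Fin m → ℝ≥0 → Ω → ℝ) (P : Measure Ω) : Prop where
  measurable : ∀ i t, Measurable (B i t)
  brownian : ∀ i, IsBrownianReal (B i) P
  indep : iIndepFun (fun (i : Fin m) (ω : Ω) (t : ℝ≥0) => B i t ω) P

/-- The filtration `𝓕(t)`: generated by `B(s)`, `0 ≤ s ≤ t`, and by all `P`-null events. -/
@[reducible] def brownianFiltration {m : ℕ} (B : Fin m → ℝ≥0 → Ω → ℝ) (P : Measure Ω) (t : ℝ) :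
    MeasurableSpace Ω :=
  (⨆ (i : Fin m) (s : ℝ≥0) (_ : (s : ℝ) ≤ t), MeasurableSpace.comap (B i s) inferInstance) ⊔
    MeasurableSpace.generateFrom {A | MeasurableSet A ∧ P A = 0}

/-- The random input on the horizon `[0, T]`: an `m`-dimensional Brownian motion `B` and a
sub-`σ`-algebra `F₀` of initial information which is independent of `𝓕(T)`. -/
structure Noise (P : Measure Ω) (T : ℝ) (m : ℕ) where
  B : Fin m → ℝ≥0 → Ω → ℝ
  isBrownian : IsBrownianMotion B P
  F₀ : MeasurableSpace Ω
  F₀_le : F₀ ≤ mΩ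
  indep : @Indep Ω F₀ (@brownianFiltration Ω mΩ m B P T) mΩ P

variable {P : Measure Ω} {T : ℝ} {m d : ℕ}

/-- The extended filtration `σ(𝓕(t) ∪ F₀)`. -/
@[reducible] def Noise.filtration (N : Noise P T m) (t : ℝ) : MeasurableSpace Ω :=
  brownianFiltration N.B P t ⊔ N.F₀

/-- The increment `B(t) - B(s)` for `0 ≤ s ≤ t`. -/
noncomputable def Noise.increment (N : Noise P T m) (s t : ℝ) (ω : Ω) : Vec m :=
  WithLp.toLp 2 fun i => N.B i t.toNNReal ω - N.B i s.toNNReal ω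

/-- Progressive measurability on `[0, τ]` with respect to the extended filtration. Only the
values of the process at times in `[0, τ]` matter. -/
def Noise.Progressive (N : Noise P T m) (τ : ℝ) {V : Type*} [MeasurableSpace V]
    (Y : ℝ → Ω → V) : Prop :=
  ∀ t ∈ Icc (0 : ℝ) τ,
    Measurable[Subtype.instMeasurableSpace.prod (N.filtration t)]
      fun p : Icc (0 : ℝ) t × Ω => Y p.1 p.2

/-- `E ∫₀^τ ‖Y(s)‖² ds`, as an extended nonnegative number. -/
noncomputable def energy (P : Measure Ω) (τ : ℝ) {V : Type*} [NormedAddCommGroup V]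
    (Y : ℝ → Ω → V) : ℝ≥0∞ :=
  ∫⁻ ω, (∫⁻ s in Icc (0 : ℝ) τ, ‖Y s ω‖ₑ ^ 2) ∂P

/-- `Y` is a progressively measurable process in `L²(Ω × (0, τ); V)`. -/
structure Noise.MemL2 (N : Noise P T m) (τ : ℝ) {V : Type*} [NormedAddCommGroup V]
    [MeasurableSpace V] (Y : ℝ → Ω → V) : Prop where
  progressive : N.Progressive τ Y
  energy_lt_top : energy P τ Y < ∞

/-- A simple integrand `∑ₖ ξₖ 1_{(sₖ, tₖ]}` on `[0, τ]`, with `ξₖ` square integrable and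
measurable with respect to the extended filtration at time `sₖ`. -/
structure SimpleIntegrand (N : Noise P T m) (τ : ℝ) (d : ℕ) where
  n : ℕ
  left : Fin n → ℝ
  right : Fin n → ℝ
  coeff : Fin n → Ω → Mat d m
  left_nonneg : ∀ k, 0 ≤ left k
  left_le_right : ∀ k, left k ≤ right k
  right_le : ∀ k, right k ≤ τ
  measurable_coeff : ∀ k, Measurable[N.filtration (left k)] (coeff k)
  memLp_coeff : ∀ k, MemLp (coeff k) 2 P

/-- The process `∑ₖ ξₖ 1_{(sₖ, tₖ]}`. -/
noncomputable def SimpleIntegrand.process {N : Noise P T m} {τ : ℝ}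
    (H : SimpleIntegrand N τ d) (s : ℝ) (ω : Ω) : Mat d m :=
  ∑ k, (Ioc (H.left k) (H.right k)).indicator (fun _ => H.coeff k ω) s

/-- The elementary stochastic integral `∑ₖ ξₖ (B(tₖ) - B(sₖ))`. -/
noncomputable def SimpleIntegrand.integral {N : Noise P T m} {τ : ℝ}
    (H : SimpleIntegrand N τ d) (ω : Ω) : Vec d :=
  ∑ k, matVec (H.coeff k ω) (N.increment (H.left k) (H.right k) ω)

/-- `I` is (a version of) the Itô integral `∫₀^τ b(s) dB(s)` in the `L²` sense: `b` is
progressively measurable and square integrable, and `I` is the limit in `L²(Ω)` of the elementary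
integrals of simple integrands which converge to `b` in `L²(Ω × (0, τ))`. -/
structure Noise.HasItoIntegral (N : Noise P T m) (b : ℝ → Ω → Mat d m) (τ : ℝ)
    (I : Ω → Vec d) : Prop where
  memL2 : N.MemL2 τ b
  memLp : MemLp I 2 P
  approx : ∃ H : ℕ → SimpleIntegrand N τ d,
    Tendsto (fun n => energy P τ fun s ω => (H n).process s ω - b s ω) atTop (𝓝 0) ∧
    Tendsto (fun n => eLpNorm (fun ω => (H n).integral ω - I ω) 2 P) atTop (𝓝 0)

/-- For every `t ∈ [0, T]`, almost surely
`Y(t) = Y₀ + ∫₀ᵗ a(s) ds + ∫₀ᵗ b(s) dB(s)`. -/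
def Noise.ItoEquation (N : Noise P T m) (Y : ℝ → Ω → Vec d) (Y₀ : Ω → Vec d)
    (a : ℝ → Ω → Vec d) (b : ℝ → Ω → Mat d m) : Prop :=
  ∀ t ∈ Icc (0 : ℝ) T, ∃ I : Ω → Vec d, N.HasItoIntegral b t I ∧
    ∀ᵐ ω ∂P, Y t ω = Y₀ ω + (∫ s in (0 : ℝ)..t, a s ω) + I ω

/-- Triples (initial value, drift part, diffusion part). -/
structure Characteristics (Ω : Type*) (d m : ℕ) where
  init : Ω → Vec d
  drift : ℝ → Ω → Vec d
  diffusion : ℝ → Ω → Mat d m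

/-- The triple `(Y₀, a, b)` represents the process `Y`, that is `Y = Φ(Y₀, a, b)`, where `Y₀` is
square integrable and `F₀`-measurable and `a`, `b` are progressively measurable and square
integrable. -/
structure Noise.Represents (N : Noise P T m) (c : Characteristics Ω d m)
    (Y : ℝ → Ω → Vec d) : Prop where
  measurable_init : Measurable[N.F₀] c.init
  memLp_init : MemLp c.init 2 P
  drift_memL2 : N.MemL2 T c.drift
  diffusion_memL2 : N.MemL2 T c.diffusion
  equation : N.ItoEquation Y c.init c.drift c.diffusion

/-- Membership in the space `𝒳` of Itô processes on `[0, T]`: progressively measurable processes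
with almost surely continuous paths which are represented by some triple `(Y₀, a, b)`. -/
structure Noise.MemX (N : Noise P T m) (Y : ℝ → Ω → Vec d) : Prop where
  progressive : N.Progressive T Y
  continuous_paths : ∀ᵐ ω ∂P, ContinuousOn (fun t => Y t ω) (Icc (0 : ℝ) T)
  representable : ∃ c : Characteristics Ω d m, N.Represents c Y

/-- `(E‖Y₀‖² + E ∫₀ᵀ (‖a(s)‖² + ‖b(s)‖_F²) ds)^{1/2}`. -/
noncomputable def Characteristics.norm (c : Characteristics Ω d m) (P : Measure Ω) (T : ℝ) :
    ℝ≥0∞ :=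
  ((∫⁻ ω, ‖c.init ω‖ₑ ^ 2 ∂P) + (energy P T c.drift + energy P T c.diffusion)) ^ (1 / 2 : ℝ)

open Classical in
/-- The norm of `𝒳`: the norm of the (almost everywhere unique) triple representing the process;
it is `∞` for processes outside `𝒳`. -/
noncomputable def Noise.normX (N : Noise P T m) (Y : ℝ → Ω → Vec d) : ℝ≥0∞ :=
  if h : N.MemX Y then (Classical.choose h.representable).norm P T else ∞

/-- `Y` belongs to `C([0, T]; L²(Ω; ℝᵈ))`. -/
structure MemCL2 (P : Measure Ω) (T : ℝ) (Y : ℝ → Ω → Vec d) : Prop where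
  memLp : ∀ t ∈ Icc (0 : ℝ) T, MemLp (Y t) 2 P
  continuous : ∀ t₀ ∈ Icc (0 : ℝ) T,
    Tendsto (fun t => eLpNorm (Y t - Y t₀) 2 P) (𝓝[Icc (0 : ℝ) T] t₀) (𝓝 0)

/-- `sup_{t ∈ [0, T]} ‖Y(t)‖_{L²(Ω; ℝᵈ)}`. -/
noncomputable def normCL2 (P : Measure Ω) (T : ℝ) (Y : ℝ → Ω → Vec d) : ℝ≥0∞ :=
  ⨆ t ∈ Icc (0 : ℝ) T, eLpNorm (Y t) 2 P

end Noise

/-- The control space `𝒰 = L²(0, T; ℝʳ)`. -/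
abbrev ControlSpace (T : ℝ) (r : ℕ) : Type :=
  Lp (Vec r) 2 ((volume : Measure ℝ).restrict (Icc (0 : ℝ) T))

/-- The box `[u_a, u_b]` in `ℝʳ`. -/
def box {r : ℕ} (ua ub : Vec r) : Set (Vec r) := {v | ∀ i, ua i ≤ v i ∧ v i ≤ ub i}

/-- The admissible controls `𝒰_ad`. -/
def admissible (T : ℝ) {r : ℕ} (ua ub : Vec r) : Set (ControlSpace T r) :=
  {u | ∀ᵐ t ∂(volume : Measure ℝ).restrict (Icc (0 : ℝ) T), u t ∈ box ua ub}

/-- The hypotheses on the drift coefficient `a` and the diffusion coefficient `b`, with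
constant `L`. Only the values at times in `[0, T]` matter. -/
structure CoefficientAssumption {d r m : ℕ} (T L : ℝ) (ua ub : Vec r)
    (a : Vec d → Vec r → ℝ → Vec d) (b : Vec d → Vec r → ℝ → Mat d m) : Prop where
  measurable_drift : Measurable fun p : Vec d × Vec r × Icc (0 : ℝ) T => a p.1 p.2.1 p.2.2
  measurable_diffusion : Measurable fun p : Vec d × Vec r × Icc (0 : ℝ) T => b p.1 p.2.1 p.2.2
  lipschitz : ∀ᵐ t ∂(volume : Measure ℝ).restrict (Icc (0 : ℝ) T),
    ∀ x x' : Vec d, ∀ v ∈ box ua ub, ∀ v' ∈ box ua ub,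
      ‖a x v t - a x' v' t‖ + ‖b x v t - b x' v' t‖ ≤ L * (‖x - x'‖ + ‖v - v'‖)
  bound : ∀ u ∈ admissible T ua ub,
    ∫⁻ t in Icc (0 : ℝ) T, (‖a 0 (u t) t‖ₑ ^ 2 + ‖b 0 (u t) t‖ₑ ^ 2) ≤ ENNReal.ofReal (L ^ 2)

section Solutions

variable {Ω : Type*} [mΩ : MeasurableSpace Ω] {P : Measure Ω} {T : ℝ} {d r m : ℕ}

/-- `X` is a solution in `𝒳` of
`dX(t) = a(X(t), u(t), t) dt + b(X(t), u(t), t) dB(t)`, `X(0) = X₀`, on `[0, T]`. -/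
structure IsSolution (N : Noise P T m) (a : Vec d → Vec r → ℝ → Vec d)
    (b : Vec d → Vec r → ℝ → Mat d m) (X₀ : Ω → Vec d) (u : ControlSpace T r)
    (X : ℝ → Ω → Vec d) : Prop where
  memX : N.MemX X
  equation : N.ItoEquation X X₀ (fun s ω => a (X s ω) (u s) s) (fun s ω => b (X s ω) (u s) s)

/-- `X` is a solution, and every other solution is indistinguishable from it on `[0, T]`. -/
structure IsUniqueSolution (N : Noise P T m) (a : Vec d → Vec r → ℝ → Vec d)
    (b : Vec d → Vec r → ℝ → Mat d m) (X₀ : Ω → Vec d) (u : ControlSpace T r)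
    (X : ℝ → Ω → Vec d) : Prop where
  isSolution : IsSolution N a b X₀ u X
  unique : ∀ Z : ℝ → Ω → Vec d, IsSolution N a b X₀ u Z →
    ∀ᵐ ω ∂P, ∀ t ∈ Icc (0 : ℝ) T, X t ω = Z t ω

/-- The control-to-state map `𝒮`: it assigns to a control `u` a solution of the state equation
(an arbitrary process if there is none). -/
noncomputable def controlToState (N : Noise P T m) (a : Vec d → Vec r → ℝ → Vec d)
    (b : Vec d → Vec r → ℝ → Mat d m) (X₀ : Ω → Vec d) (u : ControlSpace T r) :
    ℝ → Ω → Vec d :=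
  Classical.epsilon fun X => IsSolution N a b X₀ u X

end Solutions

end SDEControl

/-! For a progressive square integrable X, let Y be the Itô process with initial value X₀, drift
a(X, u, ·) and diffusion b(X, u, ·); a solution is a fixed point of X ↦ Y. The Itô isometry for the
stochastic integral, Cauchy–Schwarz for the drift and the Lipschitz condition give E‖Y(t) - Y'(t)‖²
≤ K (‖u - u'‖² + ∫₀ᵗ E‖X - X'‖² ds), with K = 16 (T + 1) L² (`power_sub_le_of_represents`), and a
growth bound of the same shape (`power_le_of_represents`). Against the weight exp(4 K t),
integration in time gains a factor 1/4. So the Picard iterates converge geometrically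
(`exists_isSolution`), and for solutions, where Y = X, `gronwall` yields uniqueness, boundedness and
Lipschitz dependence on u in C([0,T]; L²).

For the norm of 𝒳, the difference of two solutions is represented by the differences of their
coefficients, and the Lipschitz condition bounds these by the distance just estimated. This requires
the norm to be independent of the representing triple. If a triple represents the zero process, its
initial value vanishes at time 0, and on every [s, t] the stochastic integral is minus the drift
integral; by the isometry the diffusion energy on [s, t] is at most t - s times the drift energy,
and repeated bisection forces it to be zero. The drift then has a vanishing primitive
(`Noise.Represents.eq_zero`).

The Itô integral is defined only as an L² limit at a fixed time, so its theory is developed first: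
Brownian increments are independent of the extended filtration (`Noise.indep_increment`), simple
integrands satisfy the isometry and are dense (`exists_simpleIntegrand_tendsto`), and the indefinite
integral has a continuous adapted version (`exists_itoProcess`), by a maximal inequality and
Borel–Cantelli. Since the filtration contains all null events, a process may be set to zero on a
null event without losing adaptedness. -/

namespace SDEControl

/-! ### Independence of σ-algebras, and of the past and future of Brownian motion -/

section Independence

variable {Ω : Type*} [mΩ : MeasurableSpace Ω] {P : Measure Ω}

/-- Adding null events to a `σ`-algebra preserves independence. -/
lemma indep_sup_null [IsProbabilityMeasure P] {G D : MeasurableSpace Ω} (h : Indep G D P) :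
    Indep (G ⊔ MeasurableSpace.generateFrom {A | MeasurableSet[mΩ] A ∧ P A = 0}) D P := by
  rw [Indep_iff]
  intro A B hA hB
  -- The sets that agree almost everywhere with a set of `G` form a σ-algebra, so every set of the
  -- enlarged σ-algebra can be replaced by one of `G`.
  have hle : G ⊔ MeasurableSpace.generateFrom {A | MeasurableSet[mΩ] A ∧ P A = 0} ≤
      @eventuallyMeasurableSpace Ω G (ae P) _ := by
    refine sup_le (@le_eventuallyMeasurableSpace Ω G (ae P) _)
      (MeasurableSpace.generateFrom_le ?_)
    rintro A ⟨-, hA⟩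
    exact ⟨∅, @MeasurableSet.empty _ G, ae_eq_empty.2 hA⟩
  obtain ⟨A', hA', hAA⟩ := hle A hA
  rw [measure_congr hAA, measure_congr (hAA.inter (EventuallyEq.refl (ae P) B))]
  exact (Indep_iff _ _ _).1 h A' B hA' hB

/-- For g, f, B in `G`, `F`, `D` one has P(g ∩ f ∩ B) = P(f) P(g ∩ B) = P(f) P(g) P(B) = P(g ∩ f)
P(B), and the sets g ∩ f form a π-system generating `G ⊔ F`. It serves to adjoin the initial
information to the Brownian past. -/
lemma indep_sup_left_of_indep [IsProbabilityMeasure P] {G D F : MeasurableSpace Ω}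
    (hG : G ≤ mΩ) (hD : D ≤ mΩ) (hF : F ≤ mΩ)
    (hGD : Indep G D P) (hF' : Indep F (G ⊔ D) P) : Indep (G ⊔ F) D P := by
  set π : Set (Set Ω) := image2 (· ∩ ·) {s | MeasurableSet[G] s} {s | MeasurableSet[F] s} with hπ
  have hgen : G ⊔ F = MeasurableSpace.generateFrom π := by
    apply le_antisymm
    · refine sup_le (fun s hs => ?_) (fun s hs => ?_)
      · exact MeasurableSpace.measurableSet_generateFrom
          ⟨s, hs, univ, @MeasurableSet.univ _ F, inter_univ s⟩
      · exact MeasurableSpace.measurableSet_generateFrom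
          ⟨univ, @MeasurableSet.univ _ G, s, hs, univ_inter s⟩
    · refine MeasurableSpace.generateFrom_le ?_
      rintro _ ⟨s, hs, t, ht, rfl⟩
      exact @MeasurableSet.inter _ (G ⊔ F) _ _ (le_sup_left (a := G) (b := F) s hs)
        (le_sup_right (a := G) (b := F) t ht)
  have hpi : IsPiSystem π := by
    rintro _ ⟨s, hs, t, ht, rfl⟩ _ ⟨s', hs', t', ht', rfl⟩ -
    exact ⟨s ∩ s', @MeasurableSet.inter _ G _ _ hs hs', t ∩ t',
      @MeasurableSet.inter _ F _ _ ht ht', inter_inter_inter_comm _ _ _ _⟩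
  refine IndepSets.indep (sup_le hG hF) hD hpi
    (@MeasurableSpace.isPiSystem_measurableSet _ D) hgen
    (@MeasurableSpace.generateFrom_measurableSet _ D).symm ?_
  rw [IndepSets_iff]
  rintro _ B ⟨s, hs, t, ht, rfl⟩ hB
  have hGs : MeasurableSet[G ⊔ D] s := le_sup_left (a := G) (b := D) s hs
  have hDB : MeasurableSet[G ⊔ D] B := le_sup_right (a := G) (b := D) B hB
  have h1 := (Indep_iff _ _ _).1 hF' t (s ∩ B) ht (@MeasurableSet.inter _ (G ⊔ D) _ _ hGs hDB)
  have h2 := (Indep_iff _ _ _).1 hF' t s ht hGs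
  have h3 := (Indep_iff _ _ _).1 hGD s B hs hB
  simp only
  rw [show s ∩ t ∩ B = t ∩ (s ∩ B) by ext; simp; tauto, h1, h3, inter_comm s t, h2, mul_assoc]

lemma iIndepFun_bool {β : Bool → Type*} [∀ i, MeasurableSpace (β i)] [IsProbabilityMeasure P]
    {f : ∀ i, Ω → β i} (h : IndepFun (f true) (f false) P) : iIndepFun f P := by
  rw [iIndepFun_iff]
  intro S g hg
  have hS : S = ∅ ∨ S = {true} ∨ S = {false} ∨ S = {true, false} := by
    clear hg; revert S; decide
  rcases hS with rfl | rfl | rfl | rfl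
  · simp
  · simp
  · simp
  · have := (Indep_iff _ _ _).1 h (g true) (g false) (hg true (by simp)) (hg false (by simp))
    have h' : (⋂ i : Bool, g i) = g true ∩ g false := by
      ext ω; simp [and_comm]
    simpa [h'] using this

/-- Each component splits into its path stopped at `t₀` and its shifted increments, which are
independent by the Markov property. As the components are independent too, all these blocks are
jointly independent and may be grouped into past and future. -/
lemma IsBrownianMotion.indep_past_shift {m : ℕ} [IsProbabilityMeasure P]
    {B : Fin m → ℝ≥0 → Ω → ℝ} (hB : IsBrownianMotion B P) (t₀ : ℝ≥0) :
    Indep (⨆ (i : Fin m) (s : ℝ≥0) (_ : s ≤ t₀), MeasurableSpace.comap (B i s) inferInstance)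
      (⨆ (i : Fin m) (s : ℝ≥0),
        MeasurableSpace.comap (fun ω => B i (t₀ + s) ω - B i t₀ ω) inferInstance) P := by
  let X : Fin m → Bool → Ω → (ℝ≥0 → ℝ) := fun i c ω =>
    if c then fun t => B i (t₀ + t) ω - B i t₀ ω else fun t => B i (min t t₀) ω
  have hXm : ∀ i c, Measurable (X i c) := by
    intro i c
    cases c
    · exact measurable_pi_lambda _ fun t => hB.measurable i _
    · exact measurable_pi_lambda _ fun t => (hB.measurable i _).sub (hB.measurable i _)
  have h1 : iIndepFun (fun i ω => (X i · ω)) P := by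
    refine hB.indep.comp (fun i (p : ℝ≥0 → ℝ) (c : Bool) (t : ℝ≥0) =>
      if c then p (t₀ + t) - p t₀ else p (min t t₀)) (fun i => ?_) |>.congr ?_
    · refine measurable_pi_lambda _ fun c => measurable_pi_lambda _ fun t => ?_
      cases c
      · exact measurable_pi_apply _
      · exact (measurable_pi_apply _).sub (measurable_pi_apply _)
    · intro i
      refine Eventually.of_forall fun ω => ?_
      funext c t
      cases c <;> simp [X]
  have h2 : ∀ i, iIndepFun (X i) P := by
    intro i
    refine iIndepFun_bool ?_
    have := (hB.brownian i).toIsPreBrownianReal.indepFun_shift t₀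
    refine this.comp (φ := id) (ψ := fun (p : Iic t₀ → ℝ) (t : ℝ≥0) =>
      p ⟨min t t₀, mem_Iic.2 (min_le_right t t₀)⟩) measurable_id
      (measurable_pi_lambda _ fun t =>
        measurable_pi_apply (⟨min t t₀, mem_Iic.2 (min_le_right t t₀)⟩ : Iic t₀))
  have h3 := iIndepFun_uncurry' hXm h1 h2
  rw [iIndepFun_iff_iIndep] at h3
  have h4 := indep_iSup_of_disjoint (S := {p : Fin m × Bool | p.2 = false})
    (T := {p : Fin m × Bool | p.2 = true}) (fun p => (hXm p.1 p.2).comap_le) h3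
    (Set.disjoint_left.2 fun p hp hq => by simp_all)
  refine indep_of_indep_of_le h4 ?_ ?_
  · refine iSup_le fun i => iSup_le fun s => iSup_le fun hs => ?_
    refine le_trans ?_ (le_iSup₂ (f := fun (p : Fin m × Bool)
      (_ : p ∈ {p : Fin m × Bool | p.2 = false}) =>
        MeasurableSpace.comap (fun ω => X p.1 p.2 ω) inferInstance) (i, false) rfl)
    have : B i s = (fun p : ℝ≥0 → ℝ => p s) ∘ fun ω => X i false ω := by
      funext ω; simp [X, min_eq_left hs]
    rw [this, ← MeasurableSpace.comap_comp]
    exact MeasurableSpace.comap_mono (measurable_pi_apply s).comap_le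
  · refine iSup_le fun i => iSup_le fun s => ?_
    refine le_trans ?_ (le_iSup₂ (f := fun (p : Fin m × Bool)
      (_ : p ∈ {p : Fin m × Bool | p.2 = true}) =>
        MeasurableSpace.comap (fun ω => X p.1 p.2 ω) inferInstance) (i, true) rfl)
    have : (fun ω => B i (t₀ + s) ω - B i t₀ ω) =
        (fun p : ℝ≥0 → ℝ => p s) ∘ fun ω => X i true ω := by
      funext ω; simp [X]
    rw [this, ← MeasurableSpace.comap_comp]
    exact MeasurableSpace.comap_mono (measurable_pi_apply s).comap_le

end Independence

/-! ### Independence of Brownian increments from the extended filtration -/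

section Increments

variable {Ω : Type*} [mΩ : MeasurableSpace Ω] {P : Measure Ω} {T : ℝ} {m d : ℕ}

lemma IsBrownianMotion.brownianFiltration_le {B : Fin m → ℝ≥0 → Ω → ℝ}
    (hB : IsBrownianMotion B P) (t : ℝ) : brownianFiltration B P t ≤ mΩ := by
  refine sup_le (iSup_le fun i => iSup_le fun s => iSup_le fun _ => (hB.measurable i s).comap_le)
    (MeasurableSpace.generateFrom_le fun A hA => hA.1)

lemma Noise.filtration_le (N : Noise P T m) (t : ℝ) : N.filtration t ≤ mΩ :=
  sup_le (N.isBrownian.brownianFiltration_le t) N.F₀_le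

lemma brownianFiltration_mono (B : Fin m → ℝ≥0 → Ω → ℝ) {s t : ℝ} (h : s ≤ t) :
    brownianFiltration B P s ≤ brownianFiltration B P t := by
  refine sup_le_sup_right ?_ _
  refine iSup_mono fun i => iSup_mono fun r => iSup_le fun hr => ?_
  exact le_iSup (fun _ : (r : ℝ) ≤ t => MeasurableSpace.comap (B i r) inferInstance) (hr.trans h)

lemma Noise.filtration_mono (N : Noise P T m) {s t : ℝ} (h : s ≤ t) :
    N.filtration s ≤ N.filtration t :=
  sup_le_sup_right (brownianFiltration_mono N.B h) _

lemma Noise.measurableSet_of_null (N : Noise P T m) (t : ℝ) {A : Set Ω} (hA : MeasurableSet A)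
    (h : P A = 0) : MeasurableSet[N.filtration t] A := by
  have : MeasurableSpace.generateFrom {A | MeasurableSet A ∧ P A = 0} ≤ N.filtration t :=
    le_sup_right.trans le_sup_left
  exact this A (MeasurableSpace.measurableSet_generateFrom ⟨hA, h⟩)

lemma Noise.measurable_B (N : Noise P T m) (i : Fin m) {s : ℝ≥0} {t : ℝ} (h : (s : ℝ) ≤ t) :
    Measurable[N.filtration t] (N.B i s) := by
  have h1 : MeasurableSpace.comap (N.B i s) inferInstance ≤ N.filtration t := by
    refine le_trans ?_ (le_sup_left.trans le_sup_left)
    exact le_iSup_of_le i (le_iSup_of_le s (le_iSup_of_le h le_rfl))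
  exact Measurable.mono (comap_measurable _) h1 le_rfl

/-- The `σ`-algebra generated by the increments `B(t) - B(s)`. -/
@[reducible] def Noise.incrementAlgebra (N : Noise P T m) (s t : ℝ) : MeasurableSpace Ω :=
  ⨆ j : Fin m, MeasurableSpace.comap
    (fun ω => N.B j t.toNNReal ω - N.B j s.toNNReal ω) inferInstance

/-- The increments after time `s` are independent of the extended filtration at time `s`. -/
lemma Noise.indep_increment [IsProbabilityMeasure P] (N : Noise P T m) {s t : ℝ} (hs : 0 ≤ s)
    (hst : s ≤ t) (ht : t ≤ T) : Indep (N.filtration s) (N.incrementAlgebra s t) P := by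
  have hDle : N.incrementAlgebra s t ≤ brownianFiltration N.B P T := by
    refine iSup_le fun j => ?_
    have h1 : ∀ r ≤ T, 0 ≤ r →
        Measurable[brownianFiltration N.B P T] (N.B j r.toNNReal) := by
      intro r hr hr0
      refine Measurable.mono (comap_measurable _) (le_trans ?_ le_sup_left) le_rfl
      exact le_iSup_of_le j (le_iSup_of_le r.toNNReal
        (le_iSup_of_le (by rwa [Real.coe_toNNReal _ hr0]) le_rfl))
    exact Measurable.comap_le
      ((h1 t ht (hs.trans hst)).sub (h1 s (hst.trans ht) hs))
  have hDm : N.incrementAlgebra s t ≤ mΩ := hDle.trans (N.isBrownian.brownianFiltration_le T)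
  refine indep_sup_left_of_indep (N.isBrownian.brownianFiltration_le s) hDm N.F₀_le ?_ ?_
  · refine indep_sup_null (P := P) (G := ⨆ (i : Fin m) (r : ℝ≥0) (_ : (r : ℝ) ≤ s),
      MeasurableSpace.comap (N.B i r) inferInstance) (D := N.incrementAlgebra s t) ?_
    refine indep_of_indep_of_le (N.isBrownian.indep_past_shift s.toNNReal) ?_ ?_
    · refine iSup_mono fun i => iSup_mono fun r => iSup_le fun hr => ?_
      exact le_iSup (fun _ : r ≤ s.toNNReal => MeasurableSpace.comap (N.B i r) inferInstance)
        (NNReal.le_toNNReal_of_coe_le hr)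
    -- The increment over [s, t] is the shifted process at time t - s.
    · refine iSup_mono fun j => ?_
      refine le_trans (le_of_eq ?_) (le_iSup _ (t.toNNReal - s.toNNReal))
      rw [add_tsub_cancel_of_le (Real.toNNReal_le_toNNReal hst)]
  -- Past and increment both lie in 𝓕(T), of which the initial information is independent; this is
  -- where t ≤ T enters.
  · exact indep_of_indep_of_le_right N.indep
      (sup_le (brownianFiltration_mono N.B (hst.trans ht)) hDle)

end Increments

end SDEControl

namespace SDEControl

/-! ### Moments of Brownian increments -/

section Moments

variable {Ω : Type*} [mΩ : MeasurableSpace Ω] {P : Measure Ω} {T : ℝ} {m d : ℕ}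

lemma Noise.increment_apply (N : Noise P T m) (s t : ℝ) (ω : Ω) (j : Fin m) :
    N.increment s t ω j = N.B j t.toNNReal ω - N.B j s.toNNReal ω := rfl

lemma Noise.increment_add (N : Noise P T m) (s t u : ℝ) (ω : Ω) :
    N.increment s t ω + N.increment t u ω = N.increment s u ω := by
  ext j
  simp [increment_apply]

lemma Noise.increment_self (N : Noise P T m) (s : ℝ) (ω : Ω) : N.increment s s ω = 0 := by
  ext j
  simp [increment_apply]

lemma Noise.measurable_increment_apply (N : Noise P T m) {s t : ℝ} (hs : 0 ≤ s) (hst : s ≤ t)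
    (j : Fin m) : Measurable[N.filtration t] fun ω => N.increment s t ω j := by
  simp only [increment_apply]
  exact (N.measurable_B j (by rw [Real.coe_toNNReal _ (hs.trans hst)])).sub
    (N.measurable_B j (by rwa [Real.coe_toNNReal _ hs]))

lemma Noise.measurable_incrementAlgebra (N : Noise P T m) (s t : ℝ) (j : Fin m) :
    Measurable[N.incrementAlgebra s t] fun ω => N.increment s t ω j :=
  Measurable.mono (comap_measurable _) (le_iSup (fun j => MeasurableSpace.comap
    (fun ω => N.B j t.toNNReal ω - N.B j s.toNNReal ω) inferInstance) j) le_rfl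

lemma Noise.hasLaw_increment (N : Noise P T m) (s t : ℝ) (j : Fin m) :
    HasLaw (fun ω => N.increment s t ω j)
      (gaussianReal 0 (nndist (t.toNNReal : ℝ) (s.toNNReal : ℝ))) P :=
  (N.isBrownian.brownian j).toIsPreBrownianReal.hasLaw_sub t.toNNReal s.toNNReal

lemma Noise.memLp_increment (N : Noise P T m) (s t : ℝ) (j : Fin m) :
    MemLp (fun ω => N.increment s t ω j) 2 P := by
  have h := N.hasLaw_increment s t j
  have h2 := memLp_id_gaussianReal' (μ := 0)
    (v := nndist (t.toNNReal : ℝ) (s.toNNReal : ℝ)) 2 (by simp)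
  rw [← h.map_eq] at h2
  exact (memLp_map_measure_iff h2.aestronglyMeasurable h.aemeasurable).1 h2

lemma Noise.integral_increment (N : Noise P T m) (s t : ℝ) (j : Fin m) :
    ∫ ω, N.increment s t ω j ∂P = 0 := by
  rw [(N.hasLaw_increment s t j).integral_eq, integral_id_gaussianReal]

lemma Noise.integral_increment_mul_increment [IsProbabilityMeasure P] (N : Noise P T m)
    {s t : ℝ} (hs : 0 ≤ s) (hst : s ≤ t) (i j : Fin m) :
    ∫ ω, N.increment s t ω i * N.increment s t ω j ∂P = if i = j then t - s else 0 := by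
  split_ifs with h
  · subst h
    have h1 := (N.hasLaw_increment s t i).variance_eq
    rw [variance_id_gaussianReal, variance_eq_sub (N.memLp_increment s t i),
      N.integral_increment] at h1
    simp only [Pi.pow_apply, coe_nndist, Real.coe_toNNReal _ hs,
      Real.coe_toNNReal _ (hs.trans hst), Real.dist_eq, abs_of_nonneg (sub_nonneg.2 hst)] at h1
    simp only [← pow_two]
    linarith
  · have h1 : IndepFun (fun ω => N.increment s t ω i) (fun ω => N.increment s t ω j) P :=
      (N.isBrownian.indep.indepFun h).comp
        (φ := fun p : ℝ≥0 → ℝ => p t.toNNReal - p s.toNNReal)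
        (ψ := fun p : ℝ≥0 → ℝ => p t.toNNReal - p s.toNNReal)
        ((measurable_pi_apply _).sub (measurable_pi_apply _))
        ((measurable_pi_apply _).sub (measurable_pi_apply _))
    rw [h1.integral_fun_mul_eq_mul_integral (N.memLp_increment s t i).aestronglyMeasurable
      (N.memLp_increment s t j).aestronglyMeasurable, N.integral_increment, zero_mul]

lemma Noise.indepFun_of_measurable [IsProbabilityMeasure P] (N : Noise P T m) {s t : ℝ}
    (hs : 0 ≤ s) (hst : s ≤ t) (ht : t ≤ T) {f g : Ω → ℝ} (hf : Measurable[N.filtration s] f)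
    (hg : Measurable[N.incrementAlgebra s t] g) : IndepFun f g P :=
  indep_of_indep_of_le (N.indep_increment hs hst ht) hf.comap_le hg.comap_le

/-- Integrability comes from independence, not from Hölder: `f` is only in L¹, being later a product
of two L² functions. -/
lemma Noise.integrable_mul_increment [IsProbabilityMeasure P] (N : Noise P T m) {s t : ℝ}
    (hs : 0 ≤ s) (hst : s ≤ t) (ht : t ≤ T) {f : Ω → ℝ} (hf : Measurable[N.filtration s] f)
    (hfi : Integrable f P) (j : Fin m) : Integrable (fun ω => f ω * N.increment s t ω j) P :=
  (N.indepFun_of_measurable hs hst ht hf (N.measurable_incrementAlgebra s t j)).integrable_mul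
    hfi ((N.memLp_increment s t j).integrable one_le_two)

lemma Noise.integral_mul_increment [IsProbabilityMeasure P] (N : Noise P T m) {s t : ℝ}
    (hs : 0 ≤ s) (hst : s ≤ t) (ht : t ≤ T) {f : Ω → ℝ} (hf : Measurable[N.filtration s] f)
    (j : Fin m) : ∫ ω, f ω * N.increment s t ω j ∂P = 0 := by
  rw [(N.indepFun_of_measurable hs hst ht hf
    (N.measurable_incrementAlgebra s t j)).integral_fun_mul_eq_mul_integral
      (hf.mono (N.filtration_le s) le_rfl).aestronglyMeasurable
      (N.memLp_increment s t j).aestronglyMeasurable, N.integral_increment, mul_zero]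

lemma Noise.integrable_mul_increment_mul [IsProbabilityMeasure P] (N : Noise P T m) {s t : ℝ}
    (hs : 0 ≤ s) (hst : s ≤ t) (ht : t ≤ T) {f : Ω → ℝ} (hf : Measurable[N.filtration s] f)
    (hfi : Integrable f P) (i j : Fin m) :
    Integrable (fun ω => f ω * (N.increment s t ω i * N.increment s t ω j)) P :=
  (N.indepFun_of_measurable hs hst ht hf ((N.measurable_incrementAlgebra s t i).mul
    (N.measurable_incrementAlgebra s t j))).integrable_mul
    hfi ((N.memLp_increment s t i).integrable_mul (N.memLp_increment s t j))

lemma Noise.integral_mul_increment_mul [IsProbabilityMeasure P] (N : Noise P T m) {s t : ℝ}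
    (hs : 0 ≤ s) (hst : s ≤ t) (ht : t ≤ T) {f : Ω → ℝ} (hf : Measurable[N.filtration s] f)
    (i j : Fin m) :
    ∫ ω, f ω * (N.increment s t ω i * N.increment s t ω j) ∂P =
      if i = j then (t - s) * ∫ ω, f ω ∂P else 0 := by
  refine ((N.indepFun_of_measurable hs hst ht hf ((N.measurable_incrementAlgebra s t i).mul
    (N.measurable_incrementAlgebra s t j))).integral_fun_mul_eq_mul_integral
      (hf.mono (N.filtration_le s) le_rfl).aestronglyMeasurable
      ((N.memLp_increment s t i).integrable_mul
        (N.memLp_increment s t j)).aestronglyMeasurable).trans ?_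
  simp only [Pi.mul_apply]
  rw [N.integral_increment_mul_increment hs hst i j]
  split_ifs
  · ring
  · ring

end Moments

/-! ### Matrix coefficients applied to increments -/

section MatVec

lemma measurable_euclidean_apply {ι : Type*} [Fintype ι] {Ω : Type*} {G : MeasurableSpace Ω}
    {f : Ω → EuclideanSpace ℝ ι} (hf : Measurable[G] f) (i : ι) : Measurable[G] fun ω => f ω i :=
  (EuclideanSpace.proj (𝕜 := ℝ) i).continuous.measurable.comp hf

lemma measurable_euclidean_iff {ι : Type*} [Fintype ι] {Ω : Type*} {G : MeasurableSpace Ω}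
    {f : Ω → EuclideanSpace ℝ ι} (hf : ∀ i, Measurable[G] fun ω => f ω i) : Measurable[G] f := by
  have h : Measurable[G] fun ω i => f ω i := measurable_pi_lambda _ hf
  exact (PiLp.continuous_toLp 2 (fun _ : ι => ℝ)).measurable.comp h

variable {Ω : Type*} [mΩ : MeasurableSpace Ω] {P : Measure Ω} {T : ℝ} {m d : ℕ}

lemma matVec_apply (M : Mat d m) (v : Vec m) (i : Fin d) :
    matVec M v i = ∑ j, M (i, j) * v j := rfl

lemma matVec_neg_left (M : Mat d m) (v : Vec m) : matVec (-M) v = -matVec M v := by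
  ext i
  simp [matVec_apply]

lemma matVec_add_right (M : Mat d m) (v w : Vec m) :
    matVec M (v + w) = matVec M v + matVec M w := by
  ext i
  simp [matVec_apply, mul_add, Finset.sum_add_distrib]

lemma matVec_zero_right (M : Mat d m) : matVec M (0 : Vec m) = 0 := by
  ext i
  simp [matVec_apply]

lemma continuous_matVec : Continuous fun p : Mat d m × Vec m => matVec p.1 p.2 := by
  unfold matVec
  fun_prop

lemma Noise.measurable_increment (N : Noise P T m) {s t : ℝ} (hs : 0 ≤ s) (hst : s ≤ t) :
    Measurable[N.filtration t] (N.increment s t) :=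
  measurable_euclidean_iff fun j => N.measurable_increment_apply hs hst j

lemma Noise.measurable_matVec_increment (N : Noise P T m) {s t : ℝ} (hs : 0 ≤ s) (hst : s ≤ t)
    {ξ : Ω → Mat d m} (hξ : Measurable[N.filtration s] ξ) :
    Measurable[N.filtration t] fun ω => matVec (ξ ω) (N.increment s t ω) :=
  (continuous_matVec (d := d) (m := m)).measurable.comp
    ((hξ.mono (N.filtration_mono hst) le_rfl).prodMk (N.measurable_increment hs hst))

lemma memLp_euclidean_apply {ι : Type*} [Fintype ι] {f : Ω → EuclideanSpace ℝ ι}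
    (hf : MemLp f 2 P) (i : ι) : MemLp (fun ω => f ω i) 2 P :=
  MemLp.eval_piLp hf i

/-- A product of two L² functions need not be in L²; here the square of each entry times the square
of an increment is integrable because the two are independent. -/
lemma Noise.memLp_matVec_increment [IsProbabilityMeasure P] (N : Noise P T m) {s t : ℝ}
    (hs : 0 ≤ s) (hst : s ≤ t) (ht : t ≤ T) {ξ : Ω → Mat d m}
    (hξ : Measurable[N.filtration s] ξ) (hξ2 : MemLp ξ 2 P) :
    MemLp (fun ω => matVec (ξ ω) (N.increment s t ω)) 2 P := by
  refine MemLp.of_eval_piLp fun i => ?_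
  simp only [matVec_apply]
  refine memLp_finsetSum _ fun j _ => ?_
  have hm := measurable_euclidean_apply hξ (i, j)
  have hi := memLp_euclidean_apply hξ2 (i, j)
  refine (memLp_two_iff_integrable_sq
    ((hm.mono (N.filtration_le s) le_rfl).aestronglyMeasurable.mul
      (N.memLp_increment s t j).aestronglyMeasurable)).2 ?_
  refine (N.integrable_mul_increment_mul hs hst ht (hm.pow_const 2) hi.integrable_sq j j).congr
    (Eventually.of_forall fun ω => ?_)
  simp only [Pi.mul_apply]
  ring

lemma Noise.integral_inner_matVec_increment [IsProbabilityMeasure P] (N : Noise P T m) {s t : ℝ}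
    (hs : 0 ≤ s) (hst : s ≤ t) (ht : t ≤ T) {η : Ω → Vec d} {ξ : Ω → Mat d m}
    (hη : Measurable[N.filtration s] η) (hη2 : MemLp η 2 P)
    (hξ : Measurable[N.filtration s] ξ) (hξ2 : MemLp ξ 2 P) :
    ∫ ω, inner ℝ (η ω) (matVec (ξ ω) (N.increment s t ω)) ∂P = 0 := by
  have h1 : ∀ ω, inner ℝ (η ω) (matVec (ξ ω) (N.increment s t ω)) =
      ∑ i, ∑ j, (η ω i * ξ ω (i, j)) * N.increment s t ω j := by
    intro ω
    simp only [PiLp.inner_apply, matVec_apply, RCLike.inner_apply, conj_trivial, Finset.sum_mul]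
    refine Finset.sum_congr rfl fun i _ => Finset.sum_congr rfl fun j _ => by ring
  have hm : ∀ i j, Measurable[N.filtration s] fun ω => η ω i * ξ ω (i, j) := fun i j =>
    (measurable_euclidean_apply hη i).mul (measurable_euclidean_apply hξ (i, j))
  have hi : ∀ i j, Integrable (fun ω => η ω i * ξ ω (i, j)) P := fun i j =>
    (memLp_euclidean_apply hη2 i).integrable_mul (memLp_euclidean_apply hξ2 (i, j))
  have hi2 := fun i j => N.integrable_mul_increment hs hst ht (hm i j) (hi i j) j
  simp only [h1]
  rw [integral_finsetSum _ fun i _ => integrable_finsetSum _ fun j _ => hi2 i j]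
  refine Finset.sum_eq_zero fun i _ => ?_
  rw [integral_finsetSum _ fun j _ => hi2 i j]
  exact Finset.sum_eq_zero fun j _ => N.integral_mul_increment hs hst ht (hm i j) j

/-- Under the expectation, independence replaces ΔBⱼ ΔBₖ by t - s if j = k and by 0 otherwise; the
diagonal terms add up to the Frobenius inner product. -/
lemma Noise.integral_inner_matVec_matVec [IsProbabilityMeasure P] (N : Noise P T m) {s t : ℝ}
    (hs : 0 ≤ s) (hst : s ≤ t) (ht : t ≤ T) {ξ η : Ω → Mat d m}
    (hξ : Measurable[N.filtration s] ξ) (hξ2 : MemLp ξ 2 P)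
    (hη : Measurable[N.filtration s] η) (hη2 : MemLp η 2 P) :
    ∫ ω, inner ℝ (matVec (ξ ω) (N.increment s t ω)) (matVec (η ω) (N.increment s t ω)) ∂P =
      (t - s) * ∫ ω, inner ℝ (ξ ω) (η ω) ∂P := by
  have h1 : ∀ ω, inner ℝ (matVec (ξ ω) (N.increment s t ω)) (matVec (η ω) (N.increment s t ω)) =
      ∑ i, ∑ j, ∑ k, (ξ ω (i, j) * η ω (i, k)) *
        (N.increment s t ω j * N.increment s t ω k) := by
    intro ω
    simp only [PiLp.inner_apply, matVec_apply, RCLike.inner_apply, conj_trivial]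
    refine Finset.sum_congr rfl fun i _ => ?_
    rw [mul_comm, Finset.sum_mul_sum]
    refine Finset.sum_congr rfl fun j _ => Finset.sum_congr rfl fun k _ => by ring
  have hm : ∀ i j k, Measurable[N.filtration s] fun ω => ξ ω (i, j) * η ω (i, k) := fun i j k =>
    (measurable_euclidean_apply hξ (i, j)).mul (measurable_euclidean_apply hη (i, k))
  have hi : ∀ i j k, Integrable (fun ω => ξ ω (i, j) * η ω (i, k)) P := fun i j k =>
    (memLp_euclidean_apply hξ2 (i, j)).integrable_mul (memLp_euclidean_apply hη2 (i, k))
  have hi2 := fun i j k => N.integrable_mul_increment_mul hs hst ht (hm i j k) (hi i j k) j k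
  have h2 : ∀ ω, inner ℝ (ξ ω) (η ω) = ∑ i, ∑ j, ξ ω (i, j) * η ω (i, j) := by
    intro ω
    simp only [PiLp.inner_apply, RCLike.inner_apply, conj_trivial, Fintype.sum_prod_type]
    refine Finset.sum_congr rfl fun i _ => Finset.sum_congr rfl fun j _ => by ring
  simp only [h1, h2]
  rw [integral_finsetSum _ fun i _ => integrable_finsetSum _ fun j _ =>
    integrable_finsetSum _ fun k _ => hi2 i j k,
    integral_finsetSum _ fun i _ => integrable_finsetSum _ fun j _ => hi i j j, Finset.mul_sum]
  refine Finset.sum_congr rfl fun i _ => ?_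
  rw [integral_finsetSum _ fun j _ => integrable_finsetSum _ fun k _ => hi2 i j k,
    integral_finsetSum _ fun j _ => hi i j j, Finset.mul_sum]
  refine Finset.sum_congr rfl fun j _ => ?_
  rw [integral_finsetSum _ fun k _ => hi2 i j k]
  simp only [N.integral_mul_increment_mul hs hst ht (hm i j _)]
  simp

end MatVec

end SDEControl

namespace SDEControl

/-! ### Inner products of elementary integrals over arbitrary intervals -/

section Elementary

variable {Ω : Type*} [mΩ : MeasurableSpace Ω] {P : Measure Ω} {T : ℝ} {m d : ℕ}

/-- The elementary stochastic integral `ξ (B(t) - B(s))`. -/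
noncomputable def Noise.elem (N : Noise P T m) (ξ : Ω → Mat d m) (s t : ℝ) (ω : Ω) : Vec d :=
  matVec (ξ ω) (N.increment s t ω)

lemma Noise.elem_add (N : Noise P T m) (ξ : Ω → Mat d m) (s t u : ℝ) (ω : Ω) :
    N.elem ξ s t ω + N.elem ξ t u ω = N.elem ξ s u ω := by
  rw [elem, elem, elem, ← matVec_add_right, N.increment_add]

lemma Noise.elem_self (N : Noise P T m) (ξ : Ω → Mat d m) (s : ℝ) (ω : Ω) :
    N.elem ξ s s ω = 0 := by
  rw [elem, N.increment_self, matVec_zero_right]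

lemma integrable_inner_of_memLp {E : Type*} [NormedAddCommGroup E] [InnerProductSpace ℝ E]
    {f g : Ω → E} (hf : MemLp f 2 P) (hg : MemLp g 2 P) :
    Integrable (fun ω => inner ℝ (f ω) (g ω)) P := by
  refine (hf.norm.integrable_mul hg.norm).mono (hf.1.inner hg.1) (Eventually.of_forall fun ω => ?_)
  simp only [Pi.mul_apply, norm_mul, norm_norm]
  exact norm_inner_le_norm _ _

variable [IsProbabilityMeasure P]

lemma Noise.integral_inner_elem_of_le (N : Noise P T m) {s t u v : ℝ} (hs : 0 ≤ s) (hst : s ≤ t)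
    (htu : t ≤ u) (huv : u ≤ v) (hv : v ≤ T) {ξ η : Ω → Mat d m}
    (hξ : Measurable[N.filtration s] ξ) (hξ2 : MemLp ξ 2 P)
    (hη : Measurable[N.filtration u] η) (hη2 : MemLp η 2 P) :
    ∫ ω, inner ℝ (N.elem ξ s t ω) (N.elem η u v ω) ∂P = 0 :=
  N.integral_inner_matVec_increment (hs.trans (hst.trans htu)) huv hv
    ((N.measurable_matVec_increment hs hst hξ).mono (N.filtration_mono htu) le_rfl)
    (N.memLp_matVec_increment hs hst (htu.trans (huv.trans hv)) hξ hξ2) hη hη2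

lemma Noise.memLp_elem (N : Noise P T m) {s t : ℝ} (hs : 0 ≤ s) (hst : s ≤ t) (ht : t ≤ T)
    {ξ : Ω → Mat d m} (hξ : Measurable[N.filtration s] ξ) (hξ2 : MemLp ξ 2 P) :
    MemLp (N.elem ξ s t) 2 P :=
  N.memLp_matVec_increment hs hst ht hξ hξ2

lemma Noise.integral_inner_elem_same (N : Noise P T m) {s t v : ℝ} (hs : 0 ≤ s) (hst : s ≤ t)
    (htv : t ≤ v) (hv : v ≤ T) {ξ η : Ω → Mat d m}
    (hξ : Measurable[N.filtration s] ξ) (hξ2 : MemLp ξ 2 P)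
    (hη : Measurable[N.filtration s] η) (hη2 : MemLp η 2 P) :
    ∫ ω, inner ℝ (N.elem ξ s t ω) (N.elem η s v ω) ∂P = (t - s) * ∫ ω, inner ℝ (ξ ω) (η ω) ∂P := by
  have hη' := hη.mono (N.filtration_mono hst) le_rfl
  have h1 := N.memLp_elem hs hst (htv.trans hv) hξ hξ2
  have h2 := N.memLp_elem hs hst (htv.trans hv) hη hη2
  have h3 := N.memLp_elem (hs.trans hst) htv hv hη' hη2
  have : ∀ ω, inner ℝ (N.elem ξ s t ω) (N.elem η s v ω) =
      inner ℝ (N.elem ξ s t ω) (N.elem η s t ω) + inner ℝ (N.elem ξ s t ω) (N.elem η t v ω) := by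
    intro ω
    rw [← inner_add_right, N.elem_add]
  simp only [this]
  rw [integral_add (integrable_inner_of_memLp h1 h2) (integrable_inner_of_memLp h1 h3),
    N.integral_inner_elem_of_le hs hst le_rfl htv hv hξ hξ2 hη' hη2, add_zero]
  exact N.integral_inner_matVec_matVec hs hst (htv.trans hv) hξ hξ2 hη hη2

/-- The intervals of a simple integrand may overlap, so all pairs have to be treated. Cutting the
first interval at u leaves a part before u, orthogonal to the second integral, and a part with the
same left endpoint u. -/
lemma Noise.integral_inner_elem_of_start_le (N : Noise P T m) {s t u v : ℝ} (hs : 0 ≤ s)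
    (hst : s ≤ t) (ht : t ≤ T) (hsu : s ≤ u) (huv : u ≤ v) (hv : v ≤ T) {ξ η : Ω → Mat d m}
    (hξ : Measurable[N.filtration s] ξ) (hξ2 : MemLp ξ 2 P)
    (hη : Measurable[N.filtration u] η) (hη2 : MemLp η 2 P) :
    ∫ ω, inner ℝ (N.elem ξ s t ω) (N.elem η u v ω) ∂P =
      volume.real (Ioc s t ∩ Ioc u v) * ∫ ω, inner ℝ (ξ ω) (η ω) ∂P := by
  rw [Ioc_inter_Ioc, Real.volume_real_Ioc, max_eq_right hsu]
  rcases le_total t u with htu | hut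
  · rw [N.integral_inner_elem_of_le hs hst htu huv hv hξ hξ2 hη hη2, max_eq_right, zero_mul]
    linarith [min_le_left t v]
  have hξ' := hξ.mono (N.filtration_mono hsu) le_rfl
  have h1 := N.memLp_elem hs hsu (hut.trans ht) hξ hξ2
  have h2 := N.memLp_elem (hs.trans hsu) hut ht hξ' hξ2
  have h3 := N.memLp_elem (hs.trans hsu) huv hv hη hη2
  have : ∀ ω, inner ℝ (N.elem ξ s t ω) (N.elem η u v ω) =
      inner ℝ (N.elem ξ s u ω) (N.elem η u v ω) + inner ℝ (N.elem ξ u t ω) (N.elem η u v ω) := by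
    intro ω
    rw [← inner_add_left, N.elem_add]
  simp only [this]
  rw [integral_add (integrable_inner_of_memLp h1 h3) (integrable_inner_of_memLp h2 h3),
    N.integral_inner_elem_of_le hs hsu le_rfl huv hv hξ hξ2 hη hη2, zero_add]
  rcases le_total t v with htv | hvt
  · rw [min_eq_left htv, max_eq_left (sub_nonneg.2 hut),
      N.integral_inner_elem_same (hs.trans hsu) hut htv hv hξ' hξ2 hη hη2]
  · rw [min_eq_right hvt, max_eq_left (sub_nonneg.2 huv)]
    simp only [real_inner_comm (N.elem η u v _), real_inner_comm (η _)]
    exact N.integral_inner_elem_same (hs.trans hsu) huv hvt ht hη hη2 hξ' hξ2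

lemma Noise.integral_inner_elem (N : Noise P T m) {s t u v : ℝ} (hs : 0 ≤ s)
    (hst : s ≤ t) (ht : t ≤ T) (hu : 0 ≤ u) (huv : u ≤ v) (hv : v ≤ T) {ξ η : Ω → Mat d m}
    (hξ : Measurable[N.filtration s] ξ) (hξ2 : MemLp ξ 2 P)
    (hη : Measurable[N.filtration u] η) (hη2 : MemLp η 2 P) :
    ∫ ω, inner ℝ (N.elem ξ s t ω) (N.elem η u v ω) ∂P =
      volume.real (Ioc s t ∩ Ioc u v) * ∫ ω, inner ℝ (ξ ω) (η ω) ∂P := by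
  rcases le_total s u with hsu | hus
  · exact N.integral_inner_elem_of_start_le hs hst ht hsu huv hv hξ hξ2 hη hη2
  · rw [inter_comm]
    simp only [real_inner_comm (N.elem η u v _), real_inner_comm (η _)]
    exact N.integral_inner_elem_of_start_le hu huv hv hus hst ht hη hη2 hξ hξ2

end Elementary

/-! ### The Itô isometry for simple integrands -/

section Isometry

variable {Ω : Type*} [mΩ : MeasurableSpace Ω] {P : Measure Ω} {T τ : ℝ} {m d : ℕ}

lemma enorm_sq_eq_ofReal {E : Type*} [SeminormedAddCommGroup E] (x : E) :
    ‖x‖ₑ ^ 2 = ENNReal.ofReal (‖x‖ ^ 2) := by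
  rw [ENNReal.ofReal_pow (norm_nonneg _), ofReal_norm]

lemma norm_sum_sq_eq {ι E : Type*} [Fintype ι] [NormedAddCommGroup E] [InnerProductSpace ℝ E]
    (f : ι → E) : ‖∑ k, f k‖ ^ 2 = ∑ k, ∑ l, inner ℝ (f k) (f l) := by
  rw [← real_inner_self_eq_norm_sq, sum_inner]
  simp only [inner_sum]

lemma lintegral_enorm_sq_eq_ofReal [IsFiniteMeasure P] {E : Type*} [NormedAddCommGroup E] {f : Ω → E}
    (hf : MemLp f 2 P) : ∫⁻ ω, ‖f ω‖ₑ ^ 2 ∂P = ENNReal.ofReal (∫ ω, ‖f ω‖ ^ 2 ∂P) := by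
  simp only [enorm_sq_eq_ofReal]
  exact (ofReal_integral_eq_lintegral_ofReal hf.integrable_norm_pow'
    (Eventually.of_forall fun ω => sq_nonneg _)).symm

namespace SimpleIntegrand

variable {N : Noise P T m}

lemma integral_eq_sum_elem (H : SimpleIntegrand N τ d) (ω : Ω) :
    H.integral ω = ∑ k, N.elem (H.coeff k) (H.left k) (H.right k) ω := rfl

/-- The squared norm of the process expands into a double sum of indicators of pairwise
intersections, for each ω separately. The sign of the sum is recorded because it is needed to move
`ENNReal.ofReal` through the expectation. -/
lemma lintegral_process_sq (H : SimpleIntegrand N τ d) (ω : Ω) :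
    0 ≤ ∑ k, ∑ l, volume.real (Ioc (H.left k) (H.right k) ∩ Ioc (H.left l) (H.right l)) *
        inner ℝ (H.coeff k ω) (H.coeff l ω) ∧
    ∫⁻ s in Icc 0 τ, ‖H.process s ω‖ₑ ^ 2 = ENNReal.ofReal (∑ k, ∑ l,
      volume.real (Ioc (H.left k) (H.right k) ∩ Ioc (H.left l) (H.right l)) *
        inner ℝ (H.coeff k ω) (H.coeff l ω)) := by
  have h1 : ∀ s, ‖H.process s ω‖ ^ 2 = ∑ k, ∑ l,
      (Ioc (H.left k) (H.right k) ∩ Ioc (H.left l) (H.right l)).indicator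
        (fun _ => inner ℝ (H.coeff k ω) (H.coeff l ω)) s := by
    intro s
    rw [process, norm_sum_sq_eq]
    refine Finset.sum_congr rfl fun k _ => Finset.sum_congr rfl fun l _ => ?_
    by_cases hk : s ∈ Ioc (H.left k) (H.right k) <;>
      by_cases hl : s ∈ Ioc (H.left l) (H.right l) <;>
      simp only [indicator, hk, hl, mem_inter_iff, and_true, and_false, if_true, if_false,
        inner_zero_left, inner_zero_right]
  have hm : ∀ k l, MeasurableSet (Ioc (H.left k) (H.right k) ∩ Ioc (H.left l) (H.right l)) :=
    fun k l => measurableSet_Ioc.inter measurableSet_Ioc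
  have hi : ∀ k l, Integrable ((Ioc (H.left k) (H.right k) ∩
      Ioc (H.left l) (H.right l)).indicator fun _ : ℝ =>
        (inner ℝ (H.coeff k ω) (H.coeff l ω) : ℝ)) (volume.restrict (Icc 0 τ)) := fun k l =>
    (integrable_const _).indicator (hm k l)
  have hi2 : Integrable (fun s => ‖H.process s ω‖ ^ 2) (volume.restrict (Icc 0 τ)) := by
    simp only [h1]
    exact integrable_finsetSum _ fun k _ => integrable_finsetSum _ fun l _ => hi k l
  have key : ∫ s in Icc 0 τ, ‖H.process s ω‖ ^ 2 = ∑ k, ∑ l,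
      volume.real (Ioc (H.left k) (H.right k) ∩ Ioc (H.left l) (H.right l)) *
        inner ℝ (H.coeff k ω) (H.coeff l ω) := by
    simp only [h1]
    rw [integral_finsetSum _ fun k _ => integrable_finsetSum _ fun l _ => hi k l]
    refine Finset.sum_congr rfl fun k _ => ?_
    rw [integral_finsetSum _ fun l _ => hi k l]
    refine Finset.sum_congr rfl fun l _ => ?_
    rw [integral_indicator (hm k l), setIntegral_const, measureReal_restrict_apply (hm k l),
      smul_eq_mul, inter_eq_left.2]
    exact fun s hs => ⟨(H.left_nonneg k).trans hs.1.1.le, hs.1.2.trans (H.right_le k)⟩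
  refine ⟨key ▸ integral_nonneg fun s => sq_nonneg _, ?_⟩
  simp only [enorm_sq_eq_ofReal]
  rw [← ofReal_integral_eq_lintegral_ofReal hi2 (Eventually.of_forall fun s => sq_nonneg _), key]

variable [IsProbabilityMeasure P]

lemma memLp_elem (H : SimpleIntegrand N τ d) (hτ : τ ≤ T) (k : Fin H.n) :
    MemLp (N.elem (H.coeff k) (H.left k) (H.right k)) 2 P :=
  N.memLp_elem (H.left_nonneg k) (H.left_le_right k) ((H.right_le k).trans hτ)
    (H.measurable_coeff k) (H.memLp_coeff k)

lemma memLp_integral (H : SimpleIntegrand N τ d) (hτ : τ ≤ T) : MemLp H.integral 2 P :=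
  memLp_finsetSum _ fun k _ => H.memLp_elem hτ k

lemma integral_norm_sq (H : SimpleIntegrand N τ d) (hτ : τ ≤ T) :
    ∫ ω, ‖H.integral ω‖ ^ 2 ∂P = ∫ ω, ∑ k, ∑ l,
      volume.real (Ioc (H.left k) (H.right k) ∩ Ioc (H.left l) (H.right l)) *
        inner ℝ (H.coeff k ω) (H.coeff l ω) ∂P := by
  have hi : ∀ k l, Integrable (fun ω => volume.real
      (Ioc (H.left k) (H.right k) ∩ Ioc (H.left l) (H.right l)) *
        inner ℝ (H.coeff k ω) (H.coeff l ω)) P := fun k l =>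
    (integrable_inner_of_memLp (H.memLp_coeff k) (H.memLp_coeff l)).const_mul _
  have hi' : ∀ k l, Integrable (fun ω => inner ℝ (N.elem (H.coeff k) (H.left k) (H.right k) ω)
      (N.elem (H.coeff l) (H.left l) (H.right l) ω)) P := fun k l =>
    integrable_inner_of_memLp (H.memLp_elem hτ k) (H.memLp_elem hτ l)
  simp only [integral_eq_sum_elem, norm_sum_sq_eq]
  rw [integral_finsetSum _ fun k _ => integrable_finsetSum _ fun l _ => hi' k l,
    integral_finsetSum _ fun k _ => integrable_finsetSum _ fun l _ => hi k l]
  refine Finset.sum_congr rfl fun k _ => ?_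
  rw [integral_finsetSum _ fun l _ => hi' k l, integral_finsetSum _ fun l _ => hi k l]
  refine Finset.sum_congr rfl fun l _ => ?_
  rw [integral_const_mul]
  exact N.integral_inner_elem (H.left_nonneg k) (H.left_le_right k) ((H.right_le k).trans hτ)
    (H.left_nonneg l) (H.left_le_right l) ((H.right_le l).trans hτ)
    (H.measurable_coeff k) (H.memLp_coeff k) (H.measurable_coeff l) (H.memLp_coeff l)

/-- The Itô isometry for simple integrands. -/
lemma lintegral_integral_sq (H : SimpleIntegrand N τ d) (hτ : τ ≤ T) :
    ∫⁻ ω, ‖H.integral ω‖ₑ ^ 2 ∂P = energy P τ H.process := by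
  have hi : Integrable (fun ω => ∑ k, ∑ l,
      volume.real (Ioc (H.left k) (H.right k) ∩ Ioc (H.left l) (H.right l)) *
        inner ℝ (H.coeff k ω) (H.coeff l ω)) P :=
    integrable_finsetSum _ fun k _ => integrable_finsetSum _ fun l _ =>
      (integrable_inner_of_memLp (H.memLp_coeff k) (H.memLp_coeff l)).const_mul _
  rw [lintegral_enorm_sq_eq_ofReal (H.memLp_integral hτ), H.integral_norm_sq hτ, energy]
  simp only [fun ω => (H.lintegral_process_sq ω).2]
  refine ofReal_integral_eq_lintegral_ofReal hi (Eventually.of_forall fun ω =>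
    (H.lintegral_process_sq ω).1)

end SimpleIntegrand

end Isometry

end SDEControl

namespace SDEControl

/-! ### Squared L² norms as lower integrals -/

section SquareIntegrals

variable {α E : Type*} [MeasurableSpace α] {μ : Measure α} [NormedAddCommGroup E]

lemma eLpNorm_two_sq (f : α → E) (μ : Measure α) :
    eLpNorm f 2 μ ^ 2 = ∫⁻ x, ‖f x‖ₑ ^ 2 ∂μ := by
  have := eLpNorm_nnreal_pow_eq_lintegral (p := 2) (f := f) (μ := μ) two_ne_zero
  simpa [ENNReal.rpow_two] using this

lemma eLpNorm_two_eq (f : α → E) (μ : Measure α) :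
    eLpNorm f 2 μ = (∫⁻ x, ‖f x‖ₑ ^ 2 ∂μ) ^ (1 / 2 : ℝ) := by
  rw [← eLpNorm_two_sq, ← ENNReal.rpow_natCast, ← ENNReal.rpow_mul]
  norm_num

lemma memLp_two_of_lintegral {f : α → E} (hf : AEStronglyMeasurable f μ)
    (h : ∫⁻ x, ‖f x‖ₑ ^ 2 ∂μ < ∞) : MemLp f 2 μ := by
  refine ⟨hf, ?_⟩
  rw [← eLpNorm_two_sq] at h
  by_contra hn
  rw [not_lt, top_le_iff] at hn
  simp [hn] at h

lemma lintegral_lt_top_of_memLp {f : α → E} (hf : MemLp f 2 μ) :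
    ∫⁻ x, ‖f x‖ₑ ^ 2 ∂μ < ∞ := by
  rw [← eLpNorm_two_sq]
  exact ENNReal.pow_lt_top hf.2

lemma ennreal_sq_add_le (a b : ℝ≥0∞) : (a + b) ^ 2 ≤ 2 * a ^ 2 + 2 * b ^ 2 := by
  rcases eq_or_ne a ∞ with rfl | ha
  · simp
  rcases eq_or_ne b ∞ with rfl | hb
  · simp
  lift a to ℝ≥0 using ha
  lift b to ℝ≥0 using hb
  norm_cast
  rw [← NNReal.coe_le_coe]
  push_cast
  nlinarith [sq_nonneg ((a : ℝ) - b)]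

lemma enorm_add_sq_le (x y : E) : ‖x + y‖ₑ ^ 2 ≤ 2 * ‖x‖ₑ ^ 2 + 2 * ‖y‖ₑ ^ 2 :=
  (pow_le_pow_left' (enorm_add_le x y) 2).trans (ennreal_sq_add_le _ _)

lemma enorm_sub_sq_le (x y : E) : ‖x - y‖ₑ ^ 2 ≤ 2 * ‖x‖ₑ ^ 2 + 2 * ‖y‖ₑ ^ 2 := by
  rw [sub_eq_add_neg]
  simpa using enorm_add_sq_le x (-y)

lemma lintegral_enorm_sub_sq_le {f g : α → E} (hf : AEStronglyMeasurable f μ) :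
    ∫⁻ x, ‖f x - g x‖ₑ ^ 2 ∂μ ≤ 2 * ∫⁻ x, ‖f x‖ₑ ^ 2 ∂μ + 2 * ∫⁻ x, ‖g x‖ₑ ^ 2 ∂μ := by
  refine (lintegral_mono fun x => enorm_sub_sq_le (f x) (g x)).trans ?_
  rw [lintegral_add_left' ((hf.enorm.pow_const 2).const_mul 2),
    lintegral_const_mul'' _ (hf.enorm.pow_const 2), lintegral_const_mul' _ _ (by simp)]

lemma lintegral_enorm_add_sq_le {f g : α → E} (hf : AEStronglyMeasurable f μ) :
    ∫⁻ x, ‖f x + g x‖ₑ ^ 2 ∂μ ≤ 2 * ∫⁻ x, ‖f x‖ₑ ^ 2 ∂μ + 2 * ∫⁻ x, ‖g x‖ₑ ^ 2 ∂μ := by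
  have := lintegral_enorm_sub_sq_le (g := fun x => -g x) hf
  simpa using this

/-- The Cauchy–Schwarz inequality for the integral of a vector-valued function. -/
lemma enorm_integral_sq_le [NormedSpace ℝ E] {f : α → E} (hf : AEStronglyMeasurable f μ) :
    ‖∫ x, f x ∂μ‖ₑ ^ 2 ≤ μ univ * ∫⁻ x, ‖f x‖ₑ ^ 2 ∂μ := by
  have h1 := eLpNorm_le_eLpNorm_mul_rpow_measure_univ (p := 1) (q := 2) one_le_two hf
  rw [eLpNorm_one_eq_lintegral_enorm] at h1
  refine (pow_le_pow_left' ((enorm_integral_le_lintegral_enorm f).trans h1) 2).trans (le_of_eq ?_)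
  rw [mul_pow, eLpNorm_two_sq, mul_comm, ← ENNReal.rpow_natCast, ← ENNReal.rpow_mul]
  norm_num

end SquareIntegrals

/-! ### Approximation in L²(0, τ) by averages over the preceding cell -/

section StepAverage

variable {E : Type*} [NormedAddCommGroup E] [NormedSpace ℝ E]

/-- The average of `f` over the `k`-th cell `((k - 1) h, k h]`. -/
noncomputable def cellAvg (f : ℝ → E) (h : ℝ) (k : ℕ) : E :=
  h⁻¹ • ∫ r in Ioc (((k : ℝ) - 1) * h) (k * h), f r

/-- The step function on `(0, τ]` whose value on a cell of length `τ / n` is the average of `f`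
over the preceding cell. -/
noncomputable def stepAvg (f : ℝ → E) (τ : ℝ) (n : ℕ) (s : ℝ) : E :=
  ∑ k : Fin n, (Ioc ((k : ℝ) * (τ / n)) (((k : ℝ) + 1) * (τ / n))).indicator
    (fun _ => cellAvg f (τ / n) k) s

lemma exists_cell {h s : ℝ} {n : ℕ} (hh : 0 < h) (hs : s ∈ Ioc 0 (n * h)) :
    ∃ k : Fin n, s ∈ Ioc ((k : ℝ) * h) (((k : ℝ) + 1) * h) := by
  have h0 : 0 < s / h := div_pos hs.1 hh
  have hc : 0 < ⌈s / h⌉₊ := Nat.ceil_pos.2 h0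
  have hn : ⌈s / h⌉₊ ≤ n := Nat.ceil_le.2 (by rw [div_le_iff₀ hh]; exact hs.2)
  -- Cells are open on the left, so the index is the ceiling minus one, not the floor.
  obtain ⟨k, hk⟩ : ∃ k, ⌈s / h⌉₊ = k + 1 := ⟨⌈s / h⌉₊ - 1, by omega⟩
  refine ⟨⟨k, by omega⟩, ?_, ?_⟩
  · have : k < ⌈s / h⌉₊ := by omega
    exact (lt_div_iff₀ hh).1 (Nat.lt_ceil.1 this)
  · have : s / h ≤ ((k + 1 : ℕ) : ℝ) := Nat.ceil_le.1 hk.le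
    push_cast at this
    exact (div_le_iff₀ hh).1 this

lemma cell_unique {h s : ℝ} {j k : ℕ} (hh : 0 < h)
    (hj : s ∈ Ioc ((j : ℝ) * h) (((j : ℝ) + 1) * h))
    (hk : s ∈ Ioc ((k : ℝ) * h) (((k : ℝ) + 1) * h)) : j = k := by
  have h1 : (j : ℝ) < (k : ℝ) + 1 := lt_of_mul_lt_mul_right (hj.1.trans_le hk.2) hh.le
  have h2 : (k : ℝ) < (j : ℝ) + 1 := lt_of_mul_lt_mul_right (hk.1.trans_le hj.2) hh.le
  have h1' : j < k + 1 := by exact_mod_cast h1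
  have h2' : k < j + 1 := by exact_mod_cast h2
  omega

lemma stepAvg_eq {f : ℝ → E} {τ s : ℝ} {n : ℕ} (hh : 0 < τ / n) (k : Fin n)
    (hs : s ∈ Ioc ((k : ℝ) * (τ / n)) (((k : ℝ) + 1) * (τ / n))) :
    stepAvg f τ n s = cellAvg f (τ / n) k := by
  rw [stepAvg, Finset.sum_eq_single k, indicator_of_mem hs]
  · intro j _ hjk
    refine indicator_of_notMem (fun hj => hjk ?_) _
    exact Fin.ext (cell_unique hh hj hs)
  · simp

lemma enorm_cellAvg_sq_le {f : ℝ → E} (hf : AEStronglyMeasurable f) {h : ℝ} (hh : 0 < h)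
    (k : ℕ) : ENNReal.ofReal h * ‖cellAvg f h k‖ₑ ^ 2 ≤
      ∫⁻ r in Ioc (((k : ℝ) - 1) * h) (k * h), ‖f r‖ₑ ^ 2 := by
  have h1 := enorm_integral_sq_le (μ := volume.restrict (Ioc (((k : ℝ) - 1) * h) (k * h)))
    hf.restrict
  rw [Measure.restrict_apply_univ, Real.volume_Ioc,
    show (k : ℝ) * h - ((k : ℝ) - 1) * h = h by ring] at h1
  rw [cellAvg, enorm_smul, mul_pow]
  have h2 : ‖h⁻¹‖ₑ = (ENNReal.ofReal h)⁻¹ := by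
    rw [← ENNReal.ofReal_inv_of_pos hh, Real.enorm_of_nonneg (inv_nonneg.2 hh.le)]
  have h0 : ENNReal.ofReal h ≠ 0 := by simpa using hh
  have ht : ENNReal.ofReal h ≠ ∞ := ENNReal.ofReal_ne_top
  rw [h2]
  calc ENNReal.ofReal h * ((ENNReal.ofReal h)⁻¹ ^ 2 *
        ‖∫ r in Ioc (((k : ℝ) - 1) * h) (k * h), f r‖ₑ ^ 2)
      ≤ ENNReal.ofReal h * ((ENNReal.ofReal h)⁻¹ ^ 2 * (ENNReal.ofReal h *
        ∫⁻ r in Ioc (((k : ℝ) - 1) * h) (k * h), ‖f r‖ₑ ^ 2)) := by gcongr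
    _ = (ENNReal.ofReal h * (ENNReal.ofReal h)⁻¹) * (ENNReal.ofReal h * (ENNReal.ofReal h)⁻¹) *
        ∫⁻ r in Ioc (((k : ℝ) - 1) * h) (k * h), ‖f r‖ₑ ^ 2 := by ring
    _ = _ := by rw [ENNReal.mul_inv_cancel h0 ht, one_mul, one_mul]

/-- The half-open cells miss only the point 0. -/
lemma Icc_ae_le_iUnion_cells {τ : ℝ} {n : ℕ} (hτ : 0 < τ) (hn : 0 < n) :
    (Icc (0 : ℝ) τ : Set ℝ) ≤ᵐ[volume]
      ⋃ k : Fin n, Ioc ((k : ℝ) * (τ / n)) (((k : ℝ) + 1) * (τ / n)) := by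
  refine (Ioc_ae_eq_Icc (μ := volume)).symm.le.trans (LE.le.eventuallyLE fun s hs => ?_)
  have hn' : (0 : ℝ) < n := by exact_mod_cast hn
  refine mem_iUnion.2 (exists_cell (div_pos hτ hn') ?_)
  rwa [mul_div_cancel₀ _ hn'.ne']

/-- By Cauchy–Schwarz on each cell, the mass on a cell is at most the mass of `f` on the preceding
one, and those are disjoint. The bound is over the whole line because the first average is taken
over a cell to the left of 0. -/
lemma lintegral_stepAvg_sq_le {f : ℝ → E} (hf : AEStronglyMeasurable f) {τ : ℝ} (hτ : 0 < τ)
    {n : ℕ} (hn : 0 < n) :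
    ∫⁻ s in Icc 0 τ, ‖stepAvg f τ n s‖ₑ ^ 2 ≤ ∫⁻ s, ‖f s‖ₑ ^ 2 := by
  have hn' : (0 : ℝ) < n := by exact_mod_cast hn
  have hh : 0 < τ / n := div_pos hτ hn'
  have hmono : Monotone fun k : ℕ => ((k : ℝ) - 1) * (τ / n) := by
    intro i j hij
    have : (i : ℝ) ≤ j := by exact_mod_cast hij
    simp only
    gcongr
  have hdisj := hmono.pairwise_disjoint_on_Ioc_succ
  calc ∫⁻ s in Icc 0 τ, ‖stepAvg f τ n s‖ₑ ^ 2
      ≤ ∫⁻ s in ⋃ k : Fin n, Ioc ((k : ℝ) * (τ / n)) (((k : ℝ) + 1) * (τ / n)),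
          ‖stepAvg f τ n s‖ₑ ^ 2 :=
        lintegral_mono' (Measure.restrict_mono_ae (Icc_ae_le_iUnion_cells hτ hn)) le_rfl
    _ ≤ ∑' k : Fin n, ∫⁻ s in Ioc ((k : ℝ) * (τ / n)) (((k : ℝ) + 1) * (τ / n)),
          ‖stepAvg f τ n s‖ₑ ^ 2 := lintegral_iUnion_le _ _
    _ = ∑ k : Fin n, ENNReal.ofReal (τ / n) * ‖cellAvg f (τ / n) k‖ₑ ^ 2 := by
        rw [tsum_fintype]
        refine Finset.sum_congr rfl fun k _ => ?_
        rw [setLIntegral_congr_fun (g := fun _ => ‖cellAvg f (τ / n) k‖ₑ ^ 2) measurableSet_Ioc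
          (fun s hs => by simp only [stepAvg_eq hh k hs]), setLIntegral_const, Real.volume_Ioc,
          mul_comm]
        congr 2
        ring
    _ ≤ ∑ k : Fin n, ∫⁻ r in Ioc (((k : ℝ) - 1) * (τ / n)) ((k : ℝ) * (τ / n)), ‖f r‖ₑ ^ 2 :=
        Finset.sum_le_sum fun k _ => enorm_cellAvg_sq_le hf hh k
    _ = ∑ k ∈ Finset.range n,
          ∫⁻ r in Ioc (((k : ℝ) - 1) * (τ / n)) ((k : ℝ) * (τ / n)), ‖f r‖ₑ ^ 2 :=
        Fin.sum_univ_eq_sum_range (fun k : ℕ =>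
          ∫⁻ r in Ioc (((k : ℝ) - 1) * (τ / n)) ((k : ℝ) * (τ / n)), ‖f r‖ₑ ^ 2) n
    _ = ∫⁻ r in ⋃ k ∈ Finset.range n, Ioc (((k : ℝ) - 1) * (τ / n)) ((k : ℝ) * (τ / n)),
          ‖f r‖ₑ ^ 2 := by
        rw [lintegral_biUnion_finset _ fun k _ => measurableSet_Ioc]
        intro i _ j _ hij
        simpa [Function.onFun] using hdisj hij
    _ ≤ _ := setLIntegral_le_lintegral _ _

/-- A point and the points averaged for it lie in neighbouring cells, hence at distance at most two
cell lengths. -/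
lemma norm_stepAvg_sub_le [CompleteSpace E] {g : ℝ → E} (hg : Continuous g) {τ δ : ℝ}
    (hτ : 0 < τ) {n : ℕ}
    (hn : 0 < n) (hδ : ∀ x y, dist x y ≤ 2 * (τ / n) → ‖g x - g y‖ ≤ δ) {s : ℝ}
    (hs : s ∈ Ioc 0 τ) : ‖stepAvg g τ n s - g s‖ ≤ δ := by
  have hn' : (0 : ℝ) < n := by exact_mod_cast hn
  have hh : 0 < τ / n := div_pos hτ hn'
  obtain ⟨k, hk⟩ := exists_cell (n := n) hh (s := s) (by rwa [mul_div_cancel₀ _ hn'.ne'])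
  rw [stepAvg_eq hh k hk, cellAvg]
  set h := τ / n with hdef
  have hvol : volume.real (Ioc (((k : ℝ) - 1) * h) ((k : ℝ) * h)) = h := by
    rw [Real.volume_real_Ioc_of_le (by nlinarith)]
    ring
  have h1 : g s = h⁻¹ • ∫ _ in Ioc (((k : ℝ) - 1) * h) ((k : ℝ) * h), g s := by
    rw [setIntegral_const, hvol, smul_smul, inv_mul_cancel₀ hh.ne', one_smul]
  have hgi : IntegrableOn g (Ioc (((k : ℝ) - 1) * h) ((k : ℝ) * h)) :=
    (hg.integrableOn_Icc).mono_set Ioc_subset_Icc_self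
  rw [h1, ← smul_sub, ← integral_sub hgi (integrableOn_const (by simp)), norm_smul,
    Real.norm_of_nonneg (inv_nonneg.2 hh.le)]
  have h2 := norm_setIntegral_le_of_norm_le_const (μ := volume) (C := δ)
    (s := Ioc (((k : ℝ) - 1) * h) ((k : ℝ) * h)) (f := fun r => g r - g s) (by simp)
    (fun r hr => hδ r s (by
      rw [Real.dist_eq, abs_le]
      constructor <;> nlinarith [hr.1, hr.2, hk.1, hk.2]))
  rw [hvol] at h2
  calc h⁻¹ * _ ≤ h⁻¹ * (δ * h) := by gcongr
    _ = δ := by field_simp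

lemma measurable_stepAvg (f : ℝ → E) (τ : ℝ) (n : ℕ) : StronglyMeasurable (stepAvg f τ n) :=
  Finset.stronglyMeasurable_fun_sum _ fun _ _ =>
    stronglyMeasurable_const.indicator measurableSet_Ioc

lemma stepAvg_sub {f g : ℝ → E} (hf : MemLp f 2) (hg : MemLp g 2) (τ : ℝ) (n : ℕ) (s : ℝ) :
    stepAvg (f - g) τ n s = stepAvg f τ n s - stepAvg g τ n s := by
  have hi : ∀ {f : ℝ → E} (_ : MemLp f 2) (a b : ℝ), IntegrableOn f (Ioc a b) := by
    intro f hf a b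
    exact (hf.restrict _).integrable one_le_two
  rw [stepAvg, stepAvg, stepAvg, ← Finset.sum_sub_distrib]
  refine Finset.sum_congr rfl fun k _ => ?_
  have h : cellAvg (f - g) (τ / n) k = cellAvg f (τ / n) k - cellAvg g (τ / n) k := by
    simp only [cellAvg, Pi.sub_apply]
    rw [integral_sub (hi hf _ _) (hi hg _ _), smul_sub]
  simp only [h, indicator]
  split_ifs <;> simp

/-- The step averages of a square integrable function converge to it in `L²(0, τ)`. -/
lemma tendsto_lintegral_stepAvg_sub [CompleteSpace E] {f : ℝ → E} (hf : MemLp f 2) {τ : ℝ}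
    (hτ : 0 < τ) :
    Tendsto (fun n => ∫⁻ s in Icc 0 τ, ‖stepAvg f τ n s - f s‖ₑ ^ 2) atTop (𝓝 0) := by
  -- Replace `f` by a continuous compactly supported `g` within δ in L²: averaging is an L²
  -- contraction, and for `g` uniform continuity applies. The three errors contribute 2τδ² + 2(2δ² +
  -- 2δ²), which is below the stated bound.
  have key : ∀ δ : ℝ, 0 < δ → ∀ᶠ n : ℕ in atTop,
      ∫⁻ s in Icc 0 τ, ‖stepAvg f τ n s - f s‖ₑ ^ 2 ≤ ENNReal.ofReal ((8 + 4 * τ) * δ ^ 2) := by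
    intro δ hδ
    obtain ⟨g, gsupp, hfg, gcont, gmem⟩ := hf.exists_hasCompactSupport_eLpNorm_sub_le
      (by simp) (ε := ENNReal.ofReal δ) (by simpa using hδ)
    have hfg2 : ∫⁻ s, ‖f s - g s‖ₑ ^ 2 ≤ ENNReal.ofReal (δ ^ 2) := by
      have := pow_le_pow_left' hfg 2
      rwa [eLpNorm_two_sq, ← ENNReal.ofReal_pow hδ.le] at this
    have hu : UniformContinuous g := gsupp.uniformContinuous_of_continuous gcont
    obtain ⟨η, hη, hηg⟩ := Metric.uniformContinuous_iff.1 hu δ hδ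
    have hlim : Tendsto (fun n : ℕ => 2 * (τ / n)) atTop (𝓝 0) := by
      have := (tendsto_const_div_atTop_nhds_zero_nat τ).const_mul 2
      simpa using this
    filter_upwards [hlim.eventually_lt_const hη, eventually_gt_atTop 0] with n hn hn0
    have hsub : AEStronglyMeasurable (f - g) := hf.1.sub gmem.1
    have h1 : ∫⁻ s in Icc 0 τ, ‖stepAvg (f - g) τ n s‖ₑ ^ 2 ≤ ENNReal.ofReal (δ ^ 2) :=
      (lintegral_stepAvg_sq_le hsub hτ hn0).trans hfg2
    have h2 : ∫⁻ s in Icc 0 τ, ‖stepAvg g τ n s - g s‖ₑ ^ 2 ≤ ENNReal.ofReal (τ * δ ^ 2) := by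
      rw [setLIntegral_congr (Ioc_ae_eq_Icc (μ := volume)).symm]
      refine (setLIntegral_mono (g := fun _ => ENNReal.ofReal (δ ^ 2)) measurable_const
        fun s hs => ?_).trans ?_
      · rw [enorm_sq_eq_ofReal]
        refine ENNReal.ofReal_le_ofReal (pow_le_pow_left₀ (norm_nonneg _) ?_ 2)
        exact norm_stepAvg_sub_le gcont hτ hn0 (fun x y hxy => by
          have := hηg (hxy.trans_lt hn)
          rw [dist_eq_norm] at this
          exact this.le) hs
      · rw [setLIntegral_const, Real.volume_Ioc, sub_zero, ← ENNReal.ofReal_mul (sq_nonneg _),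
          mul_comm]
    have h3 : ∫⁻ s in Icc 0 τ, ‖f s - g s‖ₑ ^ 2 ≤ ENNReal.ofReal (δ ^ 2) :=
      (setLIntegral_le_lintegral _ _).trans hfg2
    have m1 := (measurable_stepAvg (f - g) τ n).aestronglyMeasurable
      (μ := volume.restrict (Icc 0 τ))
    have m2 := ((measurable_stepAvg g τ n).aestronglyMeasurable
      (μ := volume.restrict (Icc 0 τ))).sub (gmem.1.restrict (s := Icc 0 τ))
    have e : ∀ s, stepAvg f τ n s - f s =
        (stepAvg g τ n s - g s) + (stepAvg (f - g) τ n s - (f s - g s)) := by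
      intro s
      rw [stepAvg_sub hf gmem]
      abel
    simp only [e]
    refine (lintegral_enorm_add_sq_le m2).trans ?_
    refine (add_le_add (mul_le_mul_right h2 2) (mul_le_mul_right
      ((lintegral_enorm_sub_sq_le m1).trans (add_le_add (mul_le_mul_right h1 2)
        (mul_le_mul_right h3 2))) 2)).trans ?_
    have e2 : (2 : ℝ≥0∞) = ENNReal.ofReal 2 := by simp
    rw [e2, ← ENNReal.ofReal_mul (by positivity), ← ENNReal.ofReal_mul (by positivity),
      ← ENNReal.ofReal_add (by positivity) (by positivity), ← ENNReal.ofReal_mul (by positivity),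
      ← ENNReal.ofReal_add (by positivity) (by positivity)]
    refine ENNReal.ofReal_le_ofReal ?_
    nlinarith [mul_nonneg hτ.le (sq_nonneg δ), sq_nonneg δ]
  rw [ENNReal.tendsto_nhds_zero]
  intro ε hε
  have hlim : Tendsto (fun δ : ℝ => ENNReal.ofReal ((8 + 4 * τ) * δ ^ 2)) (𝓝[>] 0) (𝓝 0) := by
    have : Continuous fun δ : ℝ => ENNReal.ofReal ((8 + 4 * τ) * δ ^ 2) :=
      ENNReal.continuous_ofReal.comp (by fun_prop)
    have := (this.tendsto 0).mono_left (nhdsWithin_le_nhds (s := Ioi 0))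
    simpa using this
  obtain ⟨δ, hδε, hδ⟩ := ((hlim.eventually_le_const hε).and self_mem_nhdsWithin).exists
  filter_upwards [key δ hδ] with n hn using hn.trans hδε

end StepAverage

end SDEControl

namespace SDEControl

/-! ### Progressive processes and their energy as an integral over time × Ω -/

section Progressive

variable {Ω : Type*} [mΩ : MeasurableSpace Ω] {P : Measure Ω} {T τ : ℝ} {m d : ℕ}
  {N : Noise P T m} {V W : Type*} [NormedAddCommGroup V] [MeasurableSpace V] [BorelSpace V]
  [SecondCountableTopology V]

namespace Noise.Progressive

lemma mono {Y : ℝ → Ω → V} (h : N.Progressive τ Y) {τ' : ℝ} (h' : τ' ≤ τ) :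
    N.Progressive τ' Y := fun t ht => h t ⟨ht.1, ht.2.trans h'⟩

lemma sub {Y Z : ℝ → Ω → V} (hY : N.Progressive τ Y) (hZ : N.Progressive τ Z) :
    N.Progressive τ fun s ω => Y s ω - Z s ω := fun t ht => (hY t ht).sub (hZ t ht)

lemma add {Y Z : ℝ → Ω → V} (hY : N.Progressive τ Y) (hZ : N.Progressive τ Z) :
    N.Progressive τ fun s ω => Y s ω + Z s ω := fun t ht => (hY t ht).add (hZ t ht)

omit [BorelSpace V] [SecondCountableTopology V] in
lemma indicator {Y : ℝ → Ω → V} (hY : N.Progressive τ Y) {S : Set ℝ} (hS : MeasurableSet S) :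
    N.Progressive τ fun s ω => S.indicator (fun s => Y s ω) s := by
  intro t ht
  let _ := N.filtration t
  have : MeasurableSet {p : Icc (0 : ℝ) t × Ω | (p.1 : ℝ) ∈ S} :=
    (measurable_subtype_coe.comp measurable_fst) hS
  exact (hY t ht).indicator this

lemma adapted {Y : ℝ → Ω → V} (h : N.Progressive τ Y) {t : ℝ} (ht : t ∈ Icc 0 τ) :
    Measurable[N.filtration t] (Y t) := by
  have h1 := h t ht
  let _ := N.filtration t
  exact h1.comp (measurable_prodMk_left (x := (⟨t, ht.1, le_rfl⟩ : Icc (0 : ℝ) t)))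

/-- A process which is adapted and has continuous paths is progressively measurable. -/
lemma of_continuous {Y : ℝ → Ω → V} (hc : ∀ ω, ContinuousOn (fun t => Y t ω) (Icc 0 τ))
    (ha : ∀ t ∈ Icc 0 τ, Measurable[N.filtration t] (Y t)) : N.Progressive τ Y := by
  intro t ht
  refine @measurable_uncurry_of_continuous_of_measurable Ω V (Icc (0 : ℝ) t) _ _ _ _ _ _ _ _ _
    (N.filtration t) (fun s ω => Y s ω) (fun ω => ?_) (fun s => ?_)
  · exact ((hc ω).mono (Icc_subset_Icc_right ht.2)).domRestrict
  · exact (ha s ⟨s.2.1, s.2.2.trans ht.2⟩).mono (N.filtration_mono s.2.2) le_rfl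

/-- Progressive measurability says nothing about times outside [0, τ]. Extension by zero gives a
jointly measurable function on all of ℝ × Ω, to which Tonelli's theorem applies. -/
lemma exists_measurable_eqOn {Y : ℝ → Ω → V} (h : N.Progressive τ Y) (hτ : 0 ≤ τ) :
    ∃ Z : ℝ × Ω → V, Measurable Z ∧ (∀ s ∈ Icc 0 τ, ∀ ω, Z (s, ω) = Y s ω) ∧
      ∀ s ∉ Icc 0 τ, ∀ ω, Z (s, ω) = 0 := by
  have hm : Measurable fun p : Icc (0 : ℝ) τ × Ω => Y p.1 p.2 :=
    (h τ ⟨hτ, le_rfl⟩).mono (sup_le_sup_left (MeasurableSpace.comap_mono (N.filtration_le τ)) _)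
      le_rfl
  have he : MeasurableEmbedding (Prod.map Subtype.val id : Icc (0 : ℝ) τ × Ω → ℝ × Ω) :=
    (MeasurableEmbedding.subtype_coe measurableSet_Icc).prodMap MeasurableEmbedding.id
  refine ⟨Function.extend (Prod.map Subtype.val id) (fun p : Icc (0 : ℝ) τ × Ω => Y p.1 p.2) 0,
    he.measurable_extend hm measurable_zero, fun s hs ω => ?_, fun s hs ω => ?_⟩
  · exact he.injective.extend_apply _ _ ((⟨s, hs⟩ : Icc (0 : ℝ) τ), ω)
  · rw [Function.extend_apply']
    · rfl
    · rintro ⟨⟨a, b⟩, hab⟩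
      have h1 : (a : ℝ) = s := congrArg Prod.fst hab
      exact hs (h1 ▸ a.2)

lemma ae_eqOn {Y : ℝ → Ω → V} {Z : ℝ × Ω → V} [SFinite P]
    (h : ∀ s ∈ Icc 0 τ, ∀ ω, Z (s, ω) = Y s ω) :
    Z =ᵐ[(volume.restrict (Icc 0 τ)).prod P] fun p : ℝ × Ω => Y p.1 p.2 := by
  have : ∀ᵐ p ∂(volume.restrict (Icc 0 τ)).prod P, p.1 ∈ Icc (0 : ℝ) τ :=
    Measure.quasiMeasurePreserving_fst.ae (ae_restrict_mem measurableSet_Icc)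
  filter_upwards [this] with p hp using h p.1 hp p.2

lemma aemeasurable [SFinite P] {Y : ℝ → Ω → V} (h : N.Progressive τ Y) (hτ : 0 ≤ τ) :
    AEMeasurable (fun p : ℝ × Ω => Y p.1 p.2) ((volume.restrict (Icc 0 τ)).prod P) := by
  obtain ⟨Z, hZ, hZY, -⟩ := h.exists_measurable_eqOn hτ
  exact ⟨Z, hZ, (ae_eqOn hZY).symm⟩

lemma aestronglyMeasurable_path {Y : ℝ → Ω → V} (h : N.Progressive τ Y) (hτ : 0 ≤ τ)
    (ω : Ω) : AEStronglyMeasurable (fun s => Y s ω) (volume.restrict (Icc 0 τ)) := by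
  obtain ⟨Z, hZ, hZY, -⟩ := h.exists_measurable_eqOn hτ
  refine ⟨fun s => Z (s, ω), (hZ.comp measurable_prodMk_right).stronglyMeasurable, ?_⟩
  filter_upwards [ae_restrict_mem measurableSet_Icc] with s hs using (hZY s hs ω).symm

lemma energy_eq_prod [SFinite P] {Y : ℝ → Ω → V} (h : N.Progressive τ Y) (hτ : 0 ≤ τ) :
    energy P τ Y = ∫⁻ p, ‖Y p.1 p.2‖ₑ ^ 2 ∂(volume.restrict (Icc 0 τ)).prod P := by
  rw [lintegral_prod_symm _ ((h.aemeasurable hτ).enorm.pow_const 2)]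
  rfl

lemma energy_eq_swap [SFinite P] {Y : ℝ → Ω → V} (h : N.Progressive τ Y) (hτ : 0 ≤ τ) :
    energy P τ Y = ∫⁻ s in Icc 0 τ, ∫⁻ ω, ‖Y s ω‖ₑ ^ 2 ∂P := by
  rw [h.energy_eq_prod hτ, lintegral_prod _ ((h.aemeasurable hτ).enorm.pow_const 2)]

lemma energy_sub_le [SFinite P] {Y Z : ℝ → Ω → V} (hY : N.Progressive τ Y)
    (hZ : N.Progressive τ Z) (hτ : 0 ≤ τ) :
    energy P τ (fun s ω => Y s ω - Z s ω) ≤ 2 * energy P τ Y + 2 * energy P τ Z := by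
  rw [(hY.sub hZ).energy_eq_prod hτ, hY.energy_eq_prod hτ, hZ.energy_eq_prod hτ]
  exact lintegral_enorm_sub_sq_le (hY.aemeasurable hτ).aestronglyMeasurable

lemma energy_add_le [SFinite P] {Y Z : ℝ → Ω → V} (hY : N.Progressive τ Y)
    (hZ : N.Progressive τ Z) (hτ : 0 ≤ τ) :
    energy P τ (fun s ω => Y s ω + Z s ω) ≤ 2 * energy P τ Y + 2 * energy P τ Z := by
  rw [(hY.add hZ).energy_eq_prod hτ, hY.energy_eq_prod hτ, hZ.energy_eq_prod hτ]
  exact lintegral_enorm_add_sq_le (hY.aemeasurable hτ).aestronglyMeasurable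

end Noise.Progressive

omit [MeasurableSpace V] [BorelSpace V] [SecondCountableTopology V] in
lemma energy_mono (Y : ℝ → Ω → V) {τ' : ℝ} (h : τ' ≤ τ) : energy P τ' Y ≤ energy P τ Y :=
  lintegral_mono fun _ => lintegral_mono_set (Icc_subset_Icc_right h)

omit [MeasurableSpace V] [BorelSpace V] [SecondCountableTopology V] in
lemma energy_congr {Y Z : ℝ → Ω → V} (h : ∀ s ∈ Icc 0 τ, ∀ ω, ‖Y s ω‖ = ‖Z s ω‖) :
    energy P τ Y = energy P τ Z := by
  refine lintegral_congr fun ω => setLIntegral_congr_fun measurableSet_Icc fun s hs => ?_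
  simp only [enorm_sq_eq_ofReal, h s hs ω]

lemma SimpleIntegrand.progressive (H : SimpleIntegrand N τ d) : N.Progressive τ H.process := by
  intro t ht
  refine Finset.measurable_fun_sum _ fun k _ => ?_
  have hS : MeasurableSet[Subtype.instMeasurableSpace.prod (N.filtration t)]
      {p : Icc (0 : ℝ) t × Ω | (p.1 : ℝ) ∈ Ioc (H.left k) (H.right k)} :=
    (measurable_subtype_coe.comp measurable_fst) measurableSet_Ioc
  rcases le_total (H.left k) t with hk | hk
  · have h1 : Measurable[Subtype.instMeasurableSpace.prod (N.filtration t)]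
        fun p : Icc (0 : ℝ) t × Ω => H.coeff k p.2 :=
      ((H.measurable_coeff k).mono (N.filtration_mono hk) le_rfl).comp measurable_snd
    exact h1.indicator hS
  -- This coefficient need not be known at time t, but its interval starts no earlier than t and so
  -- contributes nothing on [0, t].
  · convert measurable_const (a := (0 : Mat d m)) using 2 with p
    exact indicator_of_notMem (fun hp => absurd (hp.1.trans_le p.1.2.2) (not_lt.2 hk)) _

end Progressive

/-! ### Density of simple integrands -/

section Density

variable {Ω : Type*} [mΩ : MeasurableSpace Ω] {P : Measure Ω} {T τ : ℝ} {m d : ℕ}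
  {N : Noise P T m}

/-- Integrating a progressive process in time gives a random variable which is measurable with
respect to the past. -/
lemma Noise.Progressive.measurable_integral {ι : Type*} [Fintype ι]
    {Y : ℝ → Ω → EuclideanSpace ℝ ι} (h : N.Progressive τ Y) {t : ℝ} (ht : t ∈ Icc 0 τ)
    {S : Set ℝ} (hS : MeasurableSet S) (hSt : S ⊆ Icc 0 t) :
    Measurable[N.filtration t] fun ω => ∫ s in S, Y s ω := by
  -- Progressive measurability concerns the subtype [0, t] times Ω, so the integral is moved to that
  -- subtype before Fubini measurability is used.
  have h1 : ∀ ω, ∫ s in S, Y s ω =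
      ∫ s : Icc (0 : ℝ) t, S.indicator (fun s => Y s ω) s ∂(volume.comap Subtype.val) := by
    intro ω
    rw [integral_subtype_comap measurableSet_Icc, setIntegral_indicator hS,
      inter_eq_right.2 hSt]
  simp only [h1]
  have h2 := (h.indicator hS) t ht
  have : IsFiniteMeasure ((volume : Measure ℝ).comap (Subtype.val : Icc (0 : ℝ) t → ℝ)) := by
    constructor
    rw [(MeasurableEmbedding.subtype_coe measurableSet_Icc).comap_apply, image_univ,
      Subtype.range_coe]
    exact measure_Icc_lt_top
  let _ := N.filtration t
  exact (h2.stronglyMeasurable.integral_prod_left'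
    (μ := (volume : Measure ℝ).comap (Subtype.val : Icc (0 : ℝ) t → ℝ))).measurable

variable [IsProbabilityMeasure P]

/-- Simple integrands are dense in the progressively measurable square integrable processes. -/
theorem exists_simpleIntegrand_tendsto {b : ℝ → Ω → Mat d m} (hb : N.MemL2 τ b) (hτ : 0 < τ) :
    ∃ H : ℕ → SimpleIntegrand N τ d,
      Tendsto (fun n => energy P τ fun s ω => (H n).process s ω - b s ω) atTop (𝓝 0) := by
  obtain ⟨Z, hZ, hZb, hZ0⟩ := hb.progressive.exists_measurable_eqOn hτ.le
  have hZm : ∀ ω, AEStronglyMeasurable (fun s => Z (s, ω)) := fun ω =>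
    (hZ.comp measurable_prodMk_right).aestronglyMeasurable
  have hZint : ∀ ω, ∫⁻ s, ‖Z (s, ω)‖ₑ ^ 2 = ∫⁻ s in Icc 0 τ, ‖b s ω‖ₑ ^ 2 := by
    intro ω
    rw [← lintegral_indicator measurableSet_Icc]
    refine lintegral_congr fun s => ?_
    by_cases hs : s ∈ Icc 0 τ
    · rw [indicator_of_mem hs, hZb s hs]
    · rw [indicator_of_notMem hs, hZ0 s hs]
      simp
  have hfin : ∫⁻ ω, (∫⁻ s, ‖Z (s, ω)‖ₑ ^ 2) ∂P < ∞ := by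
    simp only [hZint]
    exact hb.energy_lt_top
  have hmeasZ : Measurable fun ω => ∫⁻ s, ‖Z (s, ω)‖ₑ ^ 2 :=
    (hZ.enorm.pow_const 2).lintegral_prod_left'
  -- This is why the average is taken over the preceding cell: it only uses times up to the left
  -- endpoint of the current cell, where the coefficient has to be measurable. For k = 0 the average
  -- is over negative times, where `Z` vanishes.
  have hcoef : ∀ (n : ℕ), 0 < n → ∀ k : Fin n,
      Measurable[N.filtration ((k : ℝ) * (τ / n))]
        fun ω => cellAvg (fun s => Z (s, ω)) (τ / n) k := by
    intro n hn k
    have hn' : (0 : ℝ) < n := by exact_mod_cast hn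
    have hh : 0 < τ / n := div_pos hτ hn'
    have hk : ((k : ℝ) + 1) ≤ n := by exact_mod_cast k.2
    have hkτ : (k : ℝ) * (τ / n) ∈ Icc 0 τ := by
      refine ⟨by positivity, ?_⟩
      calc (k : ℝ) * (τ / n) ≤ n * (τ / n) := 
          mul_le_mul_of_nonneg_right (by linarith) hh.le
        _ = τ := mul_div_cancel₀ _ hn'.ne'
    have hS : MeasurableSet (Ioc (((k : ℝ) - 1) * (τ / n)) (k * (τ / n)) ∩ Icc 0 τ) :=
      measurableSet_Ioc.inter measurableSet_Icc
    have h1 := hb.progressive.measurable_integral hkτ hS fun s hs => ⟨hs.2.1, hs.1.2⟩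
    have h2 : ∀ ω, cellAvg (fun s => Z (s, ω)) (τ / n) k = (τ / n)⁻¹ •
        ∫ s in Ioc (((k : ℝ) - 1) * (τ / n)) (k * (τ / n)) ∩ Icc 0 τ, b s ω := by
      intro ω
      rw [cellAvg, ← setIntegral_indicator measurableSet_Icc]
      congr 2
      funext s
      by_cases hs : s ∈ Icc 0 τ
      · rw [indicator_of_mem hs, hZb s hs]
      · rw [indicator_of_notMem hs, hZ0 s hs]
    simp only [h2]
    exact h1.const_smul (τ / (n : ℝ))⁻¹
  have hmem : ∀ (n : ℕ), 0 < n → ∀ k : Fin n,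
      MemLp (fun ω => cellAvg (fun s => Z (s, ω)) (τ / n) k) 2 P := by
    intro n hn k
    have hn' : (0 : ℝ) < n := by exact_mod_cast hn
    have hh : 0 < τ / n := div_pos hτ hn'
    refine memLp_two_of_lintegral
      ((hcoef n hn k).mono (N.filtration_le _) le_rfl).aestronglyMeasurable ?_
    have h0 : ENNReal.ofReal (τ / n) ≠ 0 := by simpa using hh
    have h1 : ENNReal.ofReal (τ / n) *
        ∫⁻ ω, ‖cellAvg (fun s => Z (s, ω)) (τ / n) k‖ₑ ^ 2 ∂P ≤
        ∫⁻ ω, (∫⁻ s, ‖Z (s, ω)‖ₑ ^ 2) ∂P := by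
      rw [← lintegral_const_mul' _ _ ENNReal.ofReal_ne_top]
      exact lintegral_mono fun ω => (enorm_cellAvg_sq_le (hZm ω) hh k).trans
        (setLIntegral_le_lintegral _ _)
    exact ENNReal.lt_top_of_mul_ne_top_right (h1.trans_lt hfin).ne h0
  -- The j-th partition has j + 1 cells, which avoids a division by zero.
  let H : ℕ → SimpleIntegrand N τ d := fun j =>
    { n := j + 1
      left := fun k => (k : ℝ) * (τ / (j + 1 : ℕ))
      right := fun k => ((k : ℝ) + 1) * (τ / (j + 1 : ℕ))
      coeff := fun k ω => cellAvg (fun s => Z (s, ω)) (τ / (j + 1 : ℕ)) k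
      left_nonneg := fun k => by positivity
      left_le_right := fun k => by
        have : 0 < τ / (j + 1 : ℕ) := by positivity
        nlinarith
      right_le := fun k => by
        have hk : ((k : ℝ) + 1) ≤ (j + 1 : ℕ) := by exact_mod_cast k.2
        calc ((k : ℝ) + 1) * (τ / (j + 1 : ℕ)) ≤ (j + 1 : ℕ) * (τ / (j + 1 : ℕ)) := by gcongr
          _ = τ := mul_div_cancel₀ _ (by positivity)
      measurable_coeff := hcoef (j + 1) j.succ_pos
      memLp_coeff := hmem (j + 1) j.succ_pos }
  refine ⟨H, ?_⟩
  have hproc : ∀ j s ω, (H j).process s ω = stepAvg (fun s => Z (s, ω)) τ (j + 1) s :=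
    fun j s ω => rfl
  have henergy : ∀ j ω, ∫⁻ s in Icc 0 τ, ‖(H j).process s ω - b s ω‖ₑ ^ 2 =
      ∫⁻ s in Icc 0 τ, ‖stepAvg (fun s => Z (s, ω)) τ (j + 1) s - Z (s, ω)‖ₑ ^ 2 := by
    intro j ω
    refine setLIntegral_congr_fun measurableSet_Icc fun s hs => ?_
    simp only [hproc, hZb s hs]
  -- Convergence holds for almost every path; the factor 4 in the dominating function is 2 for the
  -- step averages plus 2 for the path itself.
  have hlim := tendsto_lintegral_of_dominated_convergence' (μ := P)
    (F := fun j ω => ∫⁻ s in Icc 0 τ, ‖(H j).process s ω - b s ω‖ₑ ^ 2)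
    (f := fun _ => 0) (fun ω => 4 * ∫⁻ s, ‖Z (s, ω)‖ₑ ^ 2) ?_ ?_ ?_ ?_
  · simpa [energy] using hlim
  · intro j
    exact ((((H j).progressive.sub hb.progressive).aemeasurable hτ.le).enorm.pow_const
      2).lintegral_prod_left'
  · intro j
    refine Eventually.of_forall fun ω => ?_
    simp only [henergy]
    refine (lintegral_enorm_sub_sq_le (measurable_stepAvg _ _ _).aestronglyMeasurable).trans ?_
    refine (add_le_add (mul_le_mul_right
      (lintegral_stepAvg_sq_le (hZm ω) hτ j.succ_pos) 2)
      (mul_le_mul_right (setLIntegral_le_lintegral _ _) 2)).trans (le_of_eq ?_)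
    rw [← add_mul]
    norm_num
  · rw [lintegral_const_mul _ hmeasZ]
    exact (ENNReal.mul_lt_top (by simp) hfin).ne
  · filter_upwards [ae_lt_top hmeasZ hfin.ne] with ω hω
    simp only [henergy]
    exact (tendsto_lintegral_stepAvg_sub (memLp_two_of_lintegral (hZm ω) hω) hτ).comp
      (tendsto_add_atTop_nat 1)

end Density

end SDEControl

namespace SDEControl

/-! ### Difference, extension and truncation of simple integrands -/

section SimpleOperations

variable {Ω : Type*} [mΩ : MeasurableSpace Ω] {P : Measure Ω} {T τ : ℝ} {m d : ℕ}
  {N : Noise P T m}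

namespace SimpleIntegrand

/-- The difference of two simple integrands. -/
noncomputable def sub (H K : SimpleIntegrand N τ d) : SimpleIntegrand N τ d where
  n := H.n + K.n
  left := Fin.append H.left K.left
  right := Fin.append H.right K.right
  coeff := Fin.append H.coeff fun k => -K.coeff k
  left_nonneg := Fin.addCases (by simpa using H.left_nonneg) (by simpa using K.left_nonneg)
  left_le_right := Fin.addCases (by simpa using H.left_le_right) (by simpa using K.left_le_right)
  right_le := Fin.addCases (by simpa using H.right_le) (by simpa using K.right_le)
  measurable_coeff := Fin.addCases
    (fun k => by
      rw [Fin.append_left, Fin.append_left]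
      exact H.measurable_coeff k)
    (fun k => by
      rw [Fin.append_right, Fin.append_right]
      exact (K.measurable_coeff k).neg)
  memLp_coeff := Fin.addCases (by simpa using H.memLp_coeff) fun k => by
    simpa using (K.memLp_coeff k).neg

lemma process_sub (H K : SimpleIntegrand N τ d) (s : ℝ) (ω : Ω) :
    (H.sub K).process s ω = H.process s ω - K.process s ω := by
  rw [process, process, process, sub_eq_add_neg, ← Finset.sum_neg_distrib]
  refine (Fin.sum_univ_add _).trans ?_
  congr 1
  · simp [sub]
  · refine Finset.sum_congr rfl fun k _ => ?_
    simp only [sub, Fin.append_right, Pi.neg_apply, indicator]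
    split_ifs <;> simp

lemma integral_sub (H K : SimpleIntegrand N τ d) (ω : Ω) :
    (H.sub K).integral ω = H.integral ω - K.integral ω := by
  rw [integral, integral, integral, sub_eq_add_neg, ← Finset.sum_neg_distrib]
  refine (Fin.sum_univ_add _).trans ?_
  congr 1
  · simp [sub]
  · refine Finset.sum_congr rfl fun k _ => ?_
    simp [sub, matVec_neg_left]

/-- A simple integrand on `[0, τ]`, seen as a simple integrand on a longer interval. -/
noncomputable def extend (H : SimpleIntegrand N τ d) {t : ℝ} (h : τ ≤ t) :
    SimpleIntegrand N t d where
  n := H.n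
  left := H.left
  right := H.right
  coeff := H.coeff
  left_nonneg := H.left_nonneg
  left_le_right := H.left_le_right
  right_le k := (H.right_le k).trans h
  measurable_coeff := H.measurable_coeff
  memLp_coeff := H.memLp_coeff

lemma process_of_lt (H : SimpleIntegrand N τ d) {s : ℝ} (hs : τ < s) (ω : Ω) :
    H.process s ω = 0 :=
  Finset.sum_eq_zero fun k _ => indicator_of_notMem
    (fun h => absurd (h.2.trans (H.right_le k)) (not_le.2 hs)) _

open Classical in
/-- The restriction of a simple integrand to a shorter interval `[0, t]`. -/
noncomputable def clip (H : SimpleIntegrand N τ d) {t : ℝ} (ht : 0 ≤ t) :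
    SimpleIntegrand N t d where
  n := H.n
  left k := min (H.left k) t
  right k := min (H.right k) t
  -- An interval starting after t collapses to the point t, where its coefficient need not be
  -- measurable yet; replacing the coefficient by 0 changes neither the process on [0, t] nor the
  -- integral.
  coeff k := if H.left k ≤ t then H.coeff k else 0
  left_nonneg k := le_min (H.left_nonneg k) ht
  left_le_right k := min_le_min_right _ (H.left_le_right k)
  right_le k := min_le_right _ _
  measurable_coeff k := by
    split_ifs with h
    · rw [min_eq_left h]
      exact H.measurable_coeff k
    · exact measurable_const
  memLp_coeff k := by
    split_ifs with h
    · exact H.memLp_coeff k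
    · exact MemLp.zero

lemma process_clip (H : SimpleIntegrand N τ d) {s t : ℝ} (ht : 0 ≤ t) (hs : s ≤ t) (ω : Ω) :
    (H.clip ht).process s ω = H.process s ω := by
  refine Finset.sum_congr rfl fun k _ => ?_
  simp only [clip]
  by_cases h : H.left k ≤ t
  · simp only [h, if_true, min_eq_left h, indicator, mem_Ioc, le_min_iff, hs, and_true]
  · rw [indicator_of_notMem, indicator_of_notMem]
    · exact fun h' => h (h'.1.le.trans hs)
    · intro h'
      rw [min_eq_right (not_le.1 h).le] at h'
      exact absurd h'.1 (not_lt.2 hs)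

lemma integral_clip (H : SimpleIntegrand N τ d) {t : ℝ} (ht : 0 ≤ t) (ω : Ω) :
    (H.clip ht).integral ω =
      ∑ k, N.elem (H.coeff k) (min (H.left k) t) (min (H.right k) t) ω := by
  refine Finset.sum_congr rfl fun k _ => ?_
  simp only [clip, Noise.elem]
  by_cases h : H.left k ≤ t
  · simp only [h, if_true]
  · have h1 : H.right k ≥ t := (not_le.1 h).le.trans (H.left_le_right k)
    simp only [h, if_false, min_eq_right (not_le.1 h).le, min_eq_right h1, N.increment_self,
      matVec_zero_right]

end SimpleIntegrand

end SimpleOperations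

/-! ### The Itô integral: linearity, isometry, increments -/

section ItoIntegral

variable {Ω : Type*} [mΩ : MeasurableSpace Ω] {P : Measure Ω} {T τ : ℝ} {m d : ℕ}
  {N : Noise P T m}

lemma tendsto_eLpNorm_of_tendsto_sub {α E : Type*} [MeasurableSpace α] {μ : Measure α}
    [NormedAddCommGroup E] {p : ℝ≥0∞} (hp : 1 ≤ p) {f : ℕ → α → E} {g : α → E}
    (hf : ∀ n, AEStronglyMeasurable (f n) μ) (hg : AEStronglyMeasurable g μ)
    (h : Tendsto (fun n => eLpNorm (fun x => f n x - g x) p μ) atTop (𝓝 0))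
    (hgp : eLpNorm g p μ ≠ ∞) :
    Tendsto (fun n => eLpNorm (f n) p μ) atTop (𝓝 (eLpNorm g p μ)) := by
  have h1 := ENNReal.Tendsto.sub (tendsto_const_nhds (x := eLpNorm g p μ)) h (Or.inl hgp)
  have h2 := (tendsto_const_nhds (x := eLpNorm g p μ)).add h
  rw [tsub_zero] at h1
  rw [add_zero] at h2
  refine tendsto_of_tendsto_of_tendsto_of_le_of_le h1 h2 (fun n => ?_) (fun n => ?_)
  · refine tsub_le_iff_right.2 ?_
    have := eLpNorm_sub_le (hf n) ((hf n).sub hg) hp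
    rwa [sub_sub_cancel] at this
  · have := eLpNorm_add_le hg ((hf n).sub hg) hp
    rwa [add_sub_cancel] at this

lemma tendsto_lintegral_sq_iff {α E : Type*} [MeasurableSpace α] {μ : Measure α}
    [NormedAddCommGroup E] {f : ℕ → α → E} :
    Tendsto (fun n => eLpNorm (f n) 2 μ) atTop (𝓝 0) ↔
      Tendsto (fun n => ∫⁻ x, ‖f n x‖ₑ ^ 2 ∂μ) atTop (𝓝 0) := by
  constructor
  · intro h
    have := (ENNReal.continuous_pow 2).tendsto 0 |>.comp h
    simpa [Function.comp_def, eLpNorm_two_sq] using this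
  · intro h
    have := (ENNReal.continuous_rpow_const (y := (1 / 2 : ℝ))).tendsto 0 |>.comp h
    simpa [Function.comp_def, eLpNorm_two_eq] using this

lemma tendsto_zero_of_le_two_mul_add {u v w : ℕ → ℝ≥0∞} (hv : Tendsto v atTop (𝓝 0))
    (hw : Tendsto w atTop (𝓝 0)) (h : ∀ n, u n ≤ 2 * v n + 2 * w n) :
    Tendsto u atTop (𝓝 0) := by
  have h2 : (2 : ℝ≥0∞) ≠ ∞ := by simp
  have := (ENNReal.Tendsto.const_mul hv (Or.inr h2)).add (ENNReal.Tendsto.const_mul hw (Or.inr h2))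
  simp only [mul_zero, add_zero] at this
  exact tendsto_of_tendsto_of_tendsto_of_le_of_le tendsto_const_nhds this (fun _ => zero_le) h

namespace Noise.MemL2

variable {V : Type*} [NormedAddCommGroup V] [MeasurableSpace V] [BorelSpace V]
  [SecondCountableTopology V] {Y Z : ℝ → Ω → V}

omit [BorelSpace V] [SecondCountableTopology V] in
lemma mono (h : N.MemL2 τ Y) {t : ℝ} (ht : t ≤ τ) : N.MemL2 t Y :=
  ⟨fun s hs => h.progressive s ⟨hs.1, hs.2.trans ht⟩, (energy_mono Y ht).trans_lt h.energy_lt_top⟩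

lemma sub [SFinite P] (hY : N.MemL2 τ Y) (hZ : N.MemL2 τ Z) (hτ : 0 ≤ τ) :
    N.MemL2 τ fun s ω => Y s ω - Z s ω :=
  ⟨hY.progressive.sub hZ.progressive,
    (hY.progressive.energy_sub_le hZ.progressive hτ).trans_lt (ENNReal.add_lt_top.2
      ⟨ENNReal.mul_lt_top (by simp) hY.energy_lt_top,
        ENNReal.mul_lt_top (by simp) hZ.energy_lt_top⟩)⟩

omit [BorelSpace V] [SecondCountableTopology V] in
lemma indicator (hY : N.MemL2 τ Y) {S : Set ℝ} (hS : MeasurableSet S) :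
    N.MemL2 τ fun s ω => S.indicator (fun s => Y s ω) s := by
  refine ⟨hY.progressive.indicator hS, lt_of_le_of_lt ?_ hY.energy_lt_top⟩
  refine lintegral_mono fun ω => lintegral_mono fun s => ?_
  gcongr
  by_cases hs : s ∈ S <;> simp [hs]

end Noise.MemL2

namespace Noise.HasItoIntegral

variable [IsProbabilityMeasure P] {b b' : ℝ → Ω → Mat d m} {I I' : Ω → Vec d}

lemma sub (h : N.HasItoIntegral b τ I) (h' : N.HasItoIntegral b' τ I') (hτ : 0 ≤ τ)
    (hT : τ ≤ T) :
    N.HasItoIntegral (fun s ω => b s ω - b' s ω) τ fun ω => I ω - I' ω := by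
  obtain ⟨H, h1, h2⟩ := h.approx
  obtain ⟨K, h3, h4⟩ := h'.approx
  refine ⟨h.memL2.sub h'.memL2 hτ, h.memLp.sub h'.memLp, fun n => (H n).sub (K n), ?_, ?_⟩
  · refine tendsto_zero_of_le_two_mul_add h1 h3 fun n => ?_
    refine le_trans (le_of_eq ?_) (((H n).progressive.sub h.memL2.progressive).energy_sub_le
      ((K n).progressive.sub h'.memL2.progressive) hτ)
    refine energy_congr fun s _ ω => ?_
    rw [SimpleIntegrand.process_sub]
    congr 1
    abel
  · rw [tendsto_lintegral_sq_iff] at h2 h4 ⊢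
    refine tendsto_zero_of_le_two_mul_add h2 h4 fun n => ?_
    refine le_trans (le_of_eq ?_) (lintegral_enorm_sub_sq_le
      ((((H n).memLp_integral hT).sub h.memLp).1))
    refine lintegral_congr fun ω => ?_
    rw [SimpleIntegrand.integral_sub]
    congr 2
    abel

/-- Approximation in energy does not see changes of the integrand of zero energy, so the same simple
integrands serve for `b'`. -/
lemma congr (h : N.HasItoIntegral b τ I) (hb' : N.MemL2 τ b') (hτ : 0 ≤ τ)
    (h0 : energy P τ (fun s ω => b s ω - b' s ω) = 0) : N.HasItoIntegral b' τ I := by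
  obtain ⟨H, h1, h2⟩ := h.approx
  refine ⟨hb', h.memLp, H, ?_, h2⟩
  refine tendsto_zero_of_le_two_mul_add (w := fun _ => 0) h1 tendsto_const_nhds fun n => ?_
  refine le_trans (le_of_eq (energy_congr fun s _ ω => ?_))
    ((((H n).progressive.sub h.memL2.progressive).energy_add_le
      (h.memL2.progressive.sub hb'.progressive) hτ).trans (by rw [h0]))
  congr 1
  abel

/-- The Itô isometry. -/
lemma lintegral_sq (h : N.HasItoIntegral b τ I) (hτ : 0 ≤ τ) (hT : τ ≤ T) :
    ∫⁻ ω, ‖I ω‖ₑ ^ 2 ∂P = energy P τ b := by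
  obtain ⟨H, h1, h2⟩ := h.approx
  have hbp := h.memL2.progressive
  have h3 := tendsto_eLpNorm_of_tendsto_sub one_le_two
    (fun n => ((H n).memLp_integral hT).1) h.memLp.1 h2 h.memLp.2.ne
  set μ := (volume.restrict (Icc 0 τ)).prod P with hμ
  have h4 : Tendsto (fun n => eLpNorm (fun p : ℝ × Ω => (H n).process p.1 p.2 - b p.1 p.2) 2 μ)
      atTop (𝓝 0) := by
    rw [tendsto_lintegral_sq_iff]
    refine h1.congr fun n => ?_
    exact ((H n).progressive.sub hbp).energy_eq_prod hτ
  have hbm : MemLp (fun p : ℝ × Ω => b p.1 p.2) 2 μ :=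
    memLp_two_of_lintegral (hbp.aemeasurable hτ).aestronglyMeasurable
      (by rw [← hbp.energy_eq_prod hτ]; exact h.memL2.energy_lt_top)
  have h5 := tendsto_eLpNorm_of_tendsto_sub one_le_two
    (fun n => ((H n).progressive.aemeasurable hτ).aestronglyMeasurable) hbm.1 h4 hbm.2.ne
  -- The isometry for simple integrands equates the norms of the two approximating sequences, and
  -- therefore their limits.
  have h6 : ∀ n, eLpNorm (H n).integral 2 P =
      eLpNorm (fun p : ℝ × Ω => (H n).process p.1 p.2) 2 μ := by
    intro n
    rw [eLpNorm_two_eq, eLpNorm_two_eq, (H n).lintegral_integral_sq hT,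
      (H n).progressive.energy_eq_prod hτ]
  have h7 : eLpNorm I 2 P = eLpNorm (fun p : ℝ × Ω => b p.1 p.2) 2 μ :=
    tendsto_nhds_unique h3 (by simpa only [h6] using h5)
  rw [← eLpNorm_two_sq, h7, eLpNorm_two_sq, hbp.energy_eq_prod hτ]

omit [IsProbabilityMeasure P] in
/-- An Itô integral up to time `τ` is an Itô integral up to any later time of the integrand cut
off at time `τ`. -/
lemma extend (h : N.HasItoIntegral b τ I) {t : ℝ} (hτt : τ ≤ t)
    (hb : N.MemL2 t b) :
    N.HasItoIntegral (fun s ω => (Iic τ).indicator (fun s => b s ω) s) t I := by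
  obtain ⟨H, h1, h2⟩ := h.approx
  refine ⟨hb.indicator measurableSet_Iic, h.memLp, fun n => (H n).extend hτt, ?_, h2⟩
  refine h1.congr fun n => ?_
  refine lintegral_congr fun ω => ?_
  have : ∀ s, ‖((H n).extend hτt).process s ω - (Iic τ).indicator (fun s => b s ω) s‖ₑ ^ 2 =
      (Iic τ).indicator (fun s => ‖(H n).process s ω - b s ω‖ₑ ^ 2) s := by
    intro s
    change ‖(H n).process s ω - _‖ₑ ^ 2 = _
    by_cases hs : s ∈ Iic τ
    · simp only [indicator_of_mem hs]
    · simp only [indicator_of_notMem hs, (H n).process_of_lt (not_le.1 hs)]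
      simp
  simp only [this]
  rw [setLIntegral_indicator measurableSet_Iic]
  congr 2
  ext s
  simp only [mem_inter_iff, mem_Iic, mem_Icc]
  exact ⟨fun h => ⟨h.2, h.1, h.2.trans hτt⟩, fun h => ⟨h.2.1, h.1⟩⟩

/-- The integral up to s is an integral up to t of the integrand cut off at s; by linearity the
difference integrates what remains after s, and the isometry applies. -/
lemma lintegral_sub_sq {s t : ℝ} (hI : N.HasItoIntegral b t I) (hI' : N.HasItoIntegral b s I')
    (hs : 0 ≤ s) (hst : s ≤ t) (ht : t ≤ T) :
    ∫⁻ ω, ‖I ω - I' ω‖ₑ ^ 2 ∂P =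
      energy P t fun r ω => (Ioi s).indicator (fun r => b r ω) r := by
  rw [(hI.sub (hI'.extend hst hI.memL2) (hs.trans hst) ht).lintegral_sq (hs.trans hst) ht]
  refine energy_congr fun r _ ω => ?_
  rcases le_or_gt r s with h | h
  · simp [h, not_lt.2 h]
  · simp [h, not_le.2 h]

end Noise.HasItoIntegral

end ItoIntegral

end SDEControl

namespace SDEControl

/-! ### A maximal inequality in discrete time -/

section Maximal

variable {Ω : Type*} [mΩ : MeasurableSpace Ω] {P : Measure Ω} {d : ℕ}

/-- Kolmogorov's maximal inequality for square integrable martingales in discrete time. -/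
lemma kolmogorov_maximal_inequality [IsProbabilityMeasure P] {G : ℕ → MeasurableSpace Ω}
    (hmono : Monotone G) (hle : ∀ k, G k ≤ mΩ) {M : ℕ → Ω → Vec d}
    (hm : ∀ k, Measurable[G k] (M k)) (hL : ∀ k, MemLp (M k) 2 P) (n : ℕ)
    (horth : ∀ k ≤ n, ∀ η : Ω → Vec d, Measurable[G k] η → MemLp η 2 P →
      ∫ ω, inner ℝ (η ω) (M n ω - M k ω) ∂P = 0) {ε : ℝ} (hε : 0 < ε) :
    ENNReal.ofReal (ε ^ 2) * P {ω | ∃ k ≤ n, ε ≤ ‖M k ω‖} ≤ ∫⁻ ω, ‖M n ω‖ₑ ^ 2 ∂P := by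
  -- The event that the norm reaches ε for the first time at index k.
  let D : ℕ → Set Ω := fun k => {ω | ε ≤ ‖M k ω‖} ∩ ⋂ j ∈ Finset.range k, {ω | ‖M j ω‖ < ε}
  have hDG : ∀ k, MeasurableSet[G k] (D k) := by
    intro k
    refine @MeasurableSet.inter _ (G k) _ _ ((measurable_norm.comp (hm k)) measurableSet_Ici) ?_
    refine @Finset.measurableSet_biInter _ _ (G k) _ _ fun j hj => ?_
    exact hmono (Finset.mem_range.1 hj).le _ ((measurable_norm.comp (hm j)) measurableSet_Iio)
  have hD : ∀ k, MeasurableSet (D k) := fun k => hle k _ (hDG k)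
  have hdisj : ∀ i j, i < j → Disjoint (D i) (D j) := by
    intro i j hij
    refine Set.disjoint_left.2 fun ω hi hj => ?_
    have h1 : ε ≤ ‖M i ω‖ := hi.1
    have h2 : ‖M i ω‖ < ε := mem_iInter₂.1 hj.2 i (Finset.mem_range.2 hij)
    linarith
  have hcover : {ω | ∃ k ≤ n, ε ≤ ‖M k ω‖} ⊆ ⋃ k ∈ Finset.range (n + 1), D k := by
    classical
    rintro ω ⟨k, hk, hω⟩
    have hex : ∃ k, ε ≤ ‖M k ω‖ := ⟨k, hω⟩
    refine mem_iUnion₂.2 ⟨Nat.find hex, ?_, Nat.find_spec hex, ?_⟩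
    · have := Nat.find_min' hex hω
      exact Finset.mem_range.2 (by omega)
    · exact mem_iInter₂.2 fun j hj => not_le.1 (Nat.find_min hex (Finset.mem_range.1 hj))
  have hkey : ∀ k ≤ n, ENNReal.ofReal (ε ^ 2) * P (D k) ≤ ∫⁻ ω in D k, ‖M n ω‖ₑ ^ 2 ∂P := by
    intro k hk
    -- Testing the martingale property with this η removes the cross term in ‖M_n‖² = ‖M_k + (M_n -
    -- M_k)‖², so on the event `D k` the second moment of M_n is at least ε² P(D k).
    set η : Ω → Vec d := (D k).indicator (M k) with hη
    have hηm : Measurable[G k] η := (hm k).indicator (hDG k)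
    have hηL : MemLp η 2 P := (hL k).indicator (hD k)
    have h0 := horth k hk η hηm hηL
    have hi1 : Integrable (fun ω => inner ℝ (η ω) (M n ω - M k ω)) P :=
      integrable_inner_of_memLp hηL ((hL n).sub (hL k))
    have hi2 : Integrable ((D k).indicator fun _ : Ω => ε ^ 2) P :=
      (integrable_const _).indicator (hD k)
    have hi3 : Integrable (fun ω => ‖(D k).indicator (M n) ω‖ ^ 2) P :=
      ((hL n).indicator (hD k)).integrable_norm_pow'
    have hle : ∫ ω, ((D k).indicator (fun _ : Ω => ε ^ 2) ω +
        2 * inner ℝ (η ω) (M n ω - M k ω)) ∂P ≤ ∫ ω, ‖(D k).indicator (M n) ω‖ ^ 2 ∂P := by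
      refine integral_mono (hi2.add (hi1.const_mul 2)) hi3 fun ω => ?_
      by_cases hω : ω ∈ D k
      · simp only [hη, indicator_of_mem hω]
        have h1 : ε ^ 2 ≤ ‖M k ω‖ ^ 2 := pow_le_pow_left₀ hε.le hω.1 2
        have h2 := norm_add_sq_real (M k ω) (M n ω - M k ω)
        rw [add_sub_cancel] at h2
        nlinarith [sq_nonneg ‖M n ω - M k ω‖]
      · simp [hη, hω]
    rw [integral_add hi2 (hi1.const_mul 2), integral_const_mul, h0, mul_zero, add_zero,
      integral_indicator_const _ (hD k), smul_eq_mul] at hle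
    have h3 := ENNReal.ofReal_le_ofReal hle
    have h4 := lintegral_enorm_sq_eq_ofReal (f := (D k).indicator (M n))
      ((hL n).indicator (hD k))
    rw [← h4, mul_comm, ENNReal.ofReal_mul (sq_nonneg _), ofReal_measureReal] at h3
    refine h3.trans (le_of_eq ?_)
    rw [← lintegral_indicator (hD k)]
    refine lintegral_congr fun ω => ?_
    by_cases hω : ω ∈ D k <;> simp [hω]
  calc ENNReal.ofReal (ε ^ 2) * P {ω | ∃ k ≤ n, ε ≤ ‖M k ω‖}
      ≤ ENNReal.ofReal (ε ^ 2) * ∑ k ∈ Finset.range (n + 1), P (D k) := by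
        gcongr
        exact (measure_mono hcover).trans (measure_biUnion_finset_le _ _)
    _ = ∑ k ∈ Finset.range (n + 1), ENNReal.ofReal (ε ^ 2) * P (D k) := Finset.mul_sum _ _ _
    _ ≤ ∑ k ∈ Finset.range (n + 1), ∫⁻ ω in D k, ‖M n ω‖ₑ ^ 2 ∂P :=
        Finset.sum_le_sum fun k hk => hkey k (Nat.lt_succ_iff.1 (Finset.mem_range.1 hk))
    _ = ∫⁻ ω in ⋃ k ∈ Finset.range (n + 1), D k, ‖M n ω‖ₑ ^ 2 ∂P := by
        rw [lintegral_biUnion_finset _ fun k _ => hD k]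
        intro i _ j _ hij
        rcases lt_or_gt_of_ne hij with h | h
        · exact hdisj i j h
        · exact (hdisj j i h).symm
    _ ≤ _ := setLIntegral_le_lintegral _ _

end Maximal

/-! ### Continuous versions and the maximal inequality for simple integrands -/

section ContinuousPaths

variable {Ω : Type*} [mΩ : MeasurableSpace Ω] {P : Measure Ω} {T : ℝ} {m d : ℕ}
  {N : Noise P T m}

lemma exists_measurableSet_of_ae {p : Ω → Prop} (h : ∀ᵐ ω ∂P, p ω) :
    ∃ G : Set Ω, MeasurableSet G ∧ P Gᶜ = 0 ∧ ∀ ω ∈ G, p ω := by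
  obtain ⟨t, ht, htm, ht0⟩ := exists_measurable_superset_of_null h
  refine ⟨tᶜ, htm.compl, by rwa [compl_compl], fun ω hω => ?_⟩
  by_contra hp
  exact hω (ht hp)

/-- A version of the Brownian motion all of whose paths are continuous; it is adapted since the
filtration contains the null events. -/
lemma Noise.exists_continuous_version (N : Noise P T m) :
    ∃ W : Fin m → ℝ≥0 → Ω → ℝ, (∀ i ω, Continuous fun s => W i s ω) ∧
      (∀ i (s : ℝ≥0) (t : ℝ), (s : ℝ) ≤ t → Measurable[N.filtration t] (W i s)) ∧
      ∀ᵐ ω ∂P, ∀ i s, W i s ω = N.B i s ω := by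
  have h : ∀ᵐ ω ∂P, ∀ i, Continuous fun s => N.B i s ω :=
    ae_all_iff.2 fun i => (N.isBrownian.brownian i).cont
  obtain ⟨G, hG, hG0, hGc⟩ := exists_measurableSet_of_ae h
  refine ⟨fun i s => G.indicator (N.B i s), fun i ω => ?_, fun i s t hst => ?_, ?_⟩
  · by_cases hω : ω ∈ G
    · simpa only [indicator_of_mem hω] using hGc ω hω i
    · simpa only [indicator_of_notMem hω] using continuous_const
  · refine (N.measurable_B i hst).indicator ?_
    rw [← compl_compl G]
    exact @MeasurableSet.compl _ _ (N.filtration t) (N.measurableSet_of_null t hG.compl hG0)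
  · filter_upwards [compl_mem_ae_iff.2 hG0] with ω hω i s
    rw [compl_compl] at hω
    exact indicator_of_mem hω _

namespace SimpleIntegrand

/-- The indefinite integral of a simple integrand has an adapted version all of whose paths are
continuous. -/
lemma exists_path (H : SimpleIntegrand N T d) :
    ∃ X : ℝ → Ω → Vec d, (∀ ω, Continuous fun t => X t ω) ∧
      (∀ t ∈ Icc 0 T, Measurable[N.filtration t] (X t)) ∧
      ∀ t (ht : 0 ≤ t), X t =ᵐ[P] (H.clip ht).integral := by
  obtain ⟨W, hWc, hWm, hWB⟩ := N.exists_continuous_version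
  let w : ℝ → ℝ → Ω → Vec m := fun s t ω =>
    WithLp.toLp 2 fun i => W i t.toNNReal ω - W i s.toNNReal ω
  refine ⟨fun t ω => ∑ k, matVec (H.coeff k ω) (w (min (H.left k) t) (min (H.right k) t) ω),
    fun ω => ?_, fun t ht => ?_, fun t ht => ?_⟩
  · refine continuous_finsetSum _ fun k _ => ?_
    refine (continuous_matVec (d := d) (m := m)).comp (continuous_const.prodMk ?_)
    refine (PiLp.continuous_toLp 2 _).comp (continuous_pi fun i => ?_)
    exact ((hWc i ω).comp (continuous_real_toNNReal.comp (by fun_prop))).sub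
      ((hWc i ω).comp (continuous_real_toNNReal.comp (by fun_prop)))
  · refine Finset.measurable_fun_sum _ fun k _ => ?_
    rcases le_total (H.left k) t with h | h
    · refine (continuous_matVec (d := d) (m := m)).measurable.comp
        (((H.measurable_coeff k).mono (N.filtration_mono h) le_rfl).prodMk ?_)
      refine measurable_euclidean_iff fun i => ?_
      refine (hWm i _ t ?_).sub (hWm i _ t ?_)
      · rw [Real.coe_toNNReal _ (le_min ((H.left_nonneg k).trans (H.left_le_right k)) ht.1)]
        exact min_le_right _ _
      · rw [Real.coe_toNNReal _ (le_min (H.left_nonneg k) ht.1)]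
        exact min_le_right _ _
    -- Before the k-th interval starts both endpoints are truncated to t, the increment is zero, and
    -- the coefficient, possibly not yet measurable, drops out.
    · rw [min_eq_right h, min_eq_right (h.trans (H.left_le_right k))]
      have : ∀ ω, w t t ω = 0 := by
        intro ω
        ext i
        simp [w]
      simp only [this, matVec_zero_right]
      exact measurable_const
  · filter_upwards [hWB] with ω hω
    rw [integral_clip]
    refine Finset.sum_congr rfl fun k _ => ?_
    rw [Noise.elem]
    congr 1
    ext i
    simp [w, hω, Noise.increment_apply]

lemma integral_clip_sub (H K : SimpleIntegrand N T d) {t : ℝ} (ht : 0 ≤ t) (ω : Ω) :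
    ((H.sub K).clip ht).integral ω = (H.clip ht).integral ω - (K.clip ht).integral ω := by
  rw [integral_clip, integral_clip, integral_clip, sub_eq_add_neg, ← Finset.sum_neg_distrib]
  refine (Fin.sum_univ_add _).trans ?_
  congr 1
  · simp [sub]
  · refine Finset.sum_congr rfl fun k _ => ?_
    simp [sub, Noise.elem, matVec_neg_left]

variable [IsProbabilityMeasure P]

/-- The indefinite integral of a simple integrand is a martingale. -/
lemma integral_inner_clip_sub_clip (H : SimpleIntegrand N T d) {s t : ℝ} (hs : 0 ≤ s)
    (hst : s ≤ t) (ht : t ≤ T) {η : Ω → Vec d} (hη : Measurable[N.filtration s] η)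
    (hη2 : MemLp η 2 P) :
    ∫ ω, inner ℝ (η ω) ((H.clip (hs.trans hst)).integral ω - (H.clip hs).integral ω) ∂P = 0 := by
  have ht0 := hs.trans hst
  have hmem : ∀ k {u : ℝ} (hu : 0 ≤ u) (_ : u ≤ T),
      MemLp (N.elem (H.coeff k) (min (H.left k) u) (min (H.right k) u)) 2 P := by
    intro k u hu huT
    rcases le_total (H.left k) u with h | h
    · rw [min_eq_left h]
      exact N.memLp_elem (H.left_nonneg k) (le_min (H.left_le_right k) h)
        ((min_le_right _ _).trans huT) (H.measurable_coeff k) (H.memLp_coeff k)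
    · rw [min_eq_right h, min_eq_right (h.trans (H.left_le_right k))]
      simp only [funext fun ω => N.elem_self (H.coeff k) u ω]
      exact MemLp.zero
  simp only [integral_clip, ← Finset.sum_sub_distrib, inner_sum]
  have hint : ∀ k, Integrable (fun ω => inner ℝ (η ω)
      (N.elem (H.coeff k) (min (H.left k) t) (min (H.right k) t) ω -
        N.elem (H.coeff k) (min (H.left k) s) (min (H.right k) s) ω)) P := fun k =>
    integrable_inner_of_memLp hη2 ((hmem k ht0 ht).sub (hmem k hs (hst.trans ht)))
  rw [integral_finsetSum _ fun k _ => hint k]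
  refine Finset.sum_eq_zero fun k _ => ?_
  have hlr := H.left_le_right k
  -- If the interval starts by time s, the coefficient is known at s and only the increment after s
  -- remains. If it starts later, η is known at its left endpoint. In both cases an increment is
  -- paired with functions of its past.
  rcases le_or_gt (H.left k) s with hls | hls
  · rw [min_eq_left hls, min_eq_left (hls.trans hst)]
    have h1 : ∀ ω, N.elem (H.coeff k) (H.left k) (min (H.right k) t) ω -
        N.elem (H.coeff k) (H.left k) (min (H.right k) s) ω =
        N.elem (H.coeff k) (min (H.right k) s) (min (H.right k) t) ω := fun ω => by
      rw [sub_eq_iff_eq_add', N.elem_add]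
    simp only [h1]
    rcases le_or_gt (H.right k) s with hrs | hrs
    · rw [min_eq_left hrs, min_eq_left (hrs.trans hst)]
      simp only [N.elem_self, inner_zero_right, integral_zero]
    · rw [min_eq_right hrs.le]
      exact N.integral_inner_matVec_increment hs (le_min hrs.le hst)
        ((min_le_right _ _).trans ht) hη hη2
        ((H.measurable_coeff k).mono (N.filtration_mono hls) le_rfl) (H.memLp_coeff k)
  · rw [min_eq_right hls.le, min_eq_right (hls.le.trans hlr)]
    simp only [N.elem_self, sub_zero]
    rcases le_or_gt t (H.left k) with htl | htl
    · rw [min_eq_right htl, min_eq_right (htl.trans hlr)]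
      simp only [N.elem_self, inner_zero_right, integral_zero]
    · rw [min_eq_left htl.le]
      exact N.integral_inner_matVec_increment (H.left_nonneg k) (le_min hlr htl.le)
        ((min_le_right _ _).trans ht) (hη.mono (N.filtration_mono hls.le) le_rfl) hη2
        (H.measurable_coeff k) (H.memLp_coeff k)

/-- Doob's maximal inequality for the indefinite integral of a simple integrand. -/
lemma maximal_inequality (H : SimpleIntegrand N T d) (hT : 0 ≤ T) {X : ℝ → Ω → Vec d}
    (hXc : ∀ ω, Continuous fun t => X t ω)
    (hXm : ∀ t ∈ Icc 0 T, Measurable[N.filtration t] (X t))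
    (hXH : ∀ t (ht : 0 ≤ t), X t =ᵐ[P] (H.clip ht).integral) {ε : ℝ} (hε : 0 < ε) :
    ENNReal.ofReal (ε ^ 2) * P {ω | ∃ t ∈ Icc 0 T, ε < ‖X t ω‖} ≤ energy P T H.process := by
  -- Uniform grid with n + 1 steps, capped at T so that it is defined and monotone for all indices;
  -- index n + 1 gives T.
  let τ : ℕ → ℕ → ℝ := fun n k => min (k * (T / (n + 1))) T
  have hτ0 : ∀ n k, 0 ≤ τ n k := fun n k => le_min (by positivity) hT
  have hτT : ∀ n k, τ n k ≤ T := fun n k => min_le_right _ _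
  have hτm : ∀ n, Monotone (τ n) := by
    intro n i j hij
    have : (i : ℝ) ≤ j := by exact_mod_cast hij
    exact min_le_min_right _ (by gcongr)
  have hτend : ∀ n, τ n (n + 1) = T := by
    intro n
    simp only [τ]
    push_cast
    rw [mul_div_cancel₀ _ (by positivity), min_self]
  let E : ℕ → Set Ω := fun n => {ω | ∃ k ≤ n + 1, ε ≤ ‖X (τ n k) ω‖}
  have hbound : ∀ n, ENNReal.ofReal (ε ^ 2) * P (E n) ≤ energy P T H.process := by
    intro n
    have hL : ∀ k, MemLp (X (τ n k)) 2 P := fun k =>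
      ((H.clip (hτ0 n k)).memLp_integral (hτT n k)).ae_eq (hXH _ _).symm
    refine (kolmogorov_maximal_inequality (G := fun k => N.filtration (τ n k))
      (fun i j hij => N.filtration_mono (hτm n hij)) (fun k => N.filtration_le _)
      (fun k => hXm _ ⟨hτ0 n k, hτT n k⟩) hL (n + 1) (fun k hk η hη hη2 => ?_) hε).trans
      (le_of_eq ?_)
    · rw [← H.integral_inner_clip_sub_clip (hτ0 n k) (hτm n hk) (hτT n (n + 1)) hη hη2]
      refine integral_congr_ae ?_
      filter_upwards [hXH _ (hτ0 n k), hXH _ (hτ0 n (n + 1))] with ω h1 h2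
      rw [h1, h2]
    · rw [hτend n]
      have h1 : ∫⁻ ω, ‖X T ω‖ₑ ^ 2 ∂P = ∫⁻ ω, ‖(H.clip hT).integral ω‖ₑ ^ 2 ∂P :=
        lintegral_congr_ae (by filter_upwards [hXH T hT] with ω hω; rw [hω])
      rw [h1, lintegral_integral_sq _ le_rfl]
      exact energy_congr fun s hs ω => by rw [H.process_clip hT hs.2]
  -- A strict exceedance at t is seen, by continuity, at the grid point just above t on all
  -- sufficiently fine grids. The grids are not nested, so the events are collected as a lower
  -- limit, an increasing union to which continuity of the measure applies.
  have hsub : {ω | ∃ t ∈ Icc 0 T, ε < ‖X t ω‖} ⊆ ⋃ n, ⋂ j, E (n + j) := by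
    rintro ω ⟨t, ht, hω⟩
    have hfloor : Tendsto (fun n : ℕ => τ n ⌈t / (T / (n + 1))⌉₊) atTop (𝓝 t) := by
      rcases hT.eq_or_lt with hT0 | hT0
      · have : t = 0 := le_antisymm (ht.2.trans hT0.ge) ht.1
        subst hT0
        simp [τ, this]
      have h1 : ∀ n : ℕ, t ≤ τ n ⌈t / (T / (n + 1))⌉₊ := by
        intro n
        have hp : 0 < T / ((n : ℝ) + 1) := by positivity
        refine le_min ?_ ht.2
        have := Nat.le_ceil (t / (T / ((n : ℝ) + 1)))
        rwa [div_le_iff₀ hp] at this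
      have h2 : ∀ n : ℕ, τ n ⌈t / (T / (n + 1))⌉₊ ≤ t + T / (n + 1) := by
        intro n
        have hp : 0 < T / ((n : ℝ) + 1) := by positivity
        refine (min_le_left _ _).trans ?_
        have := (Nat.ceil_lt_add_one (div_nonneg ht.1 hp.le)).le
        calc (⌈t / (T / ((n : ℝ) + 1))⌉₊ : ℝ) * (T / (n + 1))
            ≤ (t / (T / ((n : ℝ) + 1)) + 1) * (T / (n + 1)) := by gcongr
          _ = t + T / (n + 1) := by field_simp
      have h3 : Tendsto (fun n : ℕ => t + T / ((n : ℝ) + 1)) atTop (𝓝 t) := by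
        have h4 := (tendsto_const_div_atTop_nhds_zero_nat T).comp (tendsto_add_atTop_nat 1)
        have h5 := (tendsto_const_nhds (x := t)).add h4
        simpa [Function.comp_def] using h5
      exact tendsto_of_tendsto_of_tendsto_of_le_of_le tendsto_const_nhds h3 h1 h2
    have hlim := (((hXc ω).norm.tendsto t).comp hfloor).eventually_const_lt hω
    obtain ⟨n, hn⟩ := eventually_atTop.1 hlim
    refine mem_iUnion.2 ⟨n, mem_iInter.2 fun j => ⟨_, ?_, (hn (n + j) (by omega)).le⟩⟩
    refine Nat.ceil_le.2 ?_
    rcases hT.eq_or_lt with hT0 | hT0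
    · subst hT0
      simp
      positivity
    · have hp : 0 < T / (((n + j : ℕ) : ℝ) + 1) := by positivity
      rw [div_le_iff₀ hp]
      push_cast
      rw [mul_div_cancel₀ _ (by positivity)]
      exact ht.2
  have hmonoE : Monotone fun n => ⋂ j, E (n + j) := by
    intro a b hab ω hω
    refine mem_iInter.2 fun j => ?_
    have := mem_iInter.1 hω (b - a + j)
    rwa [show a + (b - a + j) = b + j by omega] at this
  calc ENNReal.ofReal (ε ^ 2) * P {ω | ∃ t ∈ Icc 0 T, ε < ‖X t ω‖}
      ≤ ENNReal.ofReal (ε ^ 2) * P (⋃ n, ⋂ j, E (n + j)) := by gcongr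
    _ = ⨆ n, ENNReal.ofReal (ε ^ 2) * P (⋂ j, E (n + j)) := by
        rw [hmonoE.measure_iUnion, ENNReal.mul_iSup]
    _ ≤ energy P T H.process := by
        refine iSup_le fun n => le_trans ?_ (hbound n)
        gcongr
        exact iInter_subset_of_subset 0 (by simp)

end SimpleIntegrand

end ContinuousPaths

end SDEControl

namespace SDEControl

/-- Pointwise limits of measurable vector-valued functions are measurable. -/
lemma measurable_limUnder_vec {α : Type*} {G : MeasurableSpace α} {n : ℕ} {f : ℕ → α → Vec n}
    (hf : ∀ k, Measurable (f k)) : Measurable fun x => limUnder atTop fun k => f k x :=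
  (StronglyMeasurable.limUnder (l := atTop) fun k => (hf k).stronglyMeasurable).measurable

/-! ### The indefinite Itô integral as a continuous process -/

section ItoProcess

variable {Ω : Type*} [mΩ : MeasurableSpace Ω] {P : Measure Ω} {T : ℝ} {m d : ℕ}
  {N : Noise P T m}

lemma ennreal_geometric_ne_top {c r : ℝ≥0∞} (hc : c ≠ ∞) (hr : r < 1) :
    ∑' n : ℕ, c * r ^ n ≠ ∞ := by
  rw [ENNReal.tsum_mul_left, ENNReal.tsum_geometric]
  exact ENNReal.mul_ne_top hc (ENNReal.inv_ne_top.2 (tsub_pos_of_lt hr).ne')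

/-- A sequence of continuous functions with geometrically small increments converges uniformly. -/
lemma continuousOn_limUnder_of_geometric {E : Type*} [NormedAddCommGroup E] [CompleteSpace E]
    {S : Set ℝ} {f : ℕ → ℝ → E} (hf : ∀ n, ContinuousOn (f n) S) {n₀ : ℕ}
    (h : ∀ n, n₀ ≤ n → ∀ t ∈ S, ‖f (n + 1) t - f n t‖ ≤ (1 / 2) ^ n) :
    (∀ t ∈ S, Tendsto (fun n => f n t) atTop (𝓝 (limUnder atTop fun n => f n t))) ∧
      ContinuousOn (fun t => limUnder atTop fun n => f n t) S := by
  have hdist : ∀ t ∈ S, ∀ j, dist (f (j + n₀) t) (f (j + 1 + n₀) t) ≤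
      (1 / 2) ^ n₀ * (1 / 2) ^ j := by
    intro t ht j
    rw [dist_comm, dist_eq_norm, ← pow_add, add_comm n₀ j, show j + 1 + n₀ = j + n₀ + 1 by ring]
    exact h _ (by omega) t ht
  have hlim : ∀ t ∈ S, Tendsto (fun n => f n t) atTop (𝓝 (limUnder atTop fun n => f n t)) := by
    intro t ht
    refine tendsto_nhds_limUnder ?_
    obtain ⟨l, hl⟩ := cauchySeq_tendsto_of_complete
      (cauchySeq_of_le_geometric (1 / 2) _ (by norm_num) (hdist t ht))
    exact ⟨l, (tendsto_add_atTop_iff_nat n₀).1 hl⟩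
  refine ⟨hlim, ?_⟩
  have hunif : TendstoUniformlyOn (fun j t => f (j + n₀) t)
      (fun t => limUnder atTop fun n => f n t) atTop S := by
    rw [Metric.tendstoUniformlyOn_iff]
    intro ε hε
    have h1 : Tendsto (fun j : ℕ => (1 / 2 : ℝ) ^ n₀ * (1 / 2) ^ j / (1 - 1 / 2)) atTop (𝓝 0) := by
      have := ((tendsto_pow_atTop_nhds_zero_of_lt_one (r := (1 / 2 : ℝ)) (by norm_num)
        (by norm_num)).const_mul ((1 / 2 : ℝ) ^ n₀)).div_const (1 - 1 / 2)
      simpa using this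
    filter_upwards [h1.eventually_lt_const hε] with j hj t ht
    rw [dist_comm]
    refine lt_of_le_of_lt ?_ hj
    exact dist_le_of_le_geometric_of_tendsto (1 / 2) _ (by norm_num) (hdist t ht)
      ((hlim t ht).comp (tendsto_add_atTop_nat n₀)) j
  exact hunif.continuousOn (Frequently.of_forall fun j => hf _)

variable [IsProbabilityMeasure P]

/-- The indefinite Itô integral of a square integrable progressive process has an adapted version
all of whose paths are continuous. -/
theorem exists_itoProcess {b : ℝ → Ω → Mat d m} (hb : N.MemL2 T b) (hT : 0 < T) :
    ∃ M : ℝ → Ω → Vec d, (∀ ω, ContinuousOn (fun t => M t ω) (Icc 0 T)) ∧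
      (∀ t ∈ Icc 0 T, Measurable[N.filtration t] (M t)) ∧
      ∀ t ∈ Icc 0 T, N.HasItoIntegral b t (M t) := by
  obtain ⟨H₀, hH₀⟩ := exists_simpleIntegrand_tendsto hb hT
  have hpos : ∀ n : ℕ, (0 : ℝ≥0∞) < (1 / 16) ^ n := fun n =>
    ENNReal.pow_pos (by simp) n
  -- The rate 16⁻ⁿ beats the squared threshold (2⁻ⁿ)² = 4⁻ⁿ in the maximal inequality, leaving the
  -- summable bound 4 · 4⁻ⁿ.
  have hsel : ∀ n : ℕ, ∃ H : SimpleIntegrand N T d,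
      energy P T (fun s ω => H.process s ω - b s ω) ≤ (1 / 16) ^ n := fun n =>
    (hH₀.eventually_le_const (hpos n)).exists.imp' H₀ fun _ h => h
  choose H hH using hsel
  choose X hXc hXm hXH using fun n => (H n).exists_path
  have hdiff : ∀ n k : ℕ, ∀ N₀, N₀ ≤ n → N₀ ≤ k →
      energy P T ((H n).sub (H k)).process ≤ 4 * (1 / 16) ^ N₀ := by
    intro n k N₀ hn hk
    have h1 := ((H n).progressive.sub hb.progressive).energy_sub_le
      ((H k).progressive.sub hb.progressive) hT.le
    have h16 : (1 / 16 : ℝ≥0∞) ≤ 1 := by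
      rw [one_div]
      exact ENNReal.inv_le_one.2 (by norm_num)
    have h2 := (hH n).trans (pow_le_pow_right_of_le_one' h16 hn)
    have h3 := (hH k).trans (pow_le_pow_right_of_le_one' h16 hk)
    refine le_trans (le_of_eq (energy_congr fun s _ ω => ?_))
      (h1.trans ((add_le_add (mul_le_mul_right h2 2) (mul_le_mul_right h3 2)).trans
        (le_of_eq ?_)))
    · rw [SimpleIntegrand.process_sub]
      congr 1
      abel
    · rw [← add_mul]
      norm_num
  -- almost sure uniform convergence by the maximal inequality and the Borel–Cantelli lemma
  let A : ℕ → Set Ω := fun n => {ω | ∃ t ∈ Icc 0 T, (1 / 2 : ℝ) ^ n < ‖X (n + 1) t ω - X n t ω‖}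
  have hA : ∀ n, P (A n) ≤ 4 * (1 / 4) ^ n := by
    intro n
    have h1 := ((H (n + 1)).sub (H n)).maximal_inequality hT.le
      (X := fun t ω => X (n + 1) t ω - X n t ω) (fun ω => (hXc (n + 1) ω).sub (hXc n ω))
      (fun t ht => (hXm (n + 1) t ht).sub (hXm n t ht))
      (fun t ht => by
        filter_upwards [hXH (n + 1) t ht, hXH n t ht] with ω h1 h2
        rw [h1, h2, SimpleIntegrand.integral_clip_sub])
      (ε := (1 / 2) ^ n) (by positivity)
    have h2 := h1.trans (hdiff (n + 1) n n (by omega) le_rfl)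
    have h3 : ENNReal.ofReal (((1 / 2 : ℝ) ^ n) ^ 2) = (1 / 4) ^ n := by
      rw [← pow_mul, mul_comm, pow_mul, ENNReal.ofReal_pow (by positivity)]
      congr 1
      rw [show ((1 : ℝ) / 2) ^ 2 = 4⁻¹ by norm_num, ENNReal.ofReal_inv_of_pos (by norm_num)]
      simp
    have h4 : (4 : ℝ≥0∞) * (1 / 16) ^ n = (1 / 4) ^ n * (4 * (1 / 4) ^ n) := by
      rw [mul_left_comm, ← mul_pow]
      congr 2
      rw [one_div, one_div, ← ENNReal.mul_inv (by simp) (by simp)]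
      norm_num
    rw [h3, h4] at h2
    have h5 : (1 / 4 : ℝ≥0∞) ^ n ≠ 0 := (ENNReal.pow_pos (by simp) n).ne'
    have h6 : (1 / 4 : ℝ≥0∞) ^ n ≠ ∞ := ENNReal.pow_ne_top (by simp)
    exact (ENNReal.mul_le_mul_iff_right h5 h6).1 h2
  have hsum : ∑' n, P (A n) ≠ ∞ :=
    ne_top_of_le_ne_top (ennreal_geometric_ne_top (c := 4) (r := 1 / 4) (by simp)
      (by rw [one_div]; exact ENNReal.inv_lt_one.2 (by norm_num))) (ENNReal.tsum_le_tsum hA)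
  obtain ⟨G, hG, hG0, hGA⟩ := exists_measurableSet_of_ae (ae_eventually_notMem hsum)
  have hGlim : ∀ ω ∈ G, (∀ t ∈ Icc 0 T,
      Tendsto (fun n => X n t ω) atTop (𝓝 (limUnder atTop fun n => X n t ω))) ∧
        ContinuousOn (fun t => limUnder atTop fun n => X n t ω) (Icc 0 T) := by
    intro ω hω
    obtain ⟨n₀, hn₀⟩ := eventually_atTop.1 (hGA ω hω)
    exact continuousOn_limUnder_of_geometric (S := Icc 0 T) (f := fun n t => X n t ω)
      (fun n => (hXc n ω).continuousOn) (n₀ := n₀) (fun n hn t ht => by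
        have := hn₀ n hn
        simp only [A, mem_ofPred_eq, not_exists, not_and, not_lt] at this
        exact this t ht)
  have hGm : ∀ t, MeasurableSet[N.filtration t] G := by
    intro t
    rw [← compl_compl G]
    exact @MeasurableSet.compl _ _ (N.filtration t) (N.measurableSet_of_null t hG.compl hG0)
  -- Setting the limit to zero off `G` makes every path continuous; adaptedness survives since the
  -- complement of `G` is a null event, contained in the filtration at every time.
  let M : ℝ → Ω → Vec d := fun t => G.indicator fun ω => limUnder atTop fun n => X n t ω
  have hMm : ∀ t ∈ Icc 0 T, Measurable[N.filtration t] (M t) := by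
    intro t ht
    have h1 : Measurable[N.filtration t] fun ω => limUnder atTop fun n => X n t ω :=
      measurable_limUnder_vec fun n => hXm n t ht
    exact h1.indicator (hGm t)
  refine ⟨M, fun ω => ?_, hMm, fun t ht => ?_⟩
  · by_cases hω : ω ∈ G
    · simpa only [M, indicator_of_mem hω] using (hGlim ω hω).2
    · simpa only [M, indicator_of_notMem hω] using continuousOn_const
  · have hmemL : ∀ n, MemLp ((H n).clip ht.1).integral 2 P := fun n =>
      ((H n).clip ht.1).memLp_integral ht.2
    have hlim : ∀ᵐ ω ∂P, Tendsto (fun n => ((H n).clip ht.1).integral ω) atTop (𝓝 (M t ω)) := by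
      have h1 : ∀ᵐ ω ∂P, ∀ n, X n t ω = ((H n).clip ht.1).integral ω :=
        ae_all_iff.2 fun n => hXH n t ht.1
      filter_upwards [h1, compl_mem_ae_iff.2 hG0] with ω h1 hω
      rw [compl_compl] at hω
      simp only [← h1, M, indicator_of_mem hω]
      exact (hGlim ω hω).1 t ht
    -- The almost sure limit is identified as the L² limit by a summable Cauchy estimate. The
    -- natural bound is 2 · 4^(-N₀); the 3 makes the inequality strict.
    have hcau : ∀ N₀ n k : ℕ, N₀ ≤ n → N₀ ≤ k →
        eLpNorm (((H n).clip ht.1).integral - ((H k).clip ht.1).integral) 2 P <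
          3 * (1 / 4) ^ N₀ := by
      intro N₀ n k hn hk
      have h1 : eLpNorm (((H n).clip ht.1).integral - ((H k).clip ht.1).integral) 2 P ^ 2 ≤
          (2 * (1 / 4) ^ N₀) ^ 2 := by
        rw [eLpNorm_two_sq]
        have h2 : ∀ ω, (((H n).clip ht.1).integral - ((H k).clip ht.1).integral) ω =
            (((H n).sub (H k)).clip ht.1).integral ω := fun ω => by
          rw [SimpleIntegrand.integral_clip_sub, Pi.sub_apply]
        simp only [h2]
        rw [SimpleIntegrand.lintegral_integral_sq _ ht.2]
        have h3 : energy P t (((H n).sub (H k)).clip ht.1).process =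
            energy P t ((H n).sub (H k)).process :=
          energy_congr fun s hs ω => by rw [SimpleIntegrand.process_clip _ ht.1 hs.2]
        rw [h3]
        refine (energy_mono _ ht.2).trans ((hdiff n k N₀ hn hk).trans (le_of_eq ?_))
        rw [mul_pow, ← pow_mul, mul_comm N₀ 2, pow_mul]
        congr 2
        · norm_num
        · rw [one_div, one_div, ENNReal.inv_pow.symm]
          norm_num
      have h2 : eLpNorm (((H n).clip ht.1).integral - ((H k).clip ht.1).integral) 2 P ≤
          2 * (1 / 4) ^ N₀ := (ENNReal.pow_le_pow_left_iff two_ne_zero).1 h1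
      refine h2.trans_lt ?_
      have h5 : (1 / 4 : ℝ≥0∞) ^ N₀ ≠ 0 := (ENNReal.pow_pos (by simp) _).ne'
      have h6 : (1 / 4 : ℝ≥0∞) ^ N₀ ≠ ∞ := ENNReal.pow_ne_top (by simp)
      exact (ENNReal.mul_lt_mul_iff_left h5 h6).2 (by norm_num)
    have htend := Lp.cauchy_tendsto_of_tendsto (fun n => (hmemL n).1) (M t)
      (ennreal_geometric_ne_top (c := 3) (r := 1 / 4) (by simp)
        (by rw [one_div]; exact ENNReal.inv_lt_one.2 (by norm_num))) hcau hlim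
    refine ⟨hb.mono ht.2, Lp.memLp_of_cauchy_tendsto one_le_two hmemL (M t)
      ((hMm t ht).mono (N.filtration_le t) le_rfl).aestronglyMeasurable htend,
      fun n => (H n).clip ht.1, ?_, htend⟩
    have hgeo : Tendsto (fun n : ℕ => (1 / 16 : ℝ≥0∞) ^ n) atTop (𝓝 0) :=
      ENNReal.tendsto_pow_atTop_nhds_zero_of_lt_one
        (by rw [one_div]; exact ENNReal.inv_lt_one.2 (by norm_num))
    refine tendsto_of_tendsto_of_tendsto_of_le_of_le tendsto_const_nhds hgeo
      (fun _ => zero_le) fun n => ?_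
    refine le_trans (le_of_eq (energy_congr fun s hs ω => ?_))
      ((energy_mono _ ht.2).trans (hH n))
    rw [SimpleIntegrand.process_clip _ ht.1 hs.2]

end ItoProcess

end SDEControl

namespace SDEControl

/-! ### The drift term, moment bounds and L² continuity of Itô processes -/

section Drift

variable {Ω : Type*} [mΩ : MeasurableSpace Ω] {P : Measure Ω} {T τ : ℝ} {m d : ℕ}
  {N : Noise P T m}

/-- The density of the energy with respect to time. -/
noncomputable def power (P : Measure Ω) {V : Type*} [NormedAddCommGroup V] (Y : ℝ → Ω → V)
    (s : ℝ) : ℝ≥0∞ :=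
  ∫⁻ ω, ‖Y s ω‖ₑ ^ 2 ∂P

variable {V : Type*} [NormedAddCommGroup V] [MeasurableSpace V] [BorelSpace V]
  [SecondCountableTopology V]

lemma Noise.Progressive.energy_indicator [SFinite P] {Y : ℝ → Ω → V} (h : N.Progressive τ Y)
    (hτ : 0 ≤ τ) {S : Set ℝ} (hS : MeasurableSet S) :
    energy P τ (fun s ω => S.indicator (fun s => Y s ω) s) =
      ∫⁻ s in S ∩ Icc 0 τ, power P Y s := by
  rw [(h.indicator hS).energy_eq_swap hτ, ← Measure.restrict_restrict hS,
    ← lintegral_indicator hS]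
  refine lintegral_congr fun s => ?_
  by_cases hs : s ∈ S <;> simp [hs, power]

lemma Noise.Progressive.energy_indicator_Ioi [SFinite P] {Y : ℝ → Ω → V}
    (h : N.Progressive T Y) {s t : ℝ} (hs : 0 ≤ s) (hst : s ≤ t) (ht : t ≤ T) :
    energy P t (fun r ω => (Ioi s).indicator (fun r => Y r ω) r) =
      ∫⁻ r in Ioc s t, power P Y r := by
  rw [(h.mono ht).energy_indicator (hs.trans hst) measurableSet_Ioi]
  congr 2
  ext r
  simp only [mem_inter_iff, mem_Ioi, mem_Icc, mem_Ioc]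
  exact ⟨fun h => ⟨h.1, h.2.2⟩, fun h => ⟨h.1, hs.trans h.1.le, h.2⟩⟩

/-- Processes at distance zero have the same energy. -/
lemma energy_eq_of_energy_sub_eq_zero [SFinite P] {Y Z : ℝ → Ω → V} (hY : N.Progressive τ Y)
    (hZ : N.Progressive τ Z) (hτ : 0 ≤ τ) (h : energy P τ (fun s ω => Y s ω - Z s ω) = 0) :
    energy P τ Y = energy P τ Z := by
  rw [(hY.sub hZ).energy_eq_prod hτ, lintegral_eq_zero_iff'
    (((hY.sub hZ).aemeasurable hτ).enorm.pow_const 2)] at h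
  rw [hY.energy_eq_prod hτ, hZ.energy_eq_prod hτ]
  refine lintegral_congr_ae ?_
  filter_upwards [h] with p hp
  have : Y p.1 p.2 = Z p.1 p.2 := by simpa [sub_eq_zero] using hp
  simp only [this]

lemma Noise.MemL2.ae_lt_top [SFinite P] {Y : ℝ → Ω → V} (h : N.MemL2 τ Y) (hτ : 0 ≤ τ) :
    ∀ᵐ ω ∂P, ∫⁻ s in Icc 0 τ, ‖Y s ω‖ₑ ^ 2 < ∞ :=
  ae_lt_top' (((h.progressive.aemeasurable hτ).enorm.pow_const 2).lintegral_prod_left')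
    h.energy_lt_top.ne

lemma Noise.Progressive.integrableOn_path {Y : ℝ → Ω → V} (h : N.Progressive τ Y) (hτ : 0 ≤ τ)
    {ω : Ω} (hω : ∫⁻ s in Icc 0 τ, ‖Y s ω‖ₑ ^ 2 < ∞) :
    IntegrableOn (fun s => Y s ω) (Icc 0 τ) :=
  (memLp_two_of_lintegral (h.aestronglyMeasurable_path hτ ω) hω).integrable one_le_two

lemma Noise.Progressive.enorm_integral_sq_le {a : ℝ → Ω → Vec d} (h : N.Progressive T a)
    {s t : ℝ} (hs : 0 ≤ s) (hst : s ≤ t) (ht : t ≤ T) (ω : Ω) :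
    ‖∫ r in s..t, a r ω‖ₑ ^ 2 ≤ ENNReal.ofReal (t - s) * ∫⁻ r in Ioc s t, ‖a r ω‖ₑ ^ 2 := by
  rw [intervalIntegral.integral_of_le hst]
  have hm : AEStronglyMeasurable (fun r => a r ω) (volume.restrict (Ioc s t)) :=
    (h.aestronglyMeasurable_path (hs.trans (hst.trans ht)) ω).mono_measure
      (Measure.restrict_mono_set _ fun r hr => ⟨hs.trans hr.1.le, hr.2.trans ht⟩)
  simpa using SDEControl.enorm_integral_sq_le hm

/-- The Cauchy–Schwarz estimate for the drift term. -/
lemma Noise.Progressive.lintegral_integral_sq_le [SFinite P] {a : ℝ → Ω → Vec d}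
    (h : N.Progressive T a) {s t : ℝ} (hs : 0 ≤ s) (hst : s ≤ t) (ht : t ≤ T) :
    ∫⁻ ω, ‖∫ r in s..t, a r ω‖ₑ ^ 2 ∂P ≤
      ENNReal.ofReal (t - s) * ∫⁻ r in Ioc s t, power P a r := by
  rw [← h.energy_indicator_Ioi hs hst ht, energy,
    ← lintegral_const_mul' _ _ ENNReal.ofReal_ne_top]
  refine lintegral_mono fun ω => (h.enorm_integral_sq_le hs hst ht ω).trans (le_of_eq ?_)
  have : ∀ r, ‖(Ioi s).indicator (fun r => a r ω) r‖ₑ ^ 2 =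
      (Ioi s).indicator (fun r => ‖a r ω‖ₑ ^ 2) r := fun r => by
    by_cases hr : r ∈ Ioi s <;> simp [hr]
  simp only [this]
  rw [lintegral_indicator measurableSet_Ioi, Measure.restrict_restrict measurableSet_Ioi]
  congr 3
  ext r
  simp only [mem_inter_iff, mem_Ioi, mem_Icc, mem_Ioc]
  exact ⟨fun h => ⟨h.1, hs.trans h.1.le, h.2⟩, fun h => ⟨h.1, h.2.2⟩⟩

lemma Noise.Progressive.measurable_intervalIntegral {a : ℝ → Ω → Vec d} (h : N.Progressive T a)
    {t : ℝ} (ht : t ∈ Icc 0 T) : Measurable[N.filtration t] fun ω => ∫ s in (0 : ℝ)..t, a s ω := by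
  simp only [intervalIntegral.integral_of_le ht.1]
  exact h.measurable_integral ht measurableSet_Ioc Ioc_subset_Icc_self

/-- The drift term has a version which is adapted and all of whose paths are continuous. -/
lemma Noise.MemL2.exists_driftProcess [SFinite P] {a : ℝ → Ω → Vec d} (ha : N.MemL2 T a)
    (hT : 0 ≤ T) :
    ∃ D : ℝ → Ω → Vec d, (∀ ω, ContinuousOn (fun t => D t ω) (Icc 0 T)) ∧
      (∀ t ∈ Icc 0 T, Measurable[N.filtration t] (D t)) ∧
      ∀ᵐ ω ∂P, ∀ t, D t ω = ∫ s in (0 : ℝ)..t, a s ω := by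
  -- Only paths of the drift with finite L² norm are integrable, so the primitive is set to zero on
  -- the remaining null event.
  obtain ⟨G, hG, hG0, hGa⟩ := exists_measurableSet_of_ae (ha.ae_lt_top hT)
  refine ⟨fun t => G.indicator fun ω => ∫ s in (0 : ℝ)..t, a s ω, fun ω => ?_, fun t ht => ?_, ?_⟩
  · by_cases hω : ω ∈ G
    · simp only [indicator_of_mem hω]
      have h1 := ha.progressive.integrableOn_path hT (hGa ω hω)
      rw [← uIcc_of_le hT] at h1 ⊢
      exact intervalIntegral.continuousOn_primitive_interval h1
    · simpa only [indicator_of_notMem hω] using continuousOn_const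
  · refine (ha.progressive.measurable_intervalIntegral ht).indicator ?_
    rw [← compl_compl G]
    exact @MeasurableSet.compl _ _ (N.filtration t) (N.measurableSet_of_null t hG.compl hG0)
  · filter_upwards [compl_mem_ae_iff.2 hG0] with ω hω t
    rw [compl_compl] at hω
    simp only [indicator_of_mem hω]

variable [IsProbabilityMeasure P]

/-- Every admissible triple represents a progressively measurable process with continuous
paths. -/
theorem Noise.exists_represents {c : Characteristics Ω d m} (hT : 0 < T)
    (h0 : Measurable[N.F₀] c.init) (h0' : MemLp c.init 2 P) (ha : N.MemL2 T c.drift)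
    (hb : N.MemL2 T c.diffusion) :
    ∃ Y : ℝ → Ω → Vec d, (∀ ω, ContinuousOn (fun t => Y t ω) (Icc 0 T)) ∧
      N.Progressive T Y ∧ N.Represents c Y := by
  obtain ⟨D, hDc, hDm, hD⟩ := ha.exists_driftProcess hT.le
  obtain ⟨M, hMc, hMm, hM⟩ := exists_itoProcess hb hT
  have hc : ∀ ω, ContinuousOn (fun t => c.init ω + D t ω + M t ω) (Icc 0 T) := fun ω =>
    (continuousOn_const.add (hDc ω)).add (hMc ω)
  refine ⟨fun t ω => c.init ω + D t ω + M t ω, hc, .of_continuous hc fun t ht => ?_, h0, h0', ha,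
    hb, fun t ht => ⟨M t, hM t ht, ?_⟩⟩
  · exact ((h0.mono le_sup_right le_rfl).add (hDm t ht)).add (hMm t ht)
  · filter_upwards [hD] with ω hω
    rw [hω]

namespace Noise.Represents

variable {c c' : Characteristics Ω d m} {Y Y' : ℝ → Ω → Vec d}

lemma sub (h : N.Represents c Y) (h' : N.Represents c' Y') (hT : 0 ≤ T) :
    N.Represents ⟨fun ω => c.init ω - c'.init ω, fun s ω => c.drift s ω - c'.drift s ω,
      fun s ω => c.diffusion s ω - c'.diffusion s ω⟩ (fun s ω => Y s ω - Y' s ω) := by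
  refine ⟨h.measurable_init.sub h'.measurable_init, h.memLp_init.sub h'.memLp_init,
    h.drift_memL2.sub h'.drift_memL2 hT, h.diffusion_memL2.sub h'.diffusion_memL2 hT,
    fun t ht => ?_⟩
  obtain ⟨I, hI, hY⟩ := h.equation t ht
  obtain ⟨I', hI', hY'⟩ := h'.equation t ht
  refine ⟨_, hI.sub hI' ht.1 ht.2, ?_⟩
  have hint : ∀ {a : ℝ → Ω → Vec d}, N.MemL2 T a →
      ∀ᵐ ω ∂P, IntervalIntegrable (fun s => a s ω) volume 0 t := fun ha => by
    filter_upwards [ha.ae_lt_top hT] with ω hω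
    rw [intervalIntegrable_iff_integrableOn_Icc_of_le ht.1]
    exact (ha.progressive.integrableOn_path hT hω).mono_set (Icc_subset_Icc_right ht.2)
  filter_upwards [hY, hY', hint h.drift_memL2, hint h'.drift_memL2] with ω h1 h2 h3 h4
  rw [h1, h2, intervalIntegral.integral_sub h3 h4]
  abel

lemma memLp (h : N.Represents c Y) {t : ℝ} (ht : t ∈ Icc 0 T) : MemLp (Y t) 2 P := by
  obtain ⟨I, hI, hY⟩ := h.equation t ht
  have h1 : MemLp (fun ω => ∫ s in (0 : ℝ)..t, c.drift s ω) 2 P := by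
    refine memLp_two_of_lintegral ((h.drift_memL2.progressive.measurable_intervalIntegral ht).mono
      (N.filtration_le t) le_rfl).aestronglyMeasurable ?_
    refine (h.drift_memL2.progressive.lintegral_integral_sq_le le_rfl ht.1 ht.2).trans_lt ?_
    rw [← h.drift_memL2.progressive.energy_indicator_Ioi le_rfl ht.1 ht.2]
    exact ENNReal.mul_lt_top ENNReal.ofReal_lt_top
      ((h.drift_memL2.mono ht.2).indicator measurableSet_Ioi).energy_lt_top
  exact ((h.memLp_init.add h1).add hI.memLp).ae_eq (by
    filter_upwards [hY] with ω hω using hω.symm)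

/-- The second moments of an Itô process are bounded by its characteristics. -/
lemma lintegral_sq_le (h : N.Represents c Y) {t : ℝ} (ht : t ∈ Icc 0 T) :
    ∫⁻ ω, ‖Y t ω‖ₑ ^ 2 ∂P ≤ 4 * ∫⁻ ω, ‖c.init ω‖ₑ ^ 2 ∂P +
      4 * (ENNReal.ofReal T * energy P t c.drift) + 2 * energy P t c.diffusion := by
  obtain ⟨I, hI, hY⟩ := h.equation t ht
  have hm : Measurable fun ω => ∫ s in (0 : ℝ)..t, c.drift s ω :=
    (h.drift_memL2.progressive.measurable_intervalIntegral ht).mono (N.filtration_le t) le_rfl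
  have h1 : ∫⁻ ω, ‖∫ s in (0 : ℝ)..t, c.drift s ω‖ₑ ^ 2 ∂P ≤
      ENNReal.ofReal T * energy P t c.drift := by
    refine (h.drift_memL2.progressive.lintegral_integral_sq_le le_rfl ht.1 ht.2).trans ?_
    rw [(h.drift_memL2.progressive.mono ht.2).energy_eq_swap ht.1, sub_zero]
    exact mul_le_mul' (ENNReal.ofReal_le_ofReal ht.2) (lintegral_mono_set Ioc_subset_Icc_self)
  calc ∫⁻ ω, ‖Y t ω‖ₑ ^ 2 ∂P
      = ∫⁻ ω, ‖(c.init ω + ∫ s in (0 : ℝ)..t, c.drift s ω) + I ω‖ₑ ^ 2 ∂P :=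
        lintegral_congr_ae (by filter_upwards [hY] with ω hω; rw [hω])
    _ ≤ 2 * (2 * ∫⁻ ω, ‖c.init ω‖ₑ ^ 2 ∂P +
          2 * ∫⁻ ω, ‖∫ s in (0 : ℝ)..t, c.drift s ω‖ₑ ^ 2 ∂P) + 2 * ∫⁻ ω, ‖I ω‖ₑ ^ 2 ∂P := by
        refine (lintegral_enorm_add_sq_le (h.memLp_init.1.add hm.aestronglyMeasurable)).trans ?_
        gcongr
        exact lintegral_enorm_add_sq_le h.memLp_init.1
    _ ≤ 2 * (2 * ∫⁻ ω, ‖c.init ω‖ₑ ^ 2 ∂P + 2 * (ENNReal.ofReal T * energy P t c.drift)) +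
          2 * energy P t c.diffusion := by
        rw [hI.lintegral_sq ht.1 ht.2]
        gcongr
    _ = _ := by ring

/-- Both terms are controlled by integrals over (s, t] of fixed integrable functions of time, which
is what continuity in L² needs. -/
lemma lintegral_sub_sq_le (h : N.Represents c Y) {s t : ℝ} (hs : 0 ≤ s) (hst : s ≤ t)
    (ht : t ≤ T) :
    ∫⁻ ω, ‖Y t ω - Y s ω‖ₑ ^ 2 ∂P ≤
      2 * (ENNReal.ofReal (t - s) * ∫⁻ r in Ioc s t, power P c.drift r) +
        2 * ∫⁻ r in Ioc s t, power P c.diffusion r := by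
  obtain ⟨I, hI, hY⟩ := h.equation t ⟨hs.trans hst, ht⟩
  obtain ⟨J, hJ, hY'⟩ := h.equation s ⟨hs, hst.trans ht⟩
  have hT : 0 ≤ T := hs.trans (hst.trans ht)
  have hap := h.drift_memL2.progressive
  have e : ∀ᵐ ω ∂P, Y t ω - Y s ω = (∫ r in s..t, c.drift r ω) + (I ω - J ω) := by
    filter_upwards [hY, hY', h.drift_memL2.ae_lt_top hT] with ω h1 h2 h3
    have h4 := hap.integrableOn_path hT h3
    have h5 : ∀ r ∈ Icc 0 T, IntervalIntegrable (fun r => c.drift r ω) volume 0 r := fun r hr => by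
      rw [intervalIntegrable_iff_integrableOn_Icc_of_le hr.1]
      exact h4.mono_set (Icc_subset_Icc_right hr.2)
    rw [h1, h2, ← intervalIntegral.integral_interval_sub_left (h5 t ⟨hs.trans hst, ht⟩)
      (h5 s ⟨hs, hst.trans ht⟩)]
    abel
  rw [lintegral_congr_ae (g := fun ω => ‖(I ω - J ω) + ∫ r in s..t, c.drift r ω‖ₑ ^ 2)
    (by filter_upwards [e] with ω hω; rw [hω, add_comm])]
  refine (lintegral_enorm_add_sq_le (f := fun ω => I ω - J ω)
    (hI.memLp.1.sub hJ.memLp.1)).trans ?_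
  rw [hI.lintegral_sub_sq hJ hs hst ht,
    h.diffusion_memL2.progressive.energy_indicator_Ioi hs hst ht, add_comm]
  gcongr
  exact hap.lintegral_integral_sq_le hs hst ht

/-- Itô processes are continuous with values in `L²(Ω)`. -/
lemma memCL2 (h : N.Represents c Y) : MemCL2 P T Y := by
  refine ⟨fun t ht => h.memLp ht, fun t₀ ht₀ => ?_⟩
  have hT : 0 ≤ T := ht₀.1.trans ht₀.2
  have hfin : ∀ {W : Type} [NormedAddCommGroup W] [MeasurableSpace W] [BorelSpace W]
      [SecondCountableTopology W] {Z : ℝ → Ω → W}, N.MemL2 T Z →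
      ∫⁻ r in Icc 0 T, power P Z r ≠ ∞ := fun {W} _ _ _ _ {Z} hZ => by
    have := hZ.energy_lt_top
    rw [hZ.progressive.energy_eq_swap hT] at this
    exact this.ne
  -- Absolute continuity of the integral; the unordered interval handles t on either side of t₀.
  have hlim : ∀ {g : ℝ → ℝ≥0∞}, ∫⁻ r in Icc 0 T, g r ≠ ∞ →
      Tendsto (fun t => ∫⁻ r in uIoc t₀ t, g r) (𝓝[Icc 0 T] t₀) (𝓝 0) := by
    intro g hg
    rw [ENNReal.tendsto_nhds_zero]
    intro ε hε
    obtain ⟨δ, hδ, hδε⟩ := exists_pos_setLIntegral_lt_of_measure_lt hg hε.ne'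
    have hv : Tendsto (fun t => ENNReal.ofReal |t - t₀|) (𝓝[Icc 0 T] t₀) (𝓝 0) := by
      have : Tendsto (fun t => ENNReal.ofReal |t - t₀|) (𝓝 t₀) (𝓝 (ENNReal.ofReal |t₀ - t₀|)) :=
        (ENNReal.continuous_ofReal.comp (by fun_prop)).tendsto t₀
      rw [sub_self, abs_zero, ENNReal.ofReal_zero] at this
      exact this.mono_left nhdsWithin_le_nhds
    filter_upwards [hv.eventually_lt_const hδ, self_mem_nhdsWithin] with t ht htT
    have h1 := hδε (uIoc t₀ t) (by
      refine lt_of_le_of_lt (Measure.restrict_apply_le _ _) ?_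
      rwa [Real.volume_uIoc])
    rw [Measure.restrict_restrict measurableSet_uIoc, inter_eq_left.2] at h1
    · exact h1.le
    · rw [uIoc_eq_union]
      rintro r (hr | hr)
      · exact ⟨ht₀.1.trans hr.1.le, hr.2.trans htT.2⟩
      · exact ⟨htT.1.trans hr.1.le, hr.2.trans ht₀.2⟩
  have h1 := (ENNReal.Tendsto.const_mul (hlim (hfin h.drift_memL2)) (a := 2 * ENNReal.ofReal T)
    (Or.inr (ENNReal.mul_ne_top (by simp) ENNReal.ofReal_ne_top))).add
    (ENNReal.Tendsto.const_mul (hlim (hfin h.diffusion_memL2)) (a := 2) (Or.inr (by simp)))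
  rw [mul_zero, mul_zero, add_zero] at h1
  have h2 : Tendsto (fun t => ∫⁻ ω, ‖(Y t - Y t₀) ω‖ₑ ^ 2 ∂P) (𝓝[Icc 0 T] t₀) (𝓝 0) := by
    refine tendsto_of_tendsto_of_tendsto_of_le_of_le' tendsto_const_nhds h1
      (Eventually.of_forall fun _ => zero_le) ?_
    filter_upwards [self_mem_nhdsWithin] with t ht
    rcases le_total t₀ t with hle | hle
    · rw [uIoc_of_le hle]
      refine (h.lintegral_sub_sq_le ht₀.1 hle ht.2).trans ?_
      rw [← mul_assoc]
      gcongr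
      linarith [ht₀.1, ht.2]
    · rw [uIoc_of_ge hle]
      have : ∀ ω, ‖(Y t - Y t₀) ω‖ₑ = ‖Y t₀ ω - Y t ω‖ₑ := fun ω => by
        rw [Pi.sub_apply, ← enorm_neg, neg_sub]
      simp only [this]
      refine (h.lintegral_sub_sq_le ht.1 hle ht₀.2).trans ?_
      rw [← mul_assoc]
      gcongr
      linarith [ht₀.2, ht.1]
  have h3 := (ENNReal.continuous_rpow_const (y := (1 / 2 : ℝ))).tendsto 0 |>.comp h2
  rw [ENNReal.zero_rpow_of_pos (by norm_num)] at h3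
  refine h3.congr fun t => ?_
  rw [eLpNorm_two_eq]
  rfl

end Noise.Represents

end Drift

/-! ### Uniqueness of the characteristics of an Itô process -/

section Uniqueness

/-- A measure which on short intervals is small compared to a finite measure vanishes. -/
lemma measure_Ioc_eq_zero {α β : Measure ℝ} {p q : ℝ} (hα : α (Ioc p q) ≠ ∞) (hpq : p ≤ q)
    (h : ∀ s t, p ≤ s → s ≤ t → t ≤ q → β (Ioc s t) ≤ ENNReal.ofReal (t - s) * α (Ioc s t)) :
    β (Ioc p q) = 0 := by
  -- Each bisection halves the length in the factor, while α and β add up over the two halves.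
  have key : ∀ n : ℕ, ∀ s t, p ≤ s → s ≤ t → t ≤ q →
      β (Ioc s t) ≤ ENNReal.ofReal ((t - s) / 2 ^ n) * α (Ioc s t) := by
    intro n
    induction n with
    | zero => simpa using h
    | succ n ih =>
      intro s t hs hst ht
      have h1 := ih s ((s + t) / 2) hs (by linarith) (by linarith)
      have h2 := ih ((s + t) / 2) t (by linarith) (by linarith) ht
      have hu : Ioc s t = Ioc s ((s + t) / 2) ∪ Ioc ((s + t) / 2) t :=
        (Ioc_union_Ioc_eq_Ioc (by linarith) (by linarith)).symm
      have hd : Disjoint (Ioc s ((s + t) / 2)) (Ioc ((s + t) / 2) t) :=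
        Ioc_disjoint_Ioc_of_le le_rfl
      rw [hu, measure_union hd measurableSet_Ioc, measure_union hd measurableSet_Ioc, mul_add]
      rw [show ((s + t) / 2 - s) / 2 ^ n = (t - s) / 2 ^ (n + 1) by rw [pow_succ]; ring] at h1
      rw [show (t - (s + t) / 2) / 2 ^ n = (t - s) / 2 ^ (n + 1) by rw [pow_succ]; ring] at h2
      exact add_le_add h1 h2
  have hlim : Tendsto (fun n : ℕ => ENNReal.ofReal ((q - p) / 2 ^ n) * α (Ioc p q)) atTop
      (𝓝 0) := by
    have h1 : Tendsto (fun n : ℕ => (q - p) / 2 ^ n) atTop (𝓝 0) := by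
      have := (tendsto_pow_atTop_nhds_zero_of_lt_one (r := (1 / 2 : ℝ)) (by norm_num)
        (by norm_num)).const_mul (q - p)
      simpa [div_eq_mul_inv] using this
    have h2 := (ENNReal.continuous_ofReal.tendsto 0).comp h1
    rw [ENNReal.ofReal_zero] at h2
    simpa using ENNReal.Tendsto.mul_const h2 (Or.inr hα)
  exact le_antisymm (ge_of_tendsto' hlim fun n => key n p q le_rfl hpq le_rfl) zero_le

/-- An integrable function all of whose integrals over `[0, t]`, `t` rational, vanish is zero
almost everywhere. -/
lemma ae_eq_zero_of_integral_rat_eq_zero {E : Type*} [NormedAddCommGroup E] [NormedSpace ℝ E]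
    [CompleteSpace E] {f : ℝ → E} {T : ℝ} (hT : 0 ≤ T) (hf : IntegrableOn f (Icc 0 T))
    (h : ∀ q : ℚ, (q : ℝ) ∈ Icc 0 T → ∫ s in (0 : ℝ)..q, f s = 0) :
    f =ᵐ[volume.restrict (Icc 0 T)] 0 := by
  have hfi : IntervalIntegrable f volume 0 T :=
    (intervalIntegrable_iff_integrableOn_Icc_of_le hT).2 hf
  have hc : ContinuousOn (fun t => ∫ s in (0 : ℝ)..t, f s) (Icc 0 T) := by
    rw [← uIcc_of_le hT] at hf ⊢
    exact intervalIntegral.continuousOn_primitive_interval hf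
  -- The primitive is continuous, so it vanishes at all times; Lebesgue differentiation then
  -- recovers f = 0 almost everywhere.
  have hz : ∀ t ∈ Ioo 0 T, ∫ s in (0 : ℝ)..t, f s = 0 := by
    have h1 : EqOn (fun t => ∫ s in (0 : ℝ)..t, f s) (fun _ => 0)
        (Ioo 0 T ∩ closure (Ioo 0 T ∩ range ((↑) : ℚ → ℝ))) := by
      intro t ht
      have h2 : ContinuousWithinAt (fun t => ∫ s in (0 : ℝ)..t, f s)
          (Ioo 0 T ∩ range ((↑) : ℚ → ℝ)) t :=
        (hc t (Ioo_subset_Icc_self ht.1)).mono fun x hx => Ioo_subset_Icc_self hx.1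
      have : (𝓝[Ioo 0 T ∩ range ((↑) : ℚ → ℝ)] t).NeBot := mem_closure_iff_nhdsWithin_neBot.1 ht.2
      refine tendsto_nhds_unique (h2.tendsto) (tendsto_const_nhds.congr' ?_)
      filter_upwards [self_mem_nhdsWithin] with x hx
      obtain ⟨hx, q, rfl⟩ := hx
      exact (h q (Ioo_subset_Icc_self hx)).symm
    intro t ht
    refine h1 ⟨ht, ?_⟩
    exact (Rat.denseRange_cast (𝕜 := ℝ)).open_subset_closure_inter isOpen_Ioo ht
  rw [← restrict_Ioo_eq_restrict_Icc, EventuallyEq, ae_restrict_iff' measurableSet_Ioo]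
  filter_upwards [hfi.ae_hasDerivAt_integral] with x hx hxT
  rw [uIcc_of_le hT] at hx
  have h1 := hx (Ioo_subset_Icc_self hxT) 0 ⟨le_rfl, hT⟩
  have h2 : HasDerivAt (fun x => ∫ t in (0 : ℝ)..x, f t) 0 x :=
    (hasDerivAt_const x (0 : E)).congr_of_eventuallyEq
      (by filter_upwards [isOpen_Ioo.mem_nhds hxT] with y hy using hz y hy)
  exact h1.unique h2

variable {Ω : Type*} [mΩ : MeasurableSpace Ω] {P : Measure Ω} [IsProbabilityMeasure P] {T : ℝ}
  {m d : ℕ} {N : Noise P T m} {c c' : Characteristics Ω d m} {Y : ℝ → Ω → Vec d}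

/-- A triple representing the zero process vanishes. -/
lemma Noise.Represents.eq_zero (h : N.Represents c fun _ _ => 0) (hT : 0 ≤ T) :
    (∀ᵐ ω ∂P, c.init ω = 0) ∧ energy P T c.drift = 0 ∧ energy P T c.diffusion = 0 := by
  have hap := h.drift_memL2.progressive
  have hbp := h.diffusion_memL2.progressive
  have hinit : ∀ᵐ ω ∂P, c.init ω = 0 := by
    obtain ⟨I, hI, hY⟩ := h.equation 0 ⟨le_rfl, hT⟩
    have h1 : ∫⁻ ω, ‖I ω‖ₑ ^ 2 ∂P = 0 := by
      rw [hI.lintegral_sq le_rfl hT, (hbp.mono hT).energy_eq_swap le_rfl]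
      simp
    rw [lintegral_eq_zero_iff' (hI.memLp.1.enorm.pow_const 2)] at h1
    filter_upwards [h1, hY] with ω h1 h2
    have h3 : I ω = 0 := by simpa using h1
    simpa [h3] using h2.symm
  have hdiff : energy P T c.diffusion = 0 := by
    -- The two energies are read as measures in time. Subtracting the equation at s from that at t
    -- shows that the stochastic integral over (s, t] is minus the drift integral; the isometry on
    -- one side and Cauchy–Schwarz on the other give the hypothesis of `measure_Ioc_eq_zero`.
    have h1 : volume.withDensity (power P c.diffusion) (Ioc 0 T) = 0 := by
      refine measure_Ioc_eq_zero (α := volume.withDensity (power P c.drift)) ?_ hT ?_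
      · rw [withDensity_apply _ measurableSet_Ioc, ← hap.energy_indicator_Ioi le_rfl hT le_rfl]
        exact (h.drift_memL2.indicator measurableSet_Ioi).energy_lt_top.ne
      · intro s t hs hst ht
        rw [withDensity_apply _ measurableSet_Ioc, withDensity_apply _ measurableSet_Ioc]
        obtain ⟨I, hI, hY⟩ := h.equation t ⟨hs.trans hst, ht⟩
        obtain ⟨J, hJ, hY'⟩ := h.equation s ⟨hs, hst.trans ht⟩
        rw [← hbp.energy_indicator_Ioi hs hst ht, ← hI.lintegral_sub_sq hJ hs hst ht]
        refine le_trans (le_of_eq (lintegral_congr_ae ?_))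
          (hap.lintegral_integral_sq_le hs hst ht)
        filter_upwards [hY, hY', h.drift_memL2.ae_lt_top hT] with ω h1 h2 h3
        have h4 := hap.integrableOn_path hT h3
        have h5 : ∀ r ∈ Icc 0 T, IntervalIntegrable (fun r => c.drift r ω) volume 0 r :=
          fun r hr => by
            rw [intervalIntegrable_iff_integrableOn_Icc_of_le hr.1]
            exact h4.mono_set (Icc_subset_Icc_right hr.2)
        rw [← intervalIntegral.integral_interval_sub_left (h5 t ⟨hs.trans hst, ht⟩)
          (h5 s ⟨hs, hst.trans ht⟩), ← enorm_neg]
        congr 2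
        have h6 := h1.symm.trans h2
        rw [neg_sub, sub_eq_sub_iff_add_eq_add]
        rw [add_assoc, add_assoc, add_right_inj] at h6
        rw [add_comm (J ω), h6]
    rw [withDensity_apply _ measurableSet_Ioc, restrict_Ioc_eq_restrict_Icc] at h1
    rw [hbp.energy_eq_swap hT]
    exact h1
  refine ⟨hinit, ?_, hdiff⟩
  -- With the initial value and the stochastic integral gone, the equation says that the primitive
  -- of the drift vanishes. It holds only almost surely for each time, hence the restriction to
  -- countably many times.
  have h1 : ∀ᵐ ω ∂P, ∀ q : ℚ, (q : ℝ) ∈ Icc 0 T → ∫ s in (0 : ℝ)..q, c.drift s ω = 0 := by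
    rw [ae_all_iff]
    intro q
    by_cases hq : (q : ℝ) ∈ Icc 0 T
    · obtain ⟨I, hI, hY⟩ := h.equation q hq
      have h1 : ∫⁻ ω, ‖I ω‖ₑ ^ 2 ∂P = 0 := by
        rw [hI.lintegral_sq hq.1 hq.2]
        exact le_antisymm ((energy_mono _ hq.2).trans hdiff.le) zero_le
      rw [lintegral_eq_zero_iff' (hI.memLp.1.enorm.pow_const 2)] at h1
      filter_upwards [h1, hY, hinit] with ω h1 h2 h3 _
      have h4 : I ω = 0 := by simpa using h1
      simpa [h4, h3] using h2.symm
    · exact Eventually.of_forall fun ω h => absurd h hq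
  rw [energy, lintegral_congr_ae (g := fun _ => 0), lintegral_zero]
  filter_upwards [h1, h.drift_memL2.ae_lt_top hT] with ω h1 h2
  have h3 := ae_eq_zero_of_integral_rat_eq_zero hT (hap.integrableOn_path hT h2) h1
  rw [lintegral_congr_ae (g := fun _ => 0), lintegral_zero]
  filter_upwards [h3] with s hs
  simp [hs]

/-- The norm of a representing triple only depends on the represented process. -/
lemma Noise.Represents.norm_eq (h : N.Represents c Y) (h' : N.Represents c' Y) (hT : 0 ≤ T) :
    c.norm P T = c'.norm P T := by
  have h0 := h.sub h' hT
  simp only [sub_self] at h0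
  obtain ⟨h1, h2, h3⟩ := h0.eq_zero hT
  rw [Characteristics.norm, Characteristics.norm,
    energy_eq_of_energy_sub_eq_zero h.drift_memL2.progressive h'.drift_memL2.progressive hT h2,
    energy_eq_of_energy_sub_eq_zero h.diffusion_memL2.progressive h'.diffusion_memL2.progressive
      hT h3]
  congr 2
  refine lintegral_congr_ae ?_
  filter_upwards [h1] with ω hω
  rw [sub_eq_zero.1 hω]

/-- This removes the arbitrary choice in the definition of the norm: any representing triple
computes it. -/
lemma Noise.Represents.normX_eq (h : N.Represents c Y) (hY : N.MemX Y) (hT : 0 ≤ T) :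
    N.normX Y = c.norm P T := by
  rw [Noise.normX, dif_pos hY]
  exact (Classical.choose_spec hY.representable).norm_eq h hT

end Uniqueness

end SDEControl

namespace SDEControl

/-! ### Exponential weights and Grönwall's inequality -/

section Gronwall

/-- The exponential weight `exp (4 K t)`. -/
noncomputable def expWeight (K : ℝ≥0) (t : ℝ) : ℝ≥0∞ := ENNReal.ofReal (Real.exp (4 * K * t))

lemma one_le_expWeight (K : ℝ≥0) {t : ℝ} (ht : 0 ≤ t) : 1 ≤ expWeight K t :=
  ENNReal.one_le_ofReal.2 (Real.one_le_exp (by positivity))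

lemma expWeight_mono (K : ℝ≥0) {s t : ℝ} (h : s ≤ t) : expWeight K s ≤ expWeight K t :=
  ENNReal.ofReal_le_ofReal (Real.exp_le_exp.2 (by gcongr))

lemma lintegral_expWeight_le (K : ℝ≥0) {t : ℝ} (ht : 0 ≤ t) :
    K * ∫⁻ s in Icc 0 t, expWeight K s ≤ 4⁻¹ * expWeight K t := by
  -- The factor 4 in the exponent is what produces the gain 1/4.
  have hd : ∀ s : ℝ, HasDerivAt (fun s : ℝ => Real.exp (4 * K * s) / 4)
      (K * Real.exp (4 * K * s)) s := by
    intro s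
    have h1 : HasDerivAt (fun s : ℝ => 4 * (K : ℝ) * s) (4 * K) s := by
      simpa using (hasDerivAt_id s).const_mul (4 * (K : ℝ))
    exact (h1.exp.div_const 4).congr_deriv (by ring)
  have hc : Continuous fun s : ℝ => (K : ℝ) * Real.exp (4 * K * s) := by fun_prop
  have h1 : ∫ s in Icc 0 t, (K : ℝ) * Real.exp (4 * K * s) =
      Real.exp (4 * K * t) / 4 - Real.exp (4 * K * 0) / 4 := by
    rw [integral_Icc_eq_integral_Ioc, ← intervalIntegral.integral_of_le ht]
    exact intervalIntegral.integral_eq_sub_of_hasDerivAt (fun s _ => hd s)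
      (hc.intervalIntegrable _ _)
  have h2 : K * ∫⁻ s in Icc 0 t, expWeight K s =
      ∫⁻ s in Icc 0 t, ENNReal.ofReal (K * Real.exp (4 * K * s)) := by
    rw [← lintegral_const_mul' _ _ ENNReal.coe_ne_top]
    refine lintegral_congr fun s => ?_
    rw [ENNReal.ofReal_mul K.coe_nonneg, ENNReal.ofReal_coe_nnreal, expWeight]
  rw [h2, ← ofReal_integral_eq_lintegral_ofReal hc.continuousOn.integrableOn_Icc
    (Eventually.of_forall fun s => by positivity), h1, expWeight,
    show (4⁻¹ : ℝ≥0∞) = ENNReal.ofReal 4⁻¹ by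
      rw [ENNReal.ofReal_inv_of_pos (by norm_num)]; simp,
    ← ENNReal.ofReal_mul (by norm_num)]
  refine ENNReal.ofReal_le_ofReal ?_
  have := Real.exp_pos (4 * (K : ℝ) * 0)
  linarith

/-- Integration in time gains a factor `1/4` in the exponentially weighted supremum norm. -/
lemma lintegral_le_of_le_expWeight {K : ℝ≥0} {φ : ℝ → ℝ≥0∞} {c : ℝ≥0∞} (hc : c ≠ ∞) {T t : ℝ}
    (ht : t ∈ Icc 0 T) (h : ∀ s ∈ Icc 0 T, φ s ≤ c * expWeight K s) :
    K * ∫⁻ s in Icc 0 t, φ s ≤ c * 4⁻¹ * expWeight K t := by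
  calc K * ∫⁻ s in Icc 0 t, φ s ≤ K * ∫⁻ s in Icc 0 t, c * expWeight K s := by
        exact mul_le_mul_right (setLIntegral_mono' measurableSet_Icc fun s hs =>
          h s ⟨hs.1, hs.2.trans ht.2⟩) _
    _ = c * (K * ∫⁻ s in Icc 0 t, expWeight K s) := by
        rw [lintegral_const_mul' _ _ hc]
        ring
    _ ≤ c * (4⁻¹ * expWeight K t) := by
        exact mul_le_mul_right (lintegral_expWeight_le K ht.1) _
    _ = _ := by rw [mul_assoc]

/-- One step of the Grönwall iteration. -/
lemma gronwall_step {K : ℝ≥0} {φ : ℝ → ℝ≥0∞} {A δ : ℝ≥0∞} (hA : A ≠ ∞) (hδ : δ ≠ ∞) {T t : ℝ}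
    (ht : t ∈ Icc 0 T) (h : ∀ s ∈ Icc 0 T, φ s ≤ (2 * A + δ) * expWeight K s) :
    A + K * ∫⁻ s in Icc 0 t, φ s ≤ (2 * A + δ * 4⁻¹) * expWeight K t := by
  have h1 := lintegral_le_of_le_expWeight
    (ENNReal.add_ne_top.2 ⟨ENNReal.mul_ne_top (by simp) hA, hδ⟩) ht h
  -- A quarter of 2A is at most A, so adding A gives 2A again: the level 2A is preserved while the
  -- excess δ shrinks by 4.
  have h4 : (4⁻¹ : ℝ≥0∞) ≤ 2⁻¹ := ENNReal.inv_le_inv.2 (by norm_num)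
  calc A + K * ∫⁻ s in Icc 0 t, φ s ≤ A * expWeight K t + (2 * A + δ) * 4⁻¹ * expWeight K t :=
        add_le_add (le_mul_of_one_le_right' (one_le_expWeight K ht.1)) h1
    _ ≤ A * expWeight K t + (A * (2 * 2⁻¹) + δ * 4⁻¹) * expWeight K t := by
        gcongr
        rw [add_mul, mul_comm 2 A, mul_assoc]
        gcongr
    _ = _ := by
        rw [ENNReal.mul_inv_cancel (by simp) (by simp)]
        ring

/-- Grönwall's inequality for bounded functions. -/
lemma gronwall {K : ℝ≥0} {φ : ℝ → ℝ≥0∞} {A M : ℝ≥0∞} (hA : A ≠ ∞) (hM : M ≠ ∞) {T : ℝ}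
    (hφ : ∀ t ∈ Icc 0 T, φ t ≤ M)
    (h : ∀ t ∈ Icc 0 T, φ t ≤ A + K * ∫⁻ s in Icc 0 t, φ s) {t : ℝ} (ht : t ∈ Icc 0 T) :
    φ t ≤ 2 * A * expWeight K t := by
  -- The excess over 2A starts at the a priori bound M, which must be finite, and is divided by 4
  -- each time the inequality is inserted into itself.
  have key : ∀ n : ℕ, ∀ t ∈ Icc 0 T, φ t ≤ (2 * A + M * 4⁻¹ ^ n) * expWeight K t := by
    intro n
    induction n with
    | zero =>
      intro t ht
      rw [pow_zero, mul_one]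
      exact (hφ t ht).trans (le_mul_of_le_of_one_le le_add_self (one_le_expWeight K ht.1))
    | succ n ih =>
      intro t ht
      rw [pow_succ, ← mul_assoc]
      exact (h t ht).trans (gronwall_step hA
        (ENNReal.mul_ne_top hM (ENNReal.pow_ne_top (by simp))) ht ih)
  have hlim : Tendsto (fun n : ℕ => (2 * A + M * 4⁻¹ ^ n) * expWeight K t) atTop
      (𝓝 ((2 * A + M * 0) * expWeight K t)) :=
    ENNReal.Tendsto.mul_const (tendsto_const_nhds.add (ENNReal.Tendsto.const_mul
      (ENNReal.tendsto_pow_atTop_nhds_zero_of_lt_one (ENNReal.inv_lt_one.2 (by norm_num)))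
      (Or.inr hM))) (Or.inr ENNReal.ofReal_ne_top)
  rw [mul_zero, add_zero] at hlim
  exact ge_of_tendsto' hlim fun n => key n t ht

end Gronwall

/-! ### Boundedness of Itô processes and change of characteristics -/

section Represents

variable {Ω : Type*} [mΩ : MeasurableSpace Ω] {P : Measure Ω} [IsProbabilityMeasure P] {T τ : ℝ}
  {m d : ℕ} {N : Noise P T m} {c c' : Characteristics Ω d m} {Y : ℝ → Ω → Vec d}

lemma setLIntegral_Icc_le {φ : ℝ → ℝ≥0∞} {M : ℝ≥0∞} (h : ∀ t ∈ Icc 0 τ, φ t ≤ M) :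
    ∫⁻ t in Icc 0 τ, φ t ≤ ENNReal.ofReal τ * M := by
  refine (setLIntegral_mono' measurableSet_Icc h).trans ?_
  rw [setLIntegral_const, Real.volume_Icc, sub_zero, mul_comm]

namespace Noise.Represents

/-- This supplies the finite a priori bound without which `gronwall` cannot start. -/
lemma exists_power_le (h : N.Represents c Y) :
    ∃ M : ℝ≥0∞, M ≠ ∞ ∧ ∀ t ∈ Icc 0 T, power P Y t ≤ M := by
  refine ⟨4 * ∫⁻ ω, ‖c.init ω‖ₑ ^ 2 ∂P +
      4 * (ENNReal.ofReal T * energy P T c.drift) + 2 * energy P T c.diffusion, ?_,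
    fun t ht => (h.lintegral_sq_le ht).trans ?_⟩
  · have h1 := (lintegral_lt_top_of_memLp h.memLp_init).ne
    have h2 := h.drift_memL2.energy_lt_top.ne
    have h3 := h.diffusion_memL2.energy_lt_top.ne
    finiteness
  · gcongr <;> exact energy_mono _ ht.2

lemma memL2 (h : N.Represents c Y) (hY : N.Progressive T Y) (hT : 0 ≤ T) : N.MemL2 T Y := by
  obtain ⟨M, hM, hYM⟩ := h.exists_power_le
  refine ⟨hY, ?_⟩
  rw [hY.energy_eq_swap hT]
  exact (setLIntegral_Icc_le hYM).trans_lt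
    (ENNReal.mul_lt_top ENNReal.ofReal_lt_top hM.lt_top)

/-- Neither integral sees a change of zero energy. It allows the coefficients along an L² limit to
be replaced by those along its continuous version. -/
lemma congr (h : N.Represents c Y) (hT : 0 ≤ T) {a : ℝ → Ω → Vec d} {b : ℝ → Ω → Mat d m}
    (ha : N.MemL2 T a) (hb : N.MemL2 T b)
    (ha0 : energy P T (fun s ω => c.drift s ω - a s ω) = 0)
    (hb0 : energy P T (fun s ω => c.diffusion s ω - b s ω) = 0) :
    N.Represents ⟨c.init, a, b⟩ Y := by
  refine ⟨h.measurable_init, h.memLp_init, ha, hb, fun t ht => ?_⟩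
  obtain ⟨I, hI, hY⟩ := h.equation t ht
  refine ⟨I, hI.congr (hb.mono ht.2) ht.1
    (le_antisymm ((energy_mono _ ht.2).trans hb0.le) zero_le), ?_⟩
  have hsub := h.drift_memL2.sub ha hT
  have h1 : ∀ᵐ ω ∂P, ∫⁻ s in Icc 0 T, ‖c.drift s ω - a s ω‖ₑ ^ 2 = 0 := by
    rw [energy, lintegral_eq_zero_iff'
      ((hsub.progressive.aemeasurable hT).enorm.pow_const 2).lintegral_prod_left'] at ha0
    exact ha0
  filter_upwards [hY, h1] with ω h2 h3
  rw [h2]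
  congr 2
  rw [lintegral_eq_zero_iff'
    ((hsub.progressive.aestronglyMeasurable_path hT ω).enorm.pow_const 2)] at h3
  refine intervalIntegral.integral_congr_ae_restrict ?_
  rw [uIoc_of_le ht.1]
  have h4 := ae_mono (Measure.restrict_mono
    (Ioc_subset_Icc_self.trans (Icc_subset_Icc_right ht.2)) le_rfl) h3
  filter_upwards [h4] with s hs
  simpa [sub_eq_zero] using hs

end Noise.Represents

end Represents

end SDEControl

namespace SDEControl

/-! ### Estimates for the coefficients along a process -/

section StateEquation

variable {Ω : Type*} [mΩ : MeasurableSpace Ω] {P : Measure Ω} {T L : ℝ} {d r m : ℕ}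
  {N : Noise P T m}

/-- The triple defining the right-hand side of the state equation along the process `X`. -/
noncomputable def stateCharacteristics (a : Vec d → Vec r → ℝ → Vec d) (b : Vec d → Vec r → ℝ → Mat d m)
    (X₀ : Ω → Vec d) (u : ControlSpace T r) (X : ℝ → Ω → Vec d) : Characteristics Ω d m :=
  ⟨X₀, fun s ω => a (X s ω) (u s) s, fun s ω => b (X s ω) (u s) s⟩

/-- The squared distance of two controls. -/
noncomputable def controlDist (u u' : ControlSpace T r) : ℝ≥0∞ :=
  ∫⁻ s in Icc 0 T, ‖u s - u' s‖ₑ ^ 2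

lemma controlDist_self (u : ControlSpace T r) : controlDist u u = 0 := by simp [controlDist]

lemma controlDist_eq (u u' : ControlSpace T r) :
    controlDist u u' = ENNReal.ofReal ‖u - u'‖ ^ 2 := by
  rw [Lp.norm_def, ENNReal.ofReal_toReal (Lp.eLpNorm_ne_top _), eLpNorm_two_sq, controlDist]
  refine lintegral_congr_ae ?_
  filter_upwards [Lp.coeFn_sub u u'] with s hs
  rw [hs, Pi.sub_apply]

/-- The growth rate of the solutions of the state equation. -/
noncomputable def growthRate (L T : ℝ) : ℝ≥0 := 16 * (T.toNNReal + 1) * (L ^ 2).toNNReal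

lemma coe_growthRate (L T : ℝ) :
    (growthRate L T : ℝ≥0∞) = 16 * (ENNReal.ofReal T + 1) * ENNReal.ofReal (L ^ 2) := by
  rw [growthRate]
  push_cast
  rfl

/-- The control is deterministic and has a measurable representative. The coefficients are
measurable only for times in [0, T], so time enters through the subtype. -/
lemma Noise.Progressive.comp_coefficient {V : Type*} [MeasurableSpace V]
    {f : Vec d → Vec r → ℝ → V}
    (hf : Measurable fun p : Vec d × Vec r × Icc (0 : ℝ) T => f p.1 p.2.1 p.2.2)
    (u : ControlSpace T r) {X : ℝ → Ω → Vec d} (hX : N.Progressive T X) :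
    N.Progressive T fun s ω => f (X s ω) (u s) s := by
  intro t ht
  have h1 := hX t ht
  have hu : Measurable u := (Lp.stronglyMeasurable u).measurable
  let _ := N.filtration t
  have h2 : Measurable fun p : Icc (0 : ℝ) t × Ω => (p.1 : ℝ) :=
    measurable_subtype_coe.comp measurable_fst
  exact hf.comp (h1.prodMk ((hu.comp h2).prodMk
    (h2.subtype_mk (h := fun p => ⟨p.1.2.1, p.1.2.2.trans ht.2⟩))))

lemma enorm_sq_add_enorm_sq_le {E F G H : Type*} [NormedAddCommGroup E] [NormedAddCommGroup F]
    [NormedAddCommGroup G] [NormedAddCommGroup H] {x : E} {y : F} {z : G} {w : H}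
    (h : ‖x‖ + ‖y‖ ≤ L * (‖z‖ + ‖w‖)) :
    ‖x‖ₑ ^ 2 + ‖y‖ₑ ^ 2 ≤ 2 * ENNReal.ofReal (L ^ 2) * (‖z‖ₑ ^ 2 + ‖w‖ₑ ^ 2) := by
  rw [show (2 : ℝ≥0∞) = ENNReal.ofReal 2 by simp]
  simp only [enorm_sq_eq_ofReal]
  rw [← ENNReal.ofReal_add (by positivity) (by positivity),
    ← ENNReal.ofReal_add (by positivity) (by positivity), ← ENNReal.ofReal_mul (by norm_num),
    ← ENNReal.ofReal_mul (by positivity)]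
  refine ENNReal.ofReal_le_ofReal ?_
  have h1 : (‖x‖ + ‖y‖) ^ 2 ≤ (L * (‖z‖ + ‖w‖)) ^ 2 := pow_le_pow_left₀ (by positivity) h 2
  have h2 : 0 ≤ ‖x‖ * ‖y‖ := by positivity
  have h3 : 0 ≤ L ^ 2 * (‖z‖ - ‖w‖) ^ 2 := by positivity
  nlinarith

variable [IsProbabilityMeasure P] {ua ub : Vec r} {a : Vec d → Vec r → ℝ → Vec d}
  {b : Vec d → Vec r → ℝ → Mat d m} {u u' : ControlSpace T r} {X X' Y Y' : ℝ → Ω → Vec d}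
  {X₀ : Ω → Vec d}

namespace CoefficientAssumption

/-- The Lipschitz estimate for the superposition operators. -/
lemma energy_sub_le (hC : CoefficientAssumption T L ua ub a b)
    (hu : u ∈ admissible T ua ub) (hu' : u' ∈ admissible T ua ub) (hX : N.Progressive T X)
    (hX' : N.Progressive T X') {t : ℝ} (ht : t ∈ Icc 0 T) :
    energy P t (fun s ω => a (X s ω) (u s) s - a (X' s ω) (u' s) s) +
        energy P t (fun s ω => b (X s ω) (u s) s - b (X' s ω) (u' s) s) ≤
      2 * ENNReal.ofReal (L ^ 2) *
        (energy P t (fun s ω => X s ω - X' s ω) + controlDist u u') := by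
  have hA := ((hX.comp_coefficient hC.measurable_drift u).sub
    (hX'.comp_coefficient hC.measurable_drift u')).mono ht.2
  have hB := ((hX.comp_coefficient hC.measurable_diffusion u).sub
    (hX'.comp_coefficient hC.measurable_diffusion u')).mono ht.2
  have hD := (hX.sub hX').mono ht.2
  set μ := (volume.restrict (Icc 0 t)).prod P
  have hV : ∫⁻ p, ‖u p.1 - u' p.1‖ₑ ^ 2 ∂μ ≤ controlDist u u' := by
    have hm : Measurable fun s => ‖u s - u' s‖ₑ ^ 2 :=
      ((Lp.stronglyMeasurable u).measurable.sub
        (Lp.stronglyMeasurable u').measurable).enorm.pow_const 2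
    have h1 := lintegral_prod (μ := volume.restrict (Icc 0 t)) (ν := P) _
      (hm.comp measurable_fst).aemeasurable
    simp only [Function.comp_apply, lintegral_const, measure_univ, mul_one] at h1
    exact h1.trans_le (lintegral_mono_set (Icc_subset_Icc_right ht.2))
  have hae : ∀ᵐ p ∂μ, ‖a (X p.1 p.2) (u p.1) p.1 - a (X' p.1 p.2) (u' p.1) p.1‖ₑ ^ 2 +
      ‖b (X p.1 p.2) (u p.1) p.1 - b (X' p.1 p.2) (u' p.1) p.1‖ₑ ^ 2 ≤
        2 * ENNReal.ofReal (L ^ 2) *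
          (‖X p.1 p.2 - X' p.1 p.2‖ₑ ^ 2 + ‖u p.1 - u' p.1‖ₑ ^ 2) := by
    -- The exceptional times do not depend on the states, so the random values of the processes may
    -- be inserted.
    have h1 : ∀ᵐ s ∂volume.restrict (Icc 0 t), ∀ x x' : Vec d,
        ‖a x (u s) s - a x' (u' s) s‖ₑ ^ 2 + ‖b x (u s) s - b x' (u' s) s‖ₑ ^ 2 ≤
          2 * ENNReal.ofReal (L ^ 2) * (‖x - x'‖ₑ ^ 2 + ‖u s - u' s‖ₑ ^ 2) := by
      refine ae_mono (Measure.restrict_mono (Icc_subset_Icc_right ht.2) le_rfl) ?_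
      filter_upwards [hC.lipschitz, hu, hu'] with s hs h1 h2 x x'
      exact enorm_sq_add_enorm_sq_le (hs x x' _ h1 _ h2)
    have h2 := Measure.quasiMeasurePreserving_fst (μ := volume.restrict (Icc 0 t)) (ν := P) |>.ae h1
    filter_upwards [h2] with p hp using hp _ _
  rw [hA.energy_eq_prod ht.1, hB.energy_eq_prod ht.1, hD.energy_eq_prod ht.1,
    ← lintegral_add_left' ((hA.aemeasurable ht.1).enorm.pow_const 2)]
  refine (lintegral_mono_ae hae).trans ?_
  rw [lintegral_const_mul' _ _ (by finiteness),
    lintegral_add_left' ((hD.aemeasurable ht.1).enorm.pow_const 2)]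
  gcongr

/-- The growth estimate for the superposition operators. -/
lemma energy_le (hC : CoefficientAssumption T L ua ub a b)
    (hu : u ∈ admissible T ua ub) (hX : N.Progressive T X) {t : ℝ} (ht : t ∈ Icc 0 T) :
    energy P t (fun s ω => a (X s ω) (u s) s) + energy P t (fun s ω => b (X s ω) (u s) s) ≤
      4 * ENNReal.ofReal (L ^ 2) * (1 + energy P t X) := by
  have h0 : N.Progressive T fun _ _ => (0 : Vec d) := fun _ _ => measurable_const
  have hA := (hX.comp_coefficient hC.measurable_drift u).mono ht.2
  have hB := (hX.comp_coefficient hC.measurable_diffusion u).mono ht.2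
  have hA0 := (h0.comp_coefficient hC.measurable_drift u).mono ht.2
  have hB0 := (h0.comp_coefficient hC.measurable_diffusion u).mono ht.2
  -- Compare with the zero process: the difference is covered by the Lipschitz estimate with equal
  -- controls, the value at state 0 by the assumed bound.
  have h1 := (hA.sub hA0).energy_add_le hA0 ht.1
  have h2 := (hB.sub hB0).energy_add_le hB0 ht.1
  simp only [sub_add_cancel] at h1 h2
  have h3 := hC.energy_sub_le hu hu hX h0 ht
  simp only [sub_zero, controlDist_self, add_zero] at h3
  have h4 : energy P t (fun s (_ : Ω) => a 0 (u s) s) + energy P t (fun s (_ : Ω) => b 0 (u s) s) ≤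
      ENNReal.ofReal (L ^ 2) := by
    simp only [energy, lintegral_const, measure_univ, mul_one]
    exact (le_lintegral_add _ _).trans
      ((lintegral_mono_set (Icc_subset_Icc_right ht.2)).trans (hC.bound u hu))
  set ℓ := ENNReal.ofReal (L ^ 2)
  calc _ ≤ _ := add_le_add h1 h2
    _ = 2 * (energy P t (fun s ω => a (X s ω) (u s) s - a 0 (u s) s) +
          energy P t (fun s ω => b (X s ω) (u s) s - b 0 (u s) s)) +
        2 * (energy P t (fun s (_ : Ω) => a 0 (u s) s) +
          energy P t (fun s (_ : Ω) => b 0 (u s) s)) := by ring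
    _ ≤ 2 * (2 * ℓ * energy P t X) + 2 * ℓ := by gcongr
    _ ≤ 2 * (2 * ℓ * energy P t X) + 4 * ℓ := by
        gcongr
        norm_num
    _ = _ := by ring

end CoefficientAssumption

end StateEquation

end SDEControl

namespace SDEControl

/-! ### Existence, uniqueness and stability for the state equation -/

section StateEquation

variable {Ω : Type*} [mΩ : MeasurableSpace Ω] {P : Measure Ω} [IsProbabilityMeasure P] {T L : ℝ}
  {d r m : ℕ} {N : Noise P T m} {ua ub : Vec r} {a : Vec d → Vec r → ℝ → Vec d}
  {b : Vec d → Vec r → ℝ → Mat d m} {u u' : ControlSpace T r} {X X' Y Y' : ℝ → Ω → Vec d}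
  {X₀ : Ω → Vec d}

lemma CoefficientAssumption.memL2 (hC : CoefficientAssumption T L ua ub a b) (hT : 0 ≤ T)
    (hu : u ∈ admissible T ua ub) (hX : N.MemL2 T X) :
    N.MemL2 T (fun s ω => a (X s ω) (u s) s) ∧ N.MemL2 T (fun s ω => b (X s ω) (u s) s) := by
  have h := (hC.energy_le hu hX.progressive ⟨hT, le_rfl⟩).trans_lt
    (ENNReal.mul_lt_top (by finiteness)
      (ENNReal.add_lt_top.2 ⟨ENNReal.one_lt_top, hX.energy_lt_top⟩))
  rw [ENNReal.add_lt_top] at h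
  exact ⟨⟨hX.progressive.comp_coefficient hC.measurable_drift u, h.1⟩,
    ⟨hX.progressive.comp_coefficient hC.measurable_diffusion u, h.2⟩⟩

/-- The second moments of the initial value, enlarged by the growth rate. -/
noncomputable def growthConst (P : Measure Ω) (L T : ℝ) (X₀ : Ω → Vec d) : ℝ≥0∞ :=
  4 * ∫⁻ ω, ‖X₀ ω‖ₑ ^ 2 ∂P + growthRate L T

lemma growthConst_ne_top (h : MemLp X₀ 2 P) : growthConst P L T X₀ ≠ ∞ := by
  have := (lintegral_lt_top_of_memLp h).ne
  rw [growthConst]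
  finiteness

/-- The coefficient estimates control the sum of the drift and diffusion energies, so the two terms
of the moment bound are given a common factor. -/
lemma four_mul_add_two_mul_le (A B : ℝ≥0∞) :
    4 * (ENNReal.ofReal T * A) + 2 * B ≤ 4 * (ENNReal.ofReal T + 1) * (A + B) := by
  calc 4 * (ENNReal.ofReal T * A) + 2 * B ≤ 4 * (ENNReal.ofReal T * A) + 4 * B := by
        gcongr
        norm_num
    _ ≤ 4 * (ENNReal.ofReal T * A) + 4 * B + (4 * A + 4 * (ENNReal.ofReal T * B)) := le_self_add
    _ = _ := by ring

/-- A priori bound for the right-hand side of the state equation. -/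
lemma power_le_of_represents (hC : CoefficientAssumption T L ua ub a b)
    (hu : u ∈ admissible T ua ub) (hX : N.Progressive T X)
    (hY : N.Represents (stateCharacteristics a b X₀ u X) Y) {t : ℝ} (ht : t ∈ Icc 0 T) :
    power P Y t ≤ growthConst P L T X₀ + growthRate L T * ∫⁻ s in Icc 0 t, power P X s := by
  refine (hY.lintegral_sq_le ht).trans ?_
  rw [add_assoc]
  refine (add_le_add_right (four_mul_add_two_mul_le _ _) _).trans ?_
  have h1 := hC.energy_le hu hX ht
  rw [(hX.mono ht.2).energy_eq_swap ht.1] at h1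
  rw [growthConst, add_assoc]
  refine add_le_add_right ((mul_le_mul_right h1 _).trans (le_of_eq ?_)) _
  -- The 16 in the growth rate arises here, as 4 (T + 1) from the moment bound times 4 L² from the
  -- growth estimate.
  rw [coe_growthRate]
  simp only [power]
  ring

/-- Stability estimate for the right-hand side of the state equation. -/
lemma power_sub_le_of_represents (hC : CoefficientAssumption T L ua ub a b)
    (hu : u ∈ admissible T ua ub) (hu' : u' ∈ admissible T ua ub) (hX : N.Progressive T X)
    (hX' : N.Progressive T X') (hY : N.Represents (stateCharacteristics a b X₀ u X) Y)
    (hY' : N.Represents (stateCharacteristics a b X₀ u' X') Y') {t : ℝ} (ht : t ∈ Icc 0 T) :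
    power P (fun s ω => Y s ω - Y' s ω) t ≤ growthRate L T * controlDist u u' +
      growthRate L T * ∫⁻ s in Icc 0 t, power P (fun s ω => X s ω - X' s ω) s := by
  refine ((hY.sub hY' (ht.1.trans ht.2)).lintegral_sq_le ht).trans ?_
  rw [add_assoc]
  refine (add_le_add_right (four_mul_add_two_mul_le _ _) _).trans ?_
  have h1 := hC.energy_sub_le hu hu' hX hX' ht
  rw [((hX.sub hX').mono ht.2).energy_eq_swap ht.1] at h1
  simp only [stateCharacteristics, sub_self, enorm_zero, ne_eq, OfNat.ofNat_ne_zero,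
    not_false_eq_true, zero_pow, lintegral_const, zero_mul, mul_zero, zero_add]
  refine (mul_le_mul_right h1 _).trans ?_
  have h2 : 4 * (ENNReal.ofReal T + 1) * (2 * ENNReal.ofReal (L ^ 2)) ≤ growthRate L T := by
    rw [coe_growthRate]
    calc _ = 8 * (ENNReal.ofReal T + 1) * ENNReal.ofReal (L ^ 2) := by ring
      _ ≤ _ := by
        gcongr
        norm_num
  rw [← mul_add, add_comm (controlDist u u'), ← mul_assoc]
  exact mul_le_mul_left h2 _

lemma IsSolution.memL2 (h : IsSolution N a b X₀ u X) (hT : 0 ≤ T) : N.MemL2 T X := by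
  obtain ⟨c, hc⟩ := h.memX.representable
  exact hc.memL2 h.memX.progressive hT

lemma IsSolution.represents (h : IsSolution N a b X₀ u X) (hT : 0 ≤ T)
    (hC : CoefficientAssumption T L ua ub a b) (hu : u ∈ admissible T ua ub)
    (h0 : Measurable[N.F₀] X₀) (h0' : MemLp X₀ 2 P) :
    N.Represents (stateCharacteristics a b X₀ u X) X :=
  have h1 := hC.memL2 hT hu (h.memL2 hT)
  ⟨h0, h0', h1.1, h1.2, h.equation⟩

lemma lintegral_sub_sq_le_of_le {α E : Type*} [MeasurableSpace α] {μ : Measure α}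
    [NormedAddCommGroup E] {f g : α → E} (hf : AEStronglyMeasurable f μ) {B : ℝ≥0∞}
    (h1 : ∫⁻ x, ‖f x‖ₑ ^ 2 ∂μ ≤ B) (h2 : ∫⁻ x, ‖g x‖ₑ ^ 2 ∂μ ≤ B) :
    ∫⁻ x, ‖f x - g x‖ₑ ^ 2 ∂μ ≤ 4 * B := by
  refine (lintegral_enorm_sub_sq_le hf).trans ?_
  calc _ ≤ 2 * B + 2 * B := by gcongr
    _ = 4 * B := by ring

/-- A sequence of processes which is Cauchy at a geometric rate converges. -/
lemma exists_memL2_tendsto {Z : ℕ → ℝ → Ω → Vec d} (hT : 0 ≤ T) (hZ : ∀ n, N.MemL2 T (Z n))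
    {C : ℝ≥0∞} (hC : C ≠ ∞) (h : ∀ n i j, n ≤ i → n ≤ j →
      energy P T (fun s ω => Z i s ω - Z j s ω) ≤ C ^ 2 * 4⁻¹ ^ n) :
    ∃ X : ℝ → Ω → Vec d, N.MemL2 T X ∧
      Tendsto (fun n => energy P T fun s ω => Z n s ω - X s ω) atTop (𝓝 0) := by
  set μ := (volume.restrict (Icc 0 T)).prod P
  let F : ℕ → ℝ × Ω → Vec d := fun n p => Z n p.1 p.2
  have hF : ∀ n, MemLp (F n) 2 μ := fun n => by
    refine memLp_two_of_lintegral ((hZ n).progressive.aemeasurable hT).aestronglyMeasurable ?_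
    rw [← (hZ n).progressive.energy_eq_prod hT]
    exact (hZ n).energy_lt_top
  have h1 : (2⁻¹ : ℝ≥0∞) < 1 := ENNReal.inv_lt_one.2 (by norm_num)
  have hcau : ∀ n i j : ℕ, n ≤ i → n ≤ j → eLpNorm (F i - F j) 2 μ < (C + 1) * 2⁻¹ ^ n := by
    intro n i j hi hj
    have h2 : eLpNorm (F i - F j) 2 μ ^ 2 ≤ (C * 2⁻¹ ^ n) ^ 2 := by
      rw [eLpNorm_two_sq, mul_pow, ← pow_mul, mul_comm n 2, pow_mul,
        show (2⁻¹ : ℝ≥0∞) ^ 2 = 4⁻¹ by rw [ENNReal.inv_pow.symm]; norm_num]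
      refine le_trans (le_of_eq ?_) (h n i j hi hj)
      rw [((hZ i).progressive.sub (hZ j).progressive).energy_eq_prod hT]
      rfl
    refine ((ENNReal.pow_le_pow_left_iff two_ne_zero).1 h2).trans_lt ?_
    have h5 : (2⁻¹ : ℝ≥0∞) ^ n ≠ 0 := (ENNReal.pow_pos (by simp) _).ne'
    have h6 : (2⁻¹ : ℝ≥0∞) ^ n ≠ ∞ := ENNReal.pow_ne_top (by simp)
    exact (ENNReal.mul_lt_mul_iff_left h5 h6).2 (ENNReal.lt_add_right hC (by simp))
  have hsum : ∑' n : ℕ, (C + 1) * 2⁻¹ ^ n ≠ ∞ := ennreal_geometric_ne_top (by finiteness) h1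
  -- A limit in L² would only be an equivalence class; the pointwise limit, with a junk value where
  -- there is none, is progressively measurable as it stands.
  let X : ℝ → Ω → Vec d := fun s ω => limUnder atTop fun n => Z n s ω
  have hX : N.Progressive T X := fun t ht =>
    measurable_limUnder_vec fun n => (hZ n).progressive t ht
  have hlim : ∀ᵐ p ∂μ, Tendsto (fun n => F n p) atTop (𝓝 (X p.1 p.2)) := by
    filter_upwards [Lp.ae_tendsto_of_cauchy_eLpNorm (fun n => (hF n).1) one_le_two hsum hcau]
      with p hp using tendsto_nhds_limUnder hp
  have htend := Lp.cauchy_tendsto_of_tendsto (fun n => (hF n).1) (fun p => X p.1 p.2)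
    hsum hcau hlim
  have hXL := Lp.memLp_of_cauchy_tendsto one_le_two hF (fun p => X p.1 p.2)
    (hX.aemeasurable hT).aestronglyMeasurable htend
  refine ⟨X, ⟨hX, ?_⟩, ?_⟩
  · rw [hX.energy_eq_prod hT]
    exact lintegral_lt_top_of_memLp hXL
  · refine (tendsto_lintegral_sq_iff.1 htend).congr fun n => ?_
    rw [((hZ n).progressive.sub hX).energy_eq_prod hT]
    rfl

/-- Existence of solutions of the state equation. -/
theorem exists_isSolution (hT : 0 < T) (hC : CoefficientAssumption T L ua ub a b)
    (hu : u ∈ admissible T ua ub) (h0 : Measurable[N.F₀] X₀) (h0' : MemLp X₀ 2 P) :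
    ∃ X, IsSolution N a b X₀ u X := by
  set K := growthRate L T
  set A := growthConst P L T X₀
  have hA : A ≠ ∞ := growthConst_ne_top h0'
  have hstep : ∀ Z : {Z : ℝ → Ω → Vec d // N.MemL2 T Z},
      ∃ Y : {Y : ℝ → Ω → Vec d // N.MemL2 T Y},
        N.Represents (stateCharacteristics a b X₀ u Z.1) Y.1 := by
    intro Z
    have h1 := hC.memL2 hT.le hu Z.2
    obtain ⟨Y, -, hYp, hY⟩ := N.exists_represents (c := stateCharacteristics a b X₀ u Z.1) hT h0 h0'
      h1.1 h1.2
    exact ⟨⟨Y, hY.memL2 hYp hT.le⟩, hY⟩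
  choose Φ hΦ using hstep
  have hzero : N.MemL2 T fun _ _ => (0 : Vec d) :=
    ⟨fun _ _ => measurable_const, by simp [energy]⟩
  -- Picard iteration started from the zero process.
  let Z : ℕ → {Z : ℝ → Ω → Vec d // N.MemL2 T Z} := fun n => Φ^[n] ⟨_, hzero⟩
  have hZ : ∀ n, N.Represents (stateCharacteristics a b X₀ u (Z n).1) (Z (n + 1)).1 := by
    intro n
    simp only [Z, Function.iterate_succ_apply']
    exact hΦ _
  have hbound : ∀ n, ∀ t ∈ Icc 0 T, power P (Z n).1 t ≤ 2 * A * expWeight K t := by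
    intro n
    induction n with
    | zero => intro t _; simp [Z, power]
    | succ n ih =>
      intro t ht
      have := gronwall_step (δ := 0) hA (by simp) ht (φ := power P (Z n).1) (by simpa using ih)
      rw [zero_mul, add_zero] at this
      exact (power_le_of_represents hC hu (Z n).2.progressive (hZ n) ht).trans this
  -- For n = 0 the bound 2A on each iterate gives 4 · 2A = 8A; every further iteration gains 1/4 in
  -- the weighted norm. Arbitrary offsets i, j make this a Cauchy estimate directly.
  have hcau : ∀ n i j, ∀ t ∈ Icc 0 T,
      power P (fun s ω => (Z (n + i)).1 s ω - (Z (n + j)).1 s ω) t ≤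
        8 * A * 4⁻¹ ^ n * expWeight K t := by
    intro n
    induction n with
    | zero =>
      intro i j t ht
      rw [zero_add, zero_add, pow_zero, mul_one]
      refine (lintegral_sub_sq_le_of_le (((Z i).2.progressive.adapted ht).mono
        (N.filtration_le t) le_rfl).aestronglyMeasurable (hbound i t ht) (hbound j t ht)).trans
        (le_of_eq ?_)
      ring
    | succ n ih =>
      intro i j t ht
      rw [Nat.add_right_comm n 1 i, Nat.add_right_comm n 1 j]
      refine (power_sub_le_of_represents hC hu hu (Z (n + i)).2.progressive
        (Z (n + j)).2.progressive (hZ _) (hZ _) ht).trans ?_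
      rw [controlDist_self, mul_zero, zero_add, pow_succ, ← mul_assoc]
      exact lintegral_le_of_le_expWeight (ENNReal.mul_ne_top (by finiteness)
        (ENNReal.pow_ne_top (by simp))) ht (ih i j)
  obtain ⟨X', hX', hlim⟩ : ∃ X' : ℝ → Ω → Vec d, N.MemL2 T X' ∧
      Tendsto (fun n => energy P T fun s ω => (Z n).1 s ω - X' s ω) atTop (𝓝 0) := by
    set D := ENNReal.ofReal T * (8 * A * expWeight K T) with hD
    have hDt : D ≠ ∞ := by
      have : expWeight K T ≠ ∞ := ENNReal.ofReal_ne_top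
      finiteness
    refine exists_memL2_tendsto hT.le (fun n => (Z n).2) (C := D ^ (1 / 2 : ℝ))
      (by finiteness) fun n i j hi hj => ?_
    obtain ⟨i, rfl⟩ := Nat.exists_eq_add_of_le hi
    obtain ⟨j, rfl⟩ := Nat.exists_eq_add_of_le hj
    rw [((Z _).2.progressive.sub (Z _).2.progressive).energy_eq_swap hT.le,
      ← ENNReal.rpow_natCast, ← ENNReal.rpow_mul]
    norm_num
    refine (setLIntegral_Icc_le (M := 8 * A * 4⁻¹ ^ n * expWeight K T) fun t ht =>
      (hcau n i j t ht).trans (mul_le_mul_right (expWeight_mono K ht.2) _)).trans (le_of_eq ?_)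
    rw [hD]
    ring
  have hco := hC.memL2 hT.le hu hX'
  -- The limit X' need not have continuous paths. Applying the fixed point map once more gives a
  -- continuous process X, and X = X' in energy because both are limits of the iterates.
  obtain ⟨X, hXc, hXp, hX⟩ := N.exists_represents (c := stateCharacteristics a b X₀ u X') hT h0 h0'
    hco.1 hco.2
  have hXL := hX.memL2 hXp hT.le
  have h1 : Tendsto (fun n => energy P T fun s ω => X s ω - (Z (n + 1)).1 s ω) atTop (𝓝 0) := by
    have h2 : ∀ n, energy P T (fun s ω => X s ω - (Z (n + 1)).1 s ω) ≤
        ENNReal.ofReal T * (K * energy P T fun s ω => (Z n).1 s ω - X' s ω) := by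
      intro n
      rw [(hXp.sub (Z (n + 1)).2.progressive).energy_eq_swap hT.le]
      refine setLIntegral_Icc_le fun t ht => (power_sub_le_of_represents hC hu hu hX'.progressive
        (Z n).2.progressive hX (hZ n) ht).trans ?_
      rw [controlDist_self, mul_zero, zero_add]
      refine mul_le_mul_right (le_trans (le_of_eq ?_) (energy_mono _ ht.2)) _
      rw [(((Z n).2.progressive.sub hX'.progressive).mono ht.2).energy_eq_swap ht.1]
      refine lintegral_congr fun s => lintegral_congr fun ω => ?_
      rw [← enorm_neg, neg_sub]
    have h3 := ENNReal.Tendsto.const_mul (ENNReal.Tendsto.const_mul hlim (a := (K : ℝ≥0∞))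
      (Or.inr ENNReal.coe_ne_top)) (a := ENNReal.ofReal T) (Or.inr ENNReal.ofReal_ne_top)
    rw [mul_zero, mul_zero] at h3
    exact tendsto_of_tendsto_of_tendsto_of_le_of_le tendsto_const_nhds h3 (fun _ => zero_le) h2
  have h2 : energy P T (fun s ω => X' s ω - X s ω) = 0 := by
    have h3 : Tendsto (fun _ : ℕ => energy P T fun s ω => X' s ω - X s ω) atTop (𝓝 0) := by
      refine tendsto_zero_of_le_two_mul_add h1 (hlim.comp (tendsto_add_atTop_nat 1)) fun n => ?_
      refine le_trans (le_of_eq (energy_congr fun s _ ω => ?_))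
        ((hXp.sub (Z (n + 1)).2.progressive).energy_add_le
          ((Z (n + 1)).2.progressive.sub hX'.progressive) hT.le)
      rw [sub_add_sub_cancel, norm_sub_rev]
    exact tendsto_nhds_unique tendsto_const_nhds h3
  -- By the Lipschitz estimate the coefficients along X' and X also agree in energy, so X is
  -- represented by its own coefficients.
  have h3 := hC.energy_sub_le hu hu hX'.progressive hXp ⟨hT.le, le_rfl⟩
  rw [h2, controlDist_self, add_zero, mul_zero, nonpos_iff_eq_zero, add_eq_zero] at h3
  have hco' := hC.memL2 hT.le hu hXL
  have hrep := hX.congr hT.le hco'.1 hco'.2 h3.1 h3.2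
  exact ⟨X, ⟨hXp, Eventually.of_forall hXc, _, hX⟩, hrep.equation⟩

/-- Continuous dependence of the solutions on the control. -/
theorem IsSolution.power_sub_le (hT : 0 ≤ T) (hC : CoefficientAssumption T L ua ub a b)
    (hu : u ∈ admissible T ua ub) (hu' : u' ∈ admissible T ua ub) (h0 : Measurable[N.F₀] X₀)
    (h0' : MemLp X₀ 2 P) (hX : IsSolution N a b X₀ u X) (hX' : IsSolution N a b X₀ u' X')
    {t : ℝ} (ht : t ∈ Icc 0 T) :
    power P (fun s ω => X s ω - X' s ω) t ≤
      2 * (growthRate L T * controlDist u u') * expWeight (growthRate L T) t := by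
  have h1 := hX.represents hT hC hu h0 h0'
  have h2 := hX'.represents hT hC hu' h0 h0'
  obtain ⟨M, hM, hle⟩ := (h1.sub h2 hT).exists_power_le
  refine gronwall ?_ hM hle (fun t ht => power_sub_le_of_represents hC hu hu' hX.memX.progressive
    hX'.memX.progressive h1 h2 ht) ht
  rw [controlDist_eq]
  finiteness

/-- A priori bound for the solutions. -/
theorem IsSolution.power_le (hT : 0 ≤ T) (hC : CoefficientAssumption T L ua ub a b)
    (hu : u ∈ admissible T ua ub) (h0 : Measurable[N.F₀] X₀) (h0' : MemLp X₀ 2 P)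
    (hX : IsSolution N a b X₀ u X) {t : ℝ} (ht : t ∈ Icc 0 T) :
    power P X t ≤ 2 * growthConst P L T X₀ * expWeight (growthRate L T) t := by
  have h1 := hX.represents hT hC hu h0 h0'
  obtain ⟨M, hM, hle⟩ := h1.exists_power_le
  exact gronwall (growthConst_ne_top h0') hM hle
    (fun t ht => power_le_of_represents hC hu hX.memX.progressive h1 ht) ht

/-- Two continuous functions on `[0, T]`, `T > 0`, which agree at the rational times in `(0, T)`
agree. -/
lemma eqOn_Icc_of_rat {E : Type*} [TopologicalSpace E] [T2Space E] {f g : ℝ → E} (hT : 0 < T)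
    (hf : ContinuousOn f (Icc 0 T)) (hg : ContinuousOn g (Icc 0 T))
    (h : ∀ q : ℚ, (q : ℝ) ∈ Icc 0 T → f q = g q) : EqOn f g (Icc 0 T) := by
  have hcl : Icc 0 T ⊆ closure (Ioo 0 T ∩ range ((↑) : ℚ → ℝ)) := by
    rw [← closure_Ioo hT.ne]
    exact closure_minimal ((Rat.denseRange_cast (𝕜 := ℝ)).open_subset_closure_inter isOpen_Ioo)
      isClosed_closure
  refine EqOn.of_subset_closure (s := Ioo 0 T ∩ range ((↑) : ℚ → ℝ)) ?_ hf hg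
    (fun x hx => Ioo_subset_Icc_self hx.1) hcl
  rintro _ ⟨hx, q, rfl⟩
  exact h q (Ioo_subset_Icc_self hx)

/-- Uniqueness of solutions of the state equation. -/
theorem IsSolution.indistinguishable (hT : 0 < T) (hC : CoefficientAssumption T L ua ub a b)
    (hu : u ∈ admissible T ua ub) (h0 : Measurable[N.F₀] X₀) (h0' : MemLp X₀ 2 P)
    (hX : IsSolution N a b X₀ u X) (hX' : IsSolution N a b X₀ u X') :
    ∀ᵐ ω ∂P, ∀ t ∈ Icc (0 : ℝ) T, X t ω = X' t ω := by
  -- Stability with equal controls gives equality almost surely at each fixed time; countably many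
  -- times and path continuity give indistinguishability.
  have h1 : ∀ᵐ ω ∂P, ∀ q : ℚ, (q : ℝ) ∈ Icc 0 T → X q ω = X' q ω := by
    rw [ae_all_iff]
    intro q
    by_cases hq : (q : ℝ) ∈ Icc 0 T
    · have h2 := hX.power_sub_le hT.le hC hu hu h0 h0' hX' hq
      rw [controlDist_self, mul_zero, mul_zero, zero_mul, nonpos_iff_eq_zero, power,
        lintegral_eq_zero_iff' (((((hX.memX.progressive.sub hX'.memX.progressive).adapted hq).mono
          (N.filtration_le _) le_rfl).aemeasurable).enorm.pow_const 2)] at h2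
      filter_upwards [h2] with ω hω _
      simpa [sub_eq_zero] using hω
    · exact Eventually.of_forall fun ω h => absurd h hq
  filter_upwards [h1, hX.memX.continuous_paths, hX'.memX.continuous_paths] with ω h2 h3 h4
  exact eqOn_Icc_of_rat hT h3 h4 h2

lemma normCL2_le {B : ℝ≥0∞} (h : ∀ t ∈ Icc 0 T, power P Y t ≤ B ^ 2) : normCL2 P T Y ≤ B := by
  refine iSup₂_le fun t ht => ?_
  rw [← ENNReal.pow_le_pow_left_iff two_ne_zero, eLpNorm_two_sq]
  exact h t ht

lemma Characteristics.norm_sq (c : Characteristics Ω d m) (P : Measure Ω) (T : ℝ) :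
    c.norm P T ^ 2 =
      (∫⁻ ω, ‖c.init ω‖ₑ ^ 2 ∂P) + (energy P T c.drift + energy P T c.diffusion) := by
  rw [Characteristics.norm, ← ENNReal.rpow_natCast, ← ENNReal.rpow_mul]
  norm_num

/-- The squared Lipschitz constant of the control-to-state map. -/
noncomputable def lipConstSq (L T : ℝ) : ℝ≥0∞ :=
  2 * growthRate L T * expWeight (growthRate L T) T

/-- The initial values cancel in the difference of the representing triples, so the norm is the
energy of the coefficient differences: 2 L² times the energy of X - X', itself at most T times the
uniform stability bound, plus the distance of the controls. -/
lemma IsSolution.normX_sub_sq_le (hT : 0 ≤ T) (hC : CoefficientAssumption T L ua ub a b)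
    (hu : u ∈ admissible T ua ub) (hu' : u' ∈ admissible T ua ub) (h0 : Measurable[N.F₀] X₀)
    (h0' : MemLp X₀ 2 P) (hX : IsSolution N a b X₀ u X) (hX' : IsSolution N a b X₀ u' X') :
    N.normX (X - X') ^ 2 ≤ 2 * ENNReal.ofReal (L ^ 2) *
      (ENNReal.ofReal T * lipConstSq L T + 1) * controlDist u u' := by
  have hp := hX.memX.progressive.sub hX'.memX.progressive
  have hrep := (hX.represents hT hC hu h0 h0').sub (hX'.represents hT hC hu' h0 h0') hT
  have hmem : N.MemX (X - X') := by
    refine ⟨hp, ?_, _, hrep⟩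
    filter_upwards [hX.memX.continuous_paths, hX'.memX.continuous_paths] with ω h1 h2
      using h1.sub h2
  rw [Noise.Represents.normX_eq (Y := X - X') hrep hmem hT, Characteristics.norm_sq]
  simp only [stateCharacteristics, sub_self, enorm_zero, ne_eq, OfNat.ofNat_ne_zero,
    not_false_eq_true, zero_pow, lintegral_const, zero_mul, zero_add]
  refine (hC.energy_sub_le hu hu' hX.memX.progressive hX'.memX.progressive ⟨hT, le_rfl⟩).trans ?_
  rw [mul_assoc _ (_ + _)]
  gcongr
  rw [add_mul, one_mul, mul_assoc]
  gcongr
  rw [hp.energy_eq_swap hT]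
  refine setLIntegral_Icc_le fun t ht =>
    (hX.power_sub_le hT hC hu hu' h0 h0' hX' ht).trans ?_
  rw [lipConstSq, ← mul_assoc 2, mul_right_comm]
  gcongr
  exact expWeight_mono _ ht.2

/-- The solution is represented by its own coefficients, whose energy is controlled by the growth
estimate and the uniform second moment bound. -/
lemma IsSolution.normX_sq_le (hT : 0 ≤ T) (hC : CoefficientAssumption T L ua ub a b)
    (hu : u ∈ admissible T ua ub) (h0 : Measurable[N.F₀] X₀) (h0' : MemLp X₀ 2 P)
    (hX : IsSolution N a b X₀ u X) :
    N.normX X ^ 2 ≤ ∫⁻ ω, ‖X₀ ω‖ₑ ^ 2 ∂P + 4 * ENNReal.ofReal (L ^ 2) * (1 + ENNReal.ofReal T *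
      (2 * growthConst P L T X₀ * expWeight (growthRate L T) T)) := by
  have hrep := hX.represents hT hC hu h0 h0'
  rw [hrep.normX_eq hX.memX hT, Characteristics.norm_sq]
  refine add_le_add_right ((hC.energy_le hu hX.memX.progressive ⟨hT, le_rfl⟩).trans ?_) _
  gcongr
  rw [hX.memX.progressive.energy_eq_swap hT]
  refine setLIntegral_Icc_le fun t ht => (hX.power_le hT hC hu h0 h0' ht).trans ?_
  gcongr
  exact expWeight_mono _ ht.2

lemma controlToState_isSolution (hT : 0 < T) (hC : CoefficientAssumption T L ua ub a b)
    (hu : u ∈ admissible T ua ub) (h0 : Measurable[N.F₀] X₀) (h0' : MemLp X₀ 2 P) :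
    IsSolution N a b X₀ u (controlToState N a b X₀ u) :=
  Classical.epsilon_spec (exists_isSolution hT hC hu h0 h0')

/-- The real square root of a finite extended nonnegative number. -/
lemma ofReal_sqrt_toReal_sq {x : ℝ≥0∞} (hx : x ≠ ∞) :
    ENNReal.ofReal √x.toReal ^ 2 = x := by
  rw [← ENNReal.ofReal_pow (Real.sqrt_nonneg _), Real.sq_sqrt ENNReal.toReal_nonneg,
    ENNReal.ofReal_toReal hx]

end StateEquation

end SDEControl
-- The theorem
open SDEControl in
theorem mainTheorem7 (L T : ℝ) (hL : 0 < L) (hT : 0 < T) :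
    ∃ C₁ C₁' : ℝ, 0 ≤ C₁ ∧ 0 ≤ C₁' ∧
      ∀ (Ω : Type*) [mΩ : MeasurableSpace Ω] (P : Measure Ω) [IsProbabilityMeasure P]
        (d : ℕ) (X₀ : Ω → Vec d), MemLp X₀ 2 P →
      ∃ C₂ C₂' : ℝ, 0 ≤ C₂ ∧ 0 ≤ C₂' ∧
        ∀ (m r : ℕ) (N : Noise P T m) (ua ub : Vec r)
          (a : Vec d → Vec r → ℝ → Vec d) (b : Vec d → Vec r → ℝ → Mat d m),
        Measurable[N.F₀] X₀ → (∀ i, ua i ≤ ub i) → CoefficientAssumption T L ua ub a b →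
          -- the map `𝒮` is well defined on `𝒰_ad`, with values in `C([0,T]; L²(Ω; ℝᵈ))`
          (∀ u ∈ admissible T ua ub,
            IsUniqueSolution N a b X₀ u (controlToState N a b X₀ u) ∧
            MemCL2 P T (controlToState N a b X₀ u)) ∧
          -- Lipschitz continuity and boundedness in `C([0,T]; L²(Ω; ℝᵈ))`
          (∀ u ∈ admissible T ua ub, ∀ u' ∈ admissible T ua ub,
            normCL2 P T (controlToState N a b X₀ u - controlToState N a b X₀ u')
              ≤ ENNReal.ofReal (C₁ * ‖u - u'‖)) ∧
          (∀ u ∈ admissible T ua ub,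
            normCL2 P T (controlToState N a b X₀ u) ≤ ENNReal.ofReal C₂) ∧
          -- Lipschitz continuity and boundedness in `𝒳`
          (∀ u ∈ admissible T ua ub, ∀ u' ∈ admissible T ua ub,
            N.normX (controlToState N a b X₀ u - controlToState N a b X₀ u')
              ≤ ENNReal.ofReal (C₁' * ‖u - u'‖)) ∧
          (∀ u ∈ admissible T ua ub,
            N.normX (controlToState N a b X₀ u) ≤ ENNReal.ofReal C₂') := by
  have hlip : lipConstSq L T ≠ ∞ := by
    have : expWeight (growthRate L T) T ≠ ∞ := ENNReal.ofReal_ne_top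
    rw [lipConstSq]
    finiteness
  set Q := 2 * ENNReal.ofReal (L ^ 2) * (ENNReal.ofReal T * lipConstSq L T + 1)
  have hQ : Q ≠ ∞ := by finiteness
  -- All estimates are for squared norms, so the constants are square roots; these two are built
  -- from L and T alone.
  refine ⟨√(lipConstSq L T).toReal, √Q.toReal, Real.sqrt_nonneg _, Real.sqrt_nonneg _, ?_⟩
  intro Ω _ P _ d X₀ hX₀
  have hA := growthConst_ne_top (L := L) (T := T) hX₀
  have hX₀' := (lintegral_lt_top_of_memLp hX₀).ne
  set R := 2 * growthConst P L T X₀ * expWeight (growthRate L T) T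
  have hR : R ≠ ∞ := by
    have : expWeight (growthRate L T) T ≠ ∞ := ENNReal.ofReal_ne_top
    finiteness
  set S := ∫⁻ ω, ‖X₀ ω‖ₑ ^ 2 ∂P + 4 * ENNReal.ofReal (L ^ 2) * (1 + ENNReal.ofReal T * R)
  have hS : S ≠ ∞ := by finiteness
  -- `R` and `S` involve the initial value only through its second moment, hence can be fixed before
  -- the noise, the box and the coefficients.
  refine ⟨√R.toReal, √S.toReal, Real.sqrt_nonneg _, Real.sqrt_nonneg _, ?_⟩
  intro m r N ua ub a b h0 _ hC
  have hsol : ∀ u ∈ admissible T ua ub, IsSolution N a b X₀ u (controlToState N a b X₀ u) :=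
    fun u hu => controlToState_isSolution hT hC hu h0 hX₀
  refine ⟨fun u hu => ⟨⟨hsol u hu, fun Z hZ =>
      (hsol u hu).indistinguishable hT hC hu h0 hX₀ hZ⟩,
      ((hsol u hu).represents hT.le hC hu h0 hX₀).memCL2⟩,
    fun u hu u' hu' => normCL2_le fun t ht => ?_, fun u hu => normCL2_le fun t ht => ?_,
    fun u hu u' hu' => ?_, fun u hu => ?_⟩
  · refine ((hsol u hu).power_sub_le hT.le hC hu hu' h0 hX₀ (hsol u' hu') ht).trans ?_
    rw [ENNReal.ofReal_mul (Real.sqrt_nonneg _), mul_pow, ofReal_sqrt_toReal_sq hlip,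
      ← controlDist_eq, lipConstSq, ← mul_assoc 2, mul_right_comm]
    gcongr
    exact expWeight_mono _ ht.2
  · rw [ofReal_sqrt_toReal_sq hR]
    exact ((hsol u hu).power_le hT.le hC hu h0 hX₀ ht).trans
      (mul_le_mul_right (expWeight_mono _ ht.2) _)
  · rw [← ENNReal.pow_le_pow_left_iff two_ne_zero, ENNReal.ofReal_mul (Real.sqrt_nonneg _),
      mul_pow, ofReal_sqrt_toReal_sq hQ, ← controlDist_eq]
    exact (hsol u hu).normX_sub_sq_le hT.le hC hu hu' h0 hX₀ (hsol u' hu')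
  · rw [← ENNReal.pow_le_pow_left_iff two_ne_zero, ofReal_sqrt_toReal_sq hS]
    exact (hsol u hu).normX_sq_le hT.le hC hu h0 hX₀
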